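/- Fix an integer $k\ge 1$, let $q=e^{\pi i/(k+2)}$, write $[n]=\frac{q^n-q^{-n}}{q-q^{-1}}$ and $\delta=-[2]=-q-q^{-1}$. Let $\mathcal D$ be the strict monoidal category with objects $0,1,2,\dots$ whose morphisms $m\to n$ are the planar (crossingless) diagrams in a rectangle with $m$ points at the bottom and $n$ points at the top, closed loops being allowed, up to isotopy; composition is vertical stacking and the tensor product is horizontal juxtaposition. (Equivalently, $\mathcal D$ is the free strict monoidal category on one object $1$ and morphisms $\cup:0\to 2$, $\cap:2\to 0$ subject to the two zigzag identities.) Let $TL$ be the additive and idempotent completion of the quotient of the $\mathbb C$-linearization of $\mathcal D$ by the relation that every loop equals $\delta$. The Jones–Wenzl projections $f_i:i\to i$, $0\le i\le k+1$, are given by $f_0=1_0$, $f_1=1_1$ and $$f_i=f_{i-1}\otimes 1_1+\tfrac{[i-1]}{[i]}\,(f_{i-1}\otimes 1_1)\circ(1_{i-2}\otimes(\cup\circ\cap))\circ(f_{i-1}\otimes 1_1)\qquad(i\ge 2);$$ they are idempotents and define objects $F_i=(i,f_i)$ of $TL$, with $F_0=\mathbb 1$. Let $\widetilde{TL}$ be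 the quotient of $TL$ by the two-sided tensor ideal of morphisms generated by (the identity of) $F_{k+1}$. For $i+j\le k$ let $\pi_{i,j}=f_{i+j}\circ(f_i\otimes f_j):F_i\otimes F_j\to F_{i+j}$. Put $\Sigma=\bigoplus_{i=0}^k F_i$ in $\widetilde{TL}$, let $u:\mathbb 1=F_0\to\Sigma$ be the inclusion, and let $m:\Sigma\otimes\Sigma\to\Sigma$ be the morphism whose component on $F_i\otimes F_j$ is $\pi_{i,j}$ followed by the inclusion $F_{i+j}\to\Sigma$ if $i+j\le k$, and zero otherwise. Let $n:\Sigma\to F_k$ be the projection. Then $(\Sigma,u,m)$ is an algebra object of the monoidal category $\widetilde{TL}$, $\Sigma$ has a left dual, that is, an object $\Sigma^\vee$ with an evaluation $\Sigma^\vee\otimes\Sigma\to\mathbb 1$ and a coevaluation $c_\Sigma:\mathbb 1\to\Sigma\otimes\Sigma^\vee$ satisfying the triangle identities, and $(F_k,n)$ is a Frobenius structure on $\Sigma$: for every choice of the left dual the morphism $$\varphi:\ \Sigma\xrightarrow{\,1_\Sigma\otimes c_\Sigma\,}\Sigma\otimes\Sigma\otimes\Sigma^\vee\xrightarrow{\,(n\circ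 m)\otimes 1_{\Sigma^\vee}\,}F_k\otimes\Sigma^\vee$$ is an isomorphism. -/

import Mathlib

open CategoryTheory MonoidalCategory Limits

set_option linter.unusedSimpArgs false
set_option linter.unusedVariables false

namespace TLJ

noncomputable section

/-- Formal planar diagrams with `m` points at the bottom and `n` points at the top, built from
vertical strands, the cup and the cap by stacking (`comp f g` has `g` on top of `f`) and by
horizontal juxtaposition. -/
inductive Word : ℕ → ℕ → Type
  | ident {m n : ℕ} (h : m = n) : Word m n
  | cup : Word 0 2
  | cap : Word 2 0
  | comp {l m n : ℕ} (f : Word l m) (g : Word m n) : Word l n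
  | tensor {a b c d m n : ℕ} (f : Word a b) (g : Word c d)
      (hm : m = a + c) (hn : n = b + d) : Word m n

namespace Word

/-- Isotopy of planar diagrams, as the congruence on formal diagrams generated by the axioms of a
strict monoidal category and by the two zigzag (straightening) relations. No relation removes a
closed loop. -/
inductive Rel : ∀ {m n : ℕ}, Word m n → Word m n → Prop
  | refl {m n : ℕ} (f : Word m n) : Rel f f
  | symm {m n : ℕ} {f g : Word m n} : Rel f g → Rel g f
  | trans {m n : ℕ} {f g h : Word m n} : Rel f g → Rel g h → Rel f h
  | comp_congr {l m n : ℕ} {f f' : Word l m} {g g' : Word m n} :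
      Rel f f' → Rel g g' → Rel (comp f g) (comp f' g')
  | tensor_congr {a b c d m n : ℕ} {f f' : Word a b} {g g' : Word c d}
      (hm : m = a + c) (hn : n = b + d) :
      Rel f f' → Rel g g' → Rel (tensor f g hm hn) (tensor f' g' hm hn)
  | id_comp {m n : ℕ} (f : Word m n) : Rel (comp (ident rfl) f) f
  | comp_id {m n : ℕ} (f : Word m n) : Rel (comp f (ident rfl)) f
  | assoc {a b c d : ℕ} (f : Word a b) (g : Word b c) (h : Word c d) :
      Rel (comp (comp f g) h) (comp f (comp g h))
  | tensor_id {a b m : ℕ} (hm : m = a + b) :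
      Rel (tensor (ident rfl) (ident rfl) hm hm) (ident rfl)
  | tensor_comp {a₁ a₂ a₃ b₁ b₂ b₃ m n : ℕ}
      (f₁ : Word a₁ a₂) (f₂ : Word a₂ a₃) (g₁ : Word b₁ b₂) (g₂ : Word b₂ b₃)
      (hm : m = a₁ + b₁) (hn : n = a₃ + b₃) :
      Rel (tensor (comp f₁ f₂) (comp g₁ g₂) hm hn)
        (comp (tensor f₁ g₁ hm rfl) (tensor f₂ g₂ rfl hn))
  | tensor_assoc {a₁ a₂ a₃ b₁ b₂ b₃ m n : ℕ}
      (f₁ : Word a₁ b₁) (f₂ : Word a₂ b₂) (f₃ : Word a₃ b₃)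
      (hm : m = a₁ + a₂ + a₃) (hn : n = b₁ + b₂ + b₃)
      (hm' : m = a₁ + (a₂ + a₃)) (hn' : n = b₁ + (b₂ + b₃)) :
      Rel (tensor (tensor f₁ f₂ rfl rfl) f₃ hm hn) (tensor f₁ (tensor f₂ f₃ rfl rfl) hm' hn')
  | unit_tensor {m n : ℕ} (f : Word m n) (hm : m = 0 + m) (hn : n = 0 + n) :
      Rel (tensor (ident (rfl : 0 = 0)) f hm hn) f
  | tensor_unit {m n : ℕ} (f : Word m n) (hm : m = m + 0) (hn : n = n + 0) :
      Rel (tensor f (ident (rfl : 0 = 0)) hm hn) f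
  | zigzag_left :
      Rel (comp (tensor cup (ident (rfl : 1 = 1)) (rfl : 1 = 0 + 1) (rfl : 3 = 2 + 1))
        (tensor (ident (rfl : 1 = 1)) cap (rfl : 3 = 1 + 2) (rfl : 1 = 1 + 0))) (ident rfl)
  | zigzag_right :
      Rel (comp (tensor (ident (rfl : 1 = 1)) cup (rfl : 1 = 1 + 0) (rfl : 3 = 1 + 2))
        (tensor cap (ident (rfl : 1 = 1)) (rfl : 3 = 2 + 1) (rfl : 1 = 0 + 1))) (ident rfl)

/-- Isotopy as an equivalence relation. -/
def setoid (m n : ℕ) : Setoid (Word m n) where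
  r := Rel
  iseqv := ⟨Rel.refl, Rel.symm, Rel.trans⟩

end Word

/-- The category of planar diagrams up to isotopy; its objects are the natural numbers. It is the
free (strict) pivotal monoidal category on one self-dual generator. -/
@[ext]
structure Diag where
  n : ℕ

namespace Diag

/-- Planar diagrams up to isotopy. -/
@[ext]
structure Hom (X Y : Diag) where
  q : _root_.Quotient (Word.setoid X.n Y.n)

/-- The class of a formal diagram. -/
def mk' {X Y : Diag} (w : Word X.n Y.n) : Hom X Y := ⟨_root_.Quotient.mk _ w⟩

theorem sound {X Y : Diag} {v w : Word X.n Y.n} (h : Word.Rel v w) : mk' (X := X) (Y := Y) v = mk' w :=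
  congrArg Hom.mk (Quotient.sound h)

theorem ind {X Y : Diag} {P : Hom X Y → Prop} (h : ∀ w, P (mk' w)) (f : Hom X Y) : P f := by
  obtain ⟨q⟩ := f
  induction q using Quotient.inductionOn with | _ w => exact h w

/-- Vertical stacking. -/
def comp' {X Y Z : Diag} (f : Hom X Y) (g : Hom Y Z) : Hom X Z :=
  ⟨Quotient.map₂ Word.comp (fun _ _ h _ _ h' => Word.Rel.comp_congr h h') f.q g.q⟩

instance : Category Diag where
  Hom := Hom
  id X := mk' (.ident rfl)
  comp := comp'
  id_comp f := by
    induction f using ind with | _ f => exact sound (.id_comp f)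
  comp_id f := by
    induction f using ind with | _ f => exact sound (.comp_id f)
  assoc f g h := by
    induction f using ind with | _ f =>
    induction g using ind with | _ g =>
    induction h using ind with | _ h => exact sound (.assoc f g h)

/-- Horizontal juxtaposition. -/
def tensorHom' {X₁ Y₁ X₂ Y₂ : Diag} (f : X₁ ⟶ Y₁) (g : X₂ ⟶ Y₂) :
    (⟨X₁.n + X₂.n⟩ : Diag) ⟶ ⟨Y₁.n + Y₂.n⟩ :=
  ⟨Quotient.map₂ (fun f g => Word.tensor f g rfl rfl)
    (fun _ _ h _ _ h' => Word.Rel.tensor_congr rfl rfl h h') (Hom.q f) (Hom.q g)⟩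

/-- The identity diagram between equal objects. -/
def castIso {X Y : Diag} (h : X.n = Y.n) : X ≅ Y where
  hom := mk' (.ident h)
  inv := mk' (.ident h.symm)
  hom_inv_id := by
    obtain ⟨m⟩ := X; obtain ⟨n⟩ := Y; obtain rfl : m = n := h; exact sound (.id_comp _)
  inv_hom_id := by
    obtain ⟨m⟩ := X; obtain ⟨n⟩ := Y; obtain rfl : m = n := h; exact sound (.id_comp _)

instance : MonoidalCategoryStruct Diag where
  tensorObj X Y := ⟨X.n + Y.n⟩
  tensorHom := tensorHom'
  whiskerLeft X _ _ f := tensorHom' (𝟙 X) f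
  whiskerRight f Y := tensorHom' f (𝟙 Y)
  tensorUnit := ⟨0⟩
  associator _ _ _ := castIso (Nat.add_assoc _ _ _)
  leftUnitor _ := castIso (Nat.zero_add _)
  rightUnitor _ := castIso (Nat.add_zero _)

end Diag

namespace Word.Rel

theorem tensor_comp_ident {a b c d m n n' : ℕ} (f : Word a b) (g : Word c d)
    (hm : m = a + c) (hn : n = b + d) (h : n = n') :
    Rel (comp (tensor f g hm hn) (ident h)) (tensor f g hm (h.symm.trans hn)) := by
  subst h; exact .comp_id _

theorem ident_comp_tensor {a b c d m m' n : ℕ} (f : Word a b) (g : Word c d)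
    (hm : m = a + c) (hn : n = b + d) (h : m' = m) :
    Rel (comp (ident h) (tensor f g hm hn)) (tensor f g (h.trans hm) hn) := by
  subst h; exact .id_comp _

theorem tensor_ident {a b c d m n : ℕ} (h : a = b) (h' : c = d) (hm : m = a + c) (hn : n = b + d) :
    Rel (tensor (ident h) (ident h') hm hn) (ident (by omega)) := by
  subst h; subst h'; subst hm; subst hn; exact .tensor_id rfl

theorem ident_comp_ident {a b c : ℕ} (h : a = b) (h' : b = c) :
    Rel (comp (ident h) (ident h')) (ident (h.trans h')) := by
  subst h; exact .id_comp _

end Word.Rel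

namespace Diag
open Word.Rel

instance : MonoidalCategory Diag := MonoidalCategory.ofTensorHom
  (id_tensorHom_id := fun _ _ => sound (.tensor_id rfl))
  (id_tensorHom := fun _ _ _ _ => rfl)
  (tensorHom_id := fun _ _ => rfl)
  (tensorHom_comp_tensorHom := fun f₁ f₂ g₁ g₂ => by
    induction f₁ using ind with | _ f₁ =>
    induction f₂ using ind with | _ f₂ =>
    induction g₁ using ind with | _ g₁ =>
    induction g₂ using ind with | _ g₂ =>
    exact sound (Word.Rel.tensor_comp f₁ g₁ f₂ g₂ rfl rfl).symm)
  (associator_naturality := fun f₁ f₂ f₃ => by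
    induction f₁ using ind with | _ f₁ =>
    induction f₂ using ind with | _ f₂ =>
    induction f₃ using ind with | _ f₃ =>
    exact sound ((tensor_comp_ident _ _ _ _ _).trans
      ((Word.Rel.tensor_assoc _ _ _ _ _ (Nat.add_assoc _ _ _) rfl).trans
        (ident_comp_tensor _ _ _ _ _).symm)))
  (leftUnitor_naturality := fun {X Y} f => by
    induction f using ind with | _ f =>
    exact sound ((tensor_comp_ident _ _ _ _ _).trans ((ident_comp_tensor _ _ _ _ _).symm.trans
      (.comp_congr (.refl (.ident (Nat.zero_add X.n)))
        (.unit_tensor f (Nat.zero_add _).symm (Nat.zero_add _).symm)))))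
  (rightUnitor_naturality := fun {X Y} f => by
    induction f using ind with | _ f =>
    exact sound ((tensor_comp_ident _ _ _ _ _).trans ((ident_comp_tensor _ _ _ _ _).symm.trans
      (.comp_congr (.refl (.ident (Nat.add_zero X.n)))
        (.tensor_unit f (Nat.add_zero _).symm (Nat.add_zero _).symm)))))
  (pentagon := fun _ _ _ _ => sound
    ((Word.Rel.comp_congr (tensor_ident _ _ _ _)
      ((Word.Rel.comp_congr (.refl _) (tensor_ident _ _ _ _)).trans (ident_comp_ident _ _))).trans
      ((ident_comp_ident _ _).trans (ident_comp_ident _ _).symm)))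
  (triangle := fun _ _ => sound
    ((Word.Rel.comp_congr (.refl _) (tensor_ident _ _ _ _)).trans ((ident_comp_ident _ _).trans
      (tensor_ident _ _ _ _).symm)))

/-- The generating object. -/
def pt : Diag := ⟨1⟩

/-- The cup, a diagram `0 ⟶ 2`. -/
def cup : 𝟙_ Diag ⟶ pt ⊗ pt := mk' .cup

/-- The cap, a diagram `2 ⟶ 0`. -/
def cap : pt ⊗ pt ⟶ 𝟙_ Diag := mk' .cap

end Diag
namespace FreeMonoidal

universe v u
variable {R : Type*} [CommRing R] {C : Type u} [Category.{v} C]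

/-- The object of `C` underlying an object of its linearization. -/
def un (X : Free R C) : C := X

/-- A morphism of `C`, as a basis vector of the corresponding space of morphisms. -/
def sg {X Y : Free R C} (g : un X ⟶ un Y) : X ⟶ Y := (Free.embedding R C).map g

theorem sg_id (X : Free R C) : sg (𝟙 (un X)) = 𝟙 X := rfl

theorem sg_comp {X Y Z : Free R C} (f : un X ⟶ un Y) (g : un Y ⟶ un Z) :
    sg (f ≫ g) = sg f ≫ sg g := (Free.embedding R C).map_comp f g

theorem hom_ind {X Y : Free R C} {P : (X ⟶ Y) → Prop} (f : X ⟶ Y) (zero : P 0)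
    (add : ∀ f g, P f → P g → P (f + g))
    (smul : ∀ (r : R) (g : un X ⟶ un Y), P (r • sg g)) : P f := by
  refine Finsupp.induction_linear (motive := P) f zero add fun g r => ?_
  have e : r • sg g = (Finsupp.single g r : (un X ⟶ un Y) →₀ R) := by
    exact (Finsupp.smul_single r g 1).trans (congrArg (Finsupp.single g) (mul_one r))
  exact e ▸ smul r g

/-- Isomorphisms of `C`, in its linearization. -/
def sgIso {X Y : Free R C} (e : un X ≅ un Y) : X ≅ Y where
  hom := sg e.hom
  inv := sg e.inv
  hom_inv_id := by rw [← sg_comp, e.hom_inv_id, sg_id]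
  inv_hom_id := by rw [← sg_comp, e.inv_hom_id, sg_id]

variable [MonoidalCategory C]

instance : MonoidalCategoryStruct (Free R C) where
  tensorObj X Y := Free.of R (un X ⊗ un Y)
  whiskerLeft X Y Z f := Finsupp.mapDomain (fun g : un Y ⟶ un Z => un X ◁ g) f
  whiskerRight {Y Z} f X := Finsupp.mapDomain (fun g : un Y ⟶ un Z => g ▷ un X) f
  tensorUnit := Free.of R (𝟙_ C)
  associator X Y Z := sgIso (X := Free.of R ((un X ⊗ un Y) ⊗ un Z))
    (Y := Free.of R (un X ⊗ un Y ⊗ un Z)) (α_ (un X) (un Y) (un Z))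
  leftUnitor X := sgIso (X := Free.of R (𝟙_ C ⊗ un X)) (λ_ (un X))
  rightUnitor X := sgIso (X := Free.of R (un X ⊗ 𝟙_ C)) (ρ_ (un X))

/-- Whiskering a morphism of `C`, between objects of its linearization. -/
def tL (X : Free R C) {Y Z : Free R C} (f : un Y ⟶ un Z) : un (X ⊗ Y) ⟶ un (X ⊗ Z) := un X ◁ f

/-- Whiskering a morphism of `C`, between objects of its linearization. -/
def tR {Y Z : Free R C} (f : un Y ⟶ un Z) (X : Free R C) : un (Y ⊗ X) ⟶ un (Z ⊗ X) := f ▷ un X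

/-- The associator of `C`, between objects of its linearization. -/
def aU (X Y Z : Free R C) : un ((X ⊗ Y) ⊗ Z) ⟶ un (X ⊗ Y ⊗ Z) := (α_ (un X) (un Y) (un Z)).hom

/-- The left unitor of `C`, between objects of its linearization. -/
def lU (X : Free R C) : un (𝟙_ (Free R C) ⊗ X) ⟶ un X := (λ_ (un X)).hom

/-- The right unitor of `C`, between objects of its linearization. -/
def rU (X : Free R C) : un (X ⊗ 𝟙_ (Free R C)) ⟶ un X := (ρ_ (un X)).hom

theorem assoc_sg (X Y Z : Free R C) : (α_ X Y Z).hom = sg (aU X Y Z) := rfl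
theorem lunit_sg (X : Free R C) : (λ_ X).hom = sg (lU X) := rfl
theorem runit_sg (X : Free R C) : (ρ_ X).hom = sg (rU X) := rfl

section
variable {X Y Z : Free R C}

theorem wl_zero : X ◁ (0 : Y ⟶ Z) = 0 :=
  Finsupp.mapDomain_zero (f := fun g : un Y ⟶ un Z => un X ◁ g)
theorem wr_zero : (0 : Y ⟶ Z) ▷ X = 0 :=
  Finsupp.mapDomain_zero (f := fun g : un Y ⟶ un Z => g ▷ un X)
theorem wl_add (f g : Y ⟶ Z) : X ◁ (f + g) = X ◁ f + X ◁ g := Finsupp.mapDomain_add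
theorem wr_add (f g : Y ⟶ Z) : (f + g) ▷ X = f ▷ X + g ▷ X := Finsupp.mapDomain_add
theorem wl_smul (r : R) (f : Y ⟶ Z) : X ◁ (r • f) = r • X ◁ f := Finsupp.mapDomain_smul _ _
theorem wr_smul (r : R) (f : Y ⟶ Z) : (r • f) ▷ X = r • f ▷ X := Finsupp.mapDomain_smul _ _
theorem wl_sg (f : un Y ⟶ un Z) : X ◁ sg f = sg (tL X f) := Finsupp.mapDomain_single
theorem wr_sg (f : un Y ⟶ un Z) : sg f ▷ X = sg (tR f X) := Finsupp.mapDomain_single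
end

theorem wl_comp (X : Free R C) {Y Z W : Free R C} (f : Y ⟶ Z) (g : Z ⟶ W) :
    X ◁ (f ≫ g) = X ◁ f ≫ X ◁ g := by
  induction f using hom_ind with
  | zero => simp [wl_zero]
  | add f f' h h' => simp [wl_add, h, h']
  | smul r f =>
    induction g using hom_ind with
    | zero => simp only [wl_zero, Limits.comp_zero, Limits.zero_comp]
    | add g g' h h' =>
      simp only [wl_add, h, h', Preadditive.comp_add, Preadditive.add_comp]
    | smul s g =>
      have h : X ◁ (sg f ≫ sg g) = X ◁ sg f ≫ X ◁ sg g := by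
        simp only [wl_sg, ← sg_comp]
        exact congrArg sg (whiskerLeft_comp (un X) f g)
      simp only [wl_smul, Linear.comp_smul, Linear.smul_comp, h]

theorem wr_comp (X : Free R C) {Y Z W : Free R C} (f : Y ⟶ Z) (g : Z ⟶ W) :
    (f ≫ g) ▷ X = f ▷ X ≫ g ▷ X := by
  induction f using hom_ind with
  | zero => simp [wr_zero]
  | add f f' h h' => simp [wr_add, h, h']
  | smul r f =>
    induction g using hom_ind with
    | zero => simp only [wr_zero, Limits.comp_zero, Limits.zero_comp]
    | add g g' h h' =>
      simp only [wr_add, h, h', Preadditive.comp_add, Preadditive.add_comp]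
    | smul s g =>
      have h : (sg f ≫ sg g) ▷ X = sg f ▷ X ≫ sg g ▷ X := by
        simp only [wr_sg, ← sg_comp]
        exact congrArg sg (comp_whiskerRight f g (un X))
      simp only [wr_smul, Linear.comp_smul, Linear.smul_comp, h]

theorem exch {X Y Z W : Free R C} (f : W ⟶ X) (g : Y ⟶ Z) :
    W ◁ g ≫ f ▷ Z = f ▷ Y ≫ X ◁ g := by
  induction f using hom_ind with
  | zero => simp [wl_zero, wr_zero]
  | add f f' h h' => simp [wl_add, wr_add, h, h']
  | smul r f =>
    induction g using hom_ind with
    | zero => simp only [wl_zero, wr_zero, Limits.comp_zero, Limits.zero_comp]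
    | add g g' h h' =>
      simp only [wl_add, wr_add, h, h', Preadditive.comp_add, Preadditive.add_comp]
    | smul s g =>
      have h : W ◁ sg g ≫ sg f ▷ Z = sg f ▷ Y ≫ X ◁ sg g := by
        simp only [wl_sg, wr_sg, ← sg_comp]
        exact congrArg sg (whisker_exchange f g)
      simp only [wl_smul, wr_smul, Linear.comp_smul, Linear.smul_comp, h]
      rw [smul_comm]

theorem assocL {X Y Z Z' : Free R C} (f : Z ⟶ Z') :
    (X ⊗ Y) ◁ f ≫ (α_ X Y Z').hom = (α_ X Y Z).hom ≫ X ◁ Y ◁ f := by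
  induction f using hom_ind with
  | zero => simp [wl_zero]
  | add f f' h h' => simp [wl_add, h, h']
  | smul r f =>
    have h : (X ⊗ Y) ◁ sg f ≫ (α_ X Y Z').hom = (α_ X Y Z).hom ≫ X ◁ Y ◁ sg f := by
      simp only [wl_sg, assoc_sg, lunit_sg, runit_sg, ← sg_comp]
      exact congrArg sg (by simp : (un X ⊗ un Y) ◁ f ≫ (α_ (un X) (un Y) (un Z')).hom =
        (α_ (un X) (un Y) (un Z)).hom ≫ un X ◁ un Y ◁ f)
    simp only [wl_smul, Linear.comp_smul, Linear.smul_comp, h]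

theorem assocM {X Y Y' Z : Free R C} (f : Y ⟶ Y') :
    (X ◁ f) ▷ Z ≫ (α_ X Y' Z).hom = (α_ X Y Z).hom ≫ X ◁ f ▷ Z := by
  induction f using hom_ind with
  | zero => simp [wl_zero, wr_zero]
  | add f f' h h' => simp [wl_add, wr_add, h, h']
  | smul r f =>
    have h : (X ◁ sg f) ▷ Z ≫ (α_ X Y' Z).hom = (α_ X Y Z).hom ≫ X ◁ sg f ▷ Z := by
      simp only [wl_sg, wr_sg, assoc_sg, lunit_sg, runit_sg, ← sg_comp]
      exact congrArg sg (by simp : (un X ◁ f) ▷ un Z ≫ (α_ (un X) (un Y') (un Z)).hom =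
        (α_ (un X) (un Y) (un Z)).hom ≫ un X ◁ f ▷ un Z)
    simp only [wl_smul, wr_smul, Linear.comp_smul, Linear.smul_comp, h]

theorem assocR {X X' Y Z : Free R C} (f : X ⟶ X') :
    (f ▷ Y) ▷ Z ≫ (α_ X' Y Z).hom = (α_ X Y Z).hom ≫ f ▷ (Y ⊗ Z) := by
  induction f using hom_ind with
  | zero => simp [wr_zero]
  | add f f' h h' => simp [wr_add, h, h']
  | smul r f =>
    have h : (sg f ▷ Y) ▷ Z ≫ (α_ X' Y Z).hom = (α_ X Y Z).hom ≫ sg f ▷ (Y ⊗ Z) := by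
      simp only [wr_sg, assoc_sg, lunit_sg, runit_sg, ← sg_comp]
      exact congrArg sg (by simp : (f ▷ un Y) ▷ un Z ≫ (α_ (un X') (un Y) (un Z)).hom =
        (α_ (un X) (un Y) (un Z)).hom ≫ f ▷ (un Y ⊗ un Z))
    simp only [wr_smul, Linear.comp_smul, Linear.smul_comp, h]

theorem lunit {X Y : Free R C} (f : X ⟶ Y) :
    𝟙_ (Free R C) ◁ f ≫ (λ_ Y).hom = (λ_ X).hom ≫ f := by
  induction f using hom_ind with
  | zero => simp [wl_zero]
  | add f f' h h' => simp [wl_add, h, h']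
  | smul r f =>
    have h : 𝟙_ (Free R C) ◁ sg f ≫ (λ_ Y).hom = (λ_ X).hom ≫ sg f := by
      simp only [wl_sg, assoc_sg, lunit_sg, runit_sg, ← sg_comp]
      exact congrArg sg (leftUnitor_naturality f)
    simp only [wl_smul, Linear.comp_smul, Linear.smul_comp, h]

theorem runit {X Y : Free R C} (f : X ⟶ Y) :
    f ▷ 𝟙_ (Free R C) ≫ (ρ_ Y).hom = (ρ_ X).hom ≫ f := by
  induction f using hom_ind with
  | zero => simp [wr_zero]
  | add f f' h h' => simp [wr_add, h, h']
  | smul r f =>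
    have h : sg f ▷ 𝟙_ (Free R C) ≫ (ρ_ Y).hom = (ρ_ X).hom ≫ sg f := by
      simp only [wr_sg, assoc_sg, lunit_sg, runit_sg, ← sg_comp]
      exact congrArg sg (rightUnitor_naturality f)
    simp only [wr_smul, Linear.comp_smul, Linear.smul_comp, h]

theorem pent (W X Y Z : Free R C) :
    (α_ W X Y).hom ▷ Z ≫ (α_ W (X ⊗ Y) Z).hom ≫ W ◁ (α_ X Y Z).hom =
      (α_ (W ⊗ X) Y Z).hom ≫ (α_ W X (Y ⊗ Z)).hom := by
  simp only [wl_sg, wr_sg, assoc_sg, ← sg_comp]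
  exact congrArg sg (MonoidalCategory.pentagon (un W) (un X) (un Y) (un Z))

theorem tri (X Y : Free R C) :
    (α_ X (𝟙_ (Free R C)) Y).hom ≫ X ◁ (λ_ Y).hom = (ρ_ X).hom ▷ Y := by
  simp only [wl_sg, wr_sg, assoc_sg, lunit_sg, runit_sg, ← sg_comp]
  exact congrArg sg (MonoidalCategory.triangle (un X) (un Y))

theorem wl_id (X Y : Free R C) : X ◁ 𝟙 Y = 𝟙 (X ⊗ Y) := by
  rw [← sg_id, ← sg_id, wl_sg]
  exact congrArg sg (whiskerLeft_id (un X) (un Y))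

theorem wr_id (X Y : Free R C) : 𝟙 X ▷ Y = 𝟙 (X ⊗ Y) := by
  rw [← sg_id, ← sg_id, wr_sg]
  exact congrArg sg (id_whiskerRight (un X) (un Y))

end FreeMonoidal

/-- A monoidal category from whiskerings. -/
abbrev monoidalOfWhisker {C : Type*} [Category C] [MonoidalCategoryStruct C]
    (tensorHom_def : ∀ {X₁ Y₁ X₂ Y₂ : C} (f : X₁ ⟶ Y₁) (g : X₂ ⟶ Y₂),
      f ⊗ₘ g = f ▷ X₂ ≫ Y₁ ◁ g)
    (wl_id : ∀ X Y : C, X ◁ 𝟙 Y = 𝟙 (X ⊗ Y))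
    (wr_id : ∀ X Y : C, 𝟙 X ▷ Y = 𝟙 (X ⊗ Y))
    (wl_comp : ∀ (X : C) {Y Z W : C} (f : Y ⟶ Z) (g : Z ⟶ W), X ◁ (f ≫ g) = X ◁ f ≫ X ◁ g)
    (wr_comp : ∀ (X : C) {Y Z W : C} (f : Y ⟶ Z) (g : Z ⟶ W), (f ≫ g) ▷ X = f ▷ X ≫ g ▷ X)
    (exch : ∀ {X Y Z W : C} (f : W ⟶ X) (g : Y ⟶ Z), W ◁ g ≫ f ▷ Z = f ▷ Y ≫ X ◁ g)
    (assocL : ∀ {X Y Z Z' : C} (f : Z ⟶ Z'),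
      (X ⊗ Y) ◁ f ≫ (α_ X Y Z').hom = (α_ X Y Z).hom ≫ X ◁ Y ◁ f)
    (assocM : ∀ {X Y Y' Z : C} (f : Y ⟶ Y'),
      (X ◁ f) ▷ Z ≫ (α_ X Y' Z).hom = (α_ X Y Z).hom ≫ X ◁ f ▷ Z)
    (assocR : ∀ {X X' Y Z : C} (f : X ⟶ X'),
      (f ▷ Y) ▷ Z ≫ (α_ X' Y Z).hom = (α_ X Y Z).hom ≫ f ▷ (Y ⊗ Z))
    (lunit : ∀ {X Y : C} (f : X ⟶ Y), 𝟙_ C ◁ f ≫ (λ_ Y).hom = (λ_ X).hom ≫ f)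
    (runit : ∀ {X Y : C} (f : X ⟶ Y), f ▷ 𝟙_ C ≫ (ρ_ Y).hom = (ρ_ X).hom ≫ f)
    (pent : ∀ W X Y Z : C, (α_ W X Y).hom ▷ Z ≫ (α_ W (X ⊗ Y) Z).hom ≫ W ◁ (α_ X Y Z).hom =
      (α_ (W ⊗ X) Y Z).hom ≫ (α_ W X (Y ⊗ Z)).hom)
    (tri : ∀ X Y : C, (α_ X (𝟙_ C) Y).hom ≫ X ◁ (λ_ Y).hom = (ρ_ X).hom ▷ Y) :
    MonoidalCategory C where
  tensorHom_def := tensorHom_def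
  id_tensorHom_id X Y := by rw [tensorHom_def, wl_id, wr_id, Category.comp_id]
  tensorHom_comp_tensorHom f₁ f₂ g₁ g₂ := by
    simp only [tensorHom_def, wl_comp, wr_comp, Category.assoc]
    rw [← Category.assoc (_ ◁ f₂), exch, Category.assoc]
  whiskerLeft_id := wl_id
  id_whiskerRight := wr_id
  associator_naturality f₁ f₂ f₃ := by
    simp only [tensorHom_def, wl_comp, wr_comp, Category.assoc]
    rw [assocL, ← Category.assoc (_ ▷ _) (α_ _ _ _).hom, assocM, Category.assoc,
      ← Category.assoc (_ ▷ _) (α_ _ _ _).hom, assocR, Category.assoc]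
  leftUnitor_naturality := lunit
  rightUnitor_naturality := runit
  pentagon := pent
  triangle := tri

namespace FreeMonoidal
universe v u
variable {R : Type*} [CommRing R] {C : Type u} [Category.{v} C] [MonoidalCategory C]

instance : MonoidalCategory (Free R C) :=
  monoidalOfWhisker (fun _ _ => rfl) wl_id wr_id wl_comp wr_comp exch assocL assocM assocR
    lunit runit pent tri

instance : MonoidalPreadditive (Free R C) where
  whiskerLeft_zero := wl_zero
  zero_whiskerRight := wr_zero
  whiskerLeft_add := wl_add
  add_whiskerRight := wr_add

instance : MonoidalLinear R (Free R C) where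
  whiskerLeft_smul _ _ _ r f := wl_smul r f
  smul_whiskerRight r _ _ f _ := wr_smul r f

end FreeMonoidal
section TensorIdeal

variable {C : Type*} [Category C] [Preadditive C] [MonoidalCategory C]

/-- The two-sided tensor ideal of morphisms generated by a family `S` of morphisms. -/
inductive TensorIdeal (S : ∀ ⦃X Y : C⦄, (X ⟶ Y) → Prop) : ∀ {X Y : C}, (X ⟶ Y) → Prop
  | of {X Y : C} (f : X ⟶ Y) : S f → TensorIdeal S f
  | zero (X Y : C) : TensorIdeal S (0 : X ⟶ Y)
  | add {X Y : C} (f g : X ⟶ Y) : TensorIdeal S f → TensorIdeal S g → TensorIdeal S (f + g)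
  | precomp {X Y Z : C} (f : X ⟶ Y) (g : Y ⟶ Z) : TensorIdeal S g → TensorIdeal S (f ≫ g)
  | postcomp {X Y Z : C} (f : X ⟶ Y) (g : Y ⟶ Z) : TensorIdeal S f → TensorIdeal S (f ≫ g)
  | whiskerLeft (X : C) {Y Z : C} (f : Y ⟶ Z) : TensorIdeal S f → TensorIdeal S (X ◁ f)
  | whiskerRight {Y Z : C} (f : Y ⟶ Z) (X : C) : TensorIdeal S f → TensorIdeal S (f ▷ X)

/-- Congruence of morphisms modulo a tensor ideal. -/
def idealRel (S : ∀ ⦃X Y : C⦄, (X ⟶ Y) → Prop) : HomRel C := fun _ _ f g => TensorIdeal S (f - g)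

variable (S : ∀ ⦃X Y : C⦄, (X ⟶ Y) → Prop)

theorem TensorIdeal.neg {X Y : C} {f : X ⟶ Y} (h : TensorIdeal S f) : TensorIdeal S (-f) := by
  simpa using TensorIdeal.precomp (-𝟙 X) f h

instance : Congruence (idealRel S) where
  comp_left f g g' h := by
    change TensorIdeal S _
    rw [← Preadditive.comp_sub]; exact .precomp _ _ h
  comp_right g h := by
    change TensorIdeal S _
    rw [← Preadditive.sub_comp]; exact .postcomp _ _ h
  equivalence :=
    { refl := fun f => by change TensorIdeal S _; rw [sub_self]; exact .zero _ _
      symm := fun h => by change TensorIdeal S _; rw [← neg_sub]; exact .neg S h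
      trans := fun h h' => by
        change TensorIdeal S _
        rw [← sub_add_sub_cancel]; exact .add _ _ h h' }

/-- The quotient of a preadditive monoidal category by the tensor ideal generated by `S`. -/
abbrev IdealQuotient := CategoryTheory.Quotient (idealRel S)

theorem idealRel_add ⦃X Y : C⦄ (f₁ f₂ g₁ g₂ : X ⟶ Y) (h : idealRel S f₁ f₂)
    (h' : idealRel S g₁ g₂) : idealRel S (f₁ + g₁) (f₂ + g₂) := by
  change TensorIdeal S _
  rw [add_sub_add_comm]; exact .add _ _ h h'

theorem idealRel_smul {R : Type*} [CommRing R] [Linear R C] (a : R) ⦃X Y : C⦄ (f₁ f₂ : X ⟶ Y)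
    (h : idealRel S f₁ f₂) : idealRel S (a • f₁) (a • f₂) := by
  change TensorIdeal S _
  have := TensorIdeal.precomp (a • 𝟙 X) _ h
  rwa [Linear.smul_comp, Category.id_comp, smul_sub] at this

instance : Preadditive (IdealQuotient S) :=
  CategoryTheory.Quotient.preadditive (idealRel S) (idealRel_add S)

/-- The projection to the quotient by a tensor ideal. -/
abbrev toIdealQuotient : C ⥤ IdealQuotient S := CategoryTheory.Quotient.functor (idealRel S)

instance : (toIdealQuotient S).Additive :=
  CategoryTheory.Quotient.functor_additive (idealRel S) (idealRel_add S)

instance {R : Type*} [CommRing R] [Linear R C] : Linear R (IdealQuotient S) :=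
  CategoryTheory.Quotient.linear R (idealRel S) (idealRel_smul S)

instance [HasFiniteBiproducts C] : HasFiniteBiproducts (IdealQuotient S) where
  out n :=
    { has_biproduct := fun F =>
        .mk ⟨(toIdealQuotient S).mapBicone (biproduct.bicone fun i => (F i).as),
          isBilimitOfPreserves (toIdealQuotient S) (biproduct.isBilimit fun i => (F i).as)⟩ }

variable [MonoidalPreadditive C]

instance : MonoidalCategoryStruct (IdealQuotient S) where
  tensorObj X Y := ⟨X.as ⊗ Y.as⟩
  whiskerLeft X Y Z f := (CategoryTheory.Quotient.lift (idealRel S)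
    (tensorLeft X.as ⋙ toIdealQuotient S) (fun Y Z f g h => CategoryTheory.Quotient.sound _ (by
      change TensorIdeal S (X.as ◁ f - X.as ◁ g)
      have e : X.as ◁ f - X.as ◁ g = X.as ◁ (f - g) := ((tensorLeft X.as).map_sub (f := f) (g := g)).symm
      rw [e]; exact .whiskerLeft _ _ h))).map f
  whiskerRight {Y Z} f X := (CategoryTheory.Quotient.lift (idealRel S)
    (tensorRight X.as ⋙ toIdealQuotient S) (fun Y Z f g h => CategoryTheory.Quotient.sound _ (by
      change TensorIdeal S (f ▷ X.as - g ▷ X.as)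
      have e : f ▷ X.as - g ▷ X.as = (f - g) ▷ X.as := ((tensorRight X.as).map_sub (f := f) (g := g)).symm
      rw [e]; exact .whiskerRight _ _ h))).map f
  tensorUnit := ⟨𝟙_ C⟩
  associator X Y Z := (toIdealQuotient S).mapIso (α_ X.as Y.as Z.as)
  leftUnitor X := (toIdealQuotient S).mapIso (λ_ X.as)
  rightUnitor X := (toIdealQuotient S).mapIso (ρ_ X.as)

instance : MonoidalCategory (IdealQuotient S) :=
  monoidalOfWhisker (fun _ _ => rfl)
    (fun X Y => congrArg (toIdealQuotient S).map (whiskerLeft_id X.as Y.as))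
    (fun X Y => congrArg (toIdealQuotient S).map (id_whiskerRight X.as Y.as))
    (fun X _ _ _ => by
      rintro ⟨f⟩ ⟨g⟩; exact congrArg (toIdealQuotient S).map (whiskerLeft_comp X.as f g))
    (fun X _ _ _ => by
      rintro ⟨f⟩ ⟨g⟩; exact congrArg (toIdealQuotient S).map (comp_whiskerRight f g X.as))
    (by rintro _ _ _ _ ⟨f⟩ ⟨g⟩; exact congrArg (toIdealQuotient S).map (whisker_exchange f g))
    (by
      rintro X Y Z Z' ⟨f⟩
      exact congrArg (toIdealQuotient S).map (by simp : (X.as ⊗ Y.as) ◁ f ≫ (α_ _ _ Z'.as).hom =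
        (α_ X.as Y.as Z.as).hom ≫ X.as ◁ Y.as ◁ f))
    (by
      rintro X Y Y' Z ⟨f⟩
      exact congrArg (toIdealQuotient S).map (by simp : (X.as ◁ f) ▷ Z.as ≫ (α_ _ Y'.as _).hom =
        (α_ X.as Y.as Z.as).hom ≫ X.as ◁ f ▷ Z.as))
    (by
      rintro X X' Y Z ⟨f⟩
      exact congrArg (toIdealQuotient S).map (by simp : (f ▷ Y.as) ▷ Z.as ≫ (α_ X'.as _ _).hom =
        (α_ X.as Y.as Z.as).hom ≫ f ▷ (Y.as ⊗ Z.as)))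
    (by rintro X Y ⟨f⟩; exact congrArg (toIdealQuotient S).map (leftUnitor_naturality f))
    (by rintro X Y ⟨f⟩; exact congrArg (toIdealQuotient S).map (rightUnitor_naturality f))
    (fun W X Y Z => congrArg (toIdealQuotient S).map (pentagon W.as X.as Y.as Z.as))
    (fun X Y => congrArg (toIdealQuotient S).map (triangle X.as Y.as))

instance : MonoidalPreadditive (IdealQuotient S) where
  whiskerLeft_zero {X Y Z} := congrArg (toIdealQuotient S).map
    (MonoidalPreadditive.whiskerLeft_zero : X.as ◁ (0 : Y.as ⟶ Z.as) = 0)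
  zero_whiskerRight {X Y Z} := congrArg (toIdealQuotient S).map
    (MonoidalPreadditive.zero_whiskerRight : (0 : Y.as ⟶ Z.as) ▷ X.as = 0)
  whiskerLeft_add := by
    rintro X Y Z ⟨f⟩ ⟨g⟩
    exact congrArg (toIdealQuotient S).map (MonoidalPreadditive.whiskerLeft_add (X := X.as) f g)
  add_whiskerRight := by
    rintro X Y Z ⟨f⟩ ⟨g⟩
    exact congrArg (toIdealQuotient S).map (MonoidalPreadditive.add_whiskerRight (X := X.as) f g)

instance {R : Type*} [CommRing R] [Linear R C] [MonoidalLinear R C] :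
    MonoidalLinear R (IdealQuotient S) where
  whiskerLeft_smul := by
    rintro X Y Z r ⟨f⟩
    exact congrArg (toIdealQuotient S).map (MonoidalLinear.whiskerLeft_smul X.as r f)
  smul_whiskerRight := by
    rintro r Y Z ⟨f⟩ X
    exact congrArg (toIdealQuotient S).map (MonoidalLinear.smul_whiskerRight r f X.as)

end TensorIdeal

section Karoubi
open CategoryTheory.Idempotents

variable {C : Type*} [Category C]

/-- An isomorphism compatible with idempotents induces an isomorphism of their images. -/
def karoubiIso {P Q : Karoubi C} (e : P.X ≅ Q.X) (h : P.p ≫ e.hom = e.hom ≫ Q.p) : P ≅ Q where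
  hom := ⟨P.p ≫ e.hom, by rw [Category.assoc, ← h, P.idem_assoc, P.idem_assoc]⟩
  inv := ⟨Q.p ≫ e.inv, by
    have h' : Q.p ≫ e.inv = e.inv ≫ P.p := by
      rw [Iso.comp_inv_eq, Category.assoc, h, Iso.inv_hom_id_assoc]
    rw [Category.assoc, ← h', Q.idem_assoc, Q.idem_assoc]⟩
  hom_inv_id := by
    apply Karoubi.hom_ext
    simp only [Karoubi.comp_f, Karoubi.id_f]
    rw [h, Category.assoc, Q.idem_assoc, ← Category.assoc, ← h, Category.assoc, Iso.hom_inv_id,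
      Category.comp_id]
  inv_hom_id := by
    apply Karoubi.hom_ext
    simp only [Karoubi.comp_f, Karoubi.id_f]
    rw [h, Category.assoc, Iso.inv_hom_id_assoc, Q.idem]

variable [MonoidalCategory C]

instance : MonoidalCategoryStruct (Karoubi C) where
  tensorObj P Q := ⟨P.X ⊗ Q.X, P.p ⊗ₘ Q.p, by simp⟩
  tensorHom f g := ⟨f.f ⊗ₘ g.f, by simp⟩
  whiskerLeft P _ _ f := ⟨P.p ⊗ₘ f.f, by simp⟩
  whiskerRight f P := ⟨f.f ⊗ₘ P.p, by simp⟩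
  tensorUnit := ⟨𝟙_ C, 𝟙 _, by simp⟩
  associator P Q T := karoubiIso (α_ P.X Q.X T.X) (associator_naturality P.p Q.p T.p)
  leftUnitor P := karoubiIso (λ_ P.X) (by simp)
  rightUnitor P := karoubiIso (ρ_ P.X) (by simp)

namespace KaroubiMonoidal

theorem tensorHom_f {P Q P' Q' : Karoubi C} (f : P ⟶ P') (g : Q ⟶ Q') :
    (f ⊗ₘ g).f = f.f ⊗ₘ g.f := rfl

theorem whiskerLeft_f (P : Karoubi C) {Q Q' : Karoubi C} (g : Q ⟶ Q') :
    (P ◁ g).f = P.p ⊗ₘ g.f := rfl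

theorem whiskerRight_f {P P' : Karoubi C} (f : P ⟶ P') (Q : Karoubi C) :
    (f ▷ Q).f = f.f ⊗ₘ Q.p := rfl

theorem tensorObj_p (P Q : Karoubi C) : (P ⊗ Q).p = P.p ⊗ₘ Q.p := rfl

theorem associator_hom_f (P Q T : Karoubi C) :
    (α_ P Q T).hom.f = ((P.p ⊗ₘ Q.p) ⊗ₘ T.p) ≫ (α_ P.X Q.X T.X).hom := rfl

theorem leftUnitor_hom_f (P : Karoubi C) :
    (λ_ P).hom.f = (𝟙 (𝟙_ C) ⊗ₘ P.p) ≫ (λ_ P.X).hom := rfl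

theorem rightUnitor_hom_f (P : Karoubi C) :
    (ρ_ P).hom.f = (P.p ⊗ₘ 𝟙 (𝟙_ C)) ≫ (ρ_ P.X).hom := rfl

end KaroubiMonoidal

open KaroubiMonoidal

instance : MonoidalCategory (Karoubi C) := MonoidalCategory.ofTensorHom
  (id_tensorHom_id := fun _ _ => rfl)
  (id_tensorHom := fun _ _ _ _ => rfl)
  (tensorHom_id := fun _ _ => rfl)
  (tensorHom_comp_tensorHom := fun _ _ _ _ => Karoubi.hom_ext _ _ (tensorHom_comp_tensorHom _ _ _ _))
  (associator_naturality := fun f₁ f₂ f₃ => by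
    apply Karoubi.hom_ext
    simp only [Karoubi.comp_f, tensorHom_f, associator_hom_f, Category.assoc,
      ← associator_naturality]
    simp only [tensorHom_comp_tensorHom_assoc, tensorHom_comp_tensorHom, Karoubi.comp_p,
      Karoubi.p_comp])
  (leftUnitor_naturality := fun f => by
    apply Karoubi.hom_ext
    rw [Karoubi.comp_f, Karoubi.comp_f, tensorHom_f, leftUnitor_hom_f, leftUnitor_hom_f]
    change (𝟙 (𝟙_ C) ⊗ₘ f.f) ≫ _ = _
    simp)
  (rightUnitor_naturality := fun f => by
    apply Karoubi.hom_ext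
    rw [Karoubi.comp_f, Karoubi.comp_f, tensorHom_f, rightUnitor_hom_f, rightUnitor_hom_f]
    change (f.f ⊗ₘ 𝟙 (𝟙_ C)) ≫ _ = _
    simp)
  (pentagon := fun W X Y Z => by
    apply Karoubi.hom_ext
    simp only [Karoubi.comp_f, tensorHom_f, associator_hom_f, tensorObj_p, Karoubi.id_f]
    have h1 : (((W.p ⊗ₘ X.p) ⊗ₘ Y.p) ≫ (α_ W.X X.X Y.X).hom) ⊗ₘ Z.p =
        (((W.p ⊗ₘ X.p) ⊗ₘ Y.p) ⊗ₘ Z.p) ≫ (α_ W.X X.X Y.X).hom ▷ Z.X := by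
      rw [← tensorHom_id, tensorHom_comp_tensorHom, Category.comp_id]
    have h2 : W.p ⊗ₘ (((X.p ⊗ₘ Y.p) ⊗ₘ Z.p) ≫ (α_ X.X Y.X Z.X).hom) =
        (W.p ⊗ₘ ((X.p ⊗ₘ Y.p) ⊗ₘ Z.p)) ≫ W.X ◁ (α_ X.X Y.X Z.X).hom := by
      rw [← id_tensorHom, tensorHom_comp_tensorHom, Category.comp_id]
    have h3 : (α_ W.X X.X Y.X).hom ▷ Z.X ≫ ((W.p ⊗ₘ (X.p ⊗ₘ Y.p)) ⊗ₘ Z.p) =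
        (((W.p ⊗ₘ X.p) ⊗ₘ Y.p) ⊗ₘ Z.p) ≫ (α_ W.X X.X Y.X).hom ▷ Z.X := by
      rw [← tensorHom_id, tensorHom_comp_tensorHom, tensorHom_comp_tensorHom,
        associator_naturality, Category.comp_id, Category.id_comp]
    rw [h1, h2]
    simp only [Category.assoc]
    rw [← associator_naturality_assoc, reassoc_of% h3, reassoc_of% h3, ← associator_naturality_assoc,
      MonoidalCategory.pentagon]
    simp only [tensorHom_comp_tensorHom_assoc, tensorHom_comp_tensorHom, Karoubi.idem]
    rfl)
  (triangle := fun X Y => by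
    apply Karoubi.hom_ext
    simp only [Karoubi.comp_f, tensorHom_f, associator_hom_f, Karoubi.id_f,
      leftUnitor_hom_f, rightUnitor_hom_f]
    change (((X.p ⊗ₘ 𝟙 (𝟙_ C)) ⊗ₘ Y.p) ≫ (α_ X.X (𝟙_ C) Y.X).hom) ≫ _ = _
    have h1 : ((X.p ⊗ₘ 𝟙 (𝟙_ C)) ≫ (ρ_ X.X).hom) ⊗ₘ Y.p =
        ((X.p ⊗ₘ 𝟙 (𝟙_ C)) ⊗ₘ Y.p) ≫ (ρ_ X.X).hom ▷ Y.X := by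
      rw [← tensorHom_id (ρ_ X.X).hom, tensorHom_comp_tensorHom, Category.comp_id]
    have h2 : X.p ⊗ₘ ((𝟙 (𝟙_ C) ⊗ₘ Y.p) ≫ (λ_ Y.X).hom) =
        (X.p ⊗ₘ (𝟙 (𝟙_ C) ⊗ₘ Y.p)) ≫ X.X ◁ (λ_ Y.X).hom := by
      rw [← id_tensorHom X.X (λ_ Y.X).hom, tensorHom_comp_tensorHom, Category.comp_id]
    rw [h1, h2, Category.assoc]
    rw [← associator_naturality_assoc, MonoidalCategory.triangle]
    simp only [tensorHom_comp_tensorHom_assoc, tensorHom_comp_tensorHom, Karoubi.idem,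
      Category.comp_id])

instance [Preadditive C] [MonoidalPreadditive C] : MonoidalPreadditive (Karoubi C) where
  whiskerLeft_zero := Karoubi.hom_ext _ _ (MonoidalPreadditive.tensor_zero _)
  zero_whiskerRight := Karoubi.hom_ext _ _ (MonoidalPreadditive.zero_tensor _)
  whiskerLeft_add _ _ := Karoubi.hom_ext _ _ (MonoidalPreadditive.tensor_add _ _ _)
  add_whiskerRight _ _ := Karoubi.hom_ext _ _ (MonoidalPreadditive.add_tensor _ _ _)

end Karoubi

section MatMonoidal

universe v u
variable {C : Type u} [Category.{v} C] [Preadditive C]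

namespace MatMonoidal

/-- The matrix `f` has entries `φ i` in the places `(i, e i)` and zeros elsewhere. -/
structure IsMonomial {M N : Mat_ C} (f : M ⟶ N) (e : M.ι → N.ι)
    (φ : ∀ i, M.X i ⟶ N.X (e i)) : Prop where
  diag : ∀ i, f i (e i) = φ i
  off : ∀ i j, e i ≠ j → f i j = 0

theorem IsMonomial.comp_apply {M N K : Mat_ C} {f : M ⟶ N} {e : M.ι → N.ι}
    {φ : ∀ i, M.X i ⟶ N.X (e i)} (hf : IsMonomial f e φ)
    (g : N ⟶ K) (i : M.ι) (k : K.ι) : (f ≫ g) i k = φ i ≫ g (e i) k := by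
  rw [Mat_.comp_apply, Finset.sum_eq_single (e i), hf.diag]
  · intro j _ hj
    rw [hf.off _ _ hj.symm, zero_comp]
  · simp

theorem IsMonomial.apply_comp {M N K : Mat_ C} {f : M ⟶ N} {e : M.ι → N.ι}
    {φ : ∀ i, M.X i ⟶ N.X (e i)} (hf : IsMonomial f e φ) (he : e.Injective)
    (g : K ⟶ M) (k : K.ι) (i : M.ι) : (g ≫ f) k (e i) = g k i ≫ φ i := by
  rw [Mat_.comp_apply, Finset.sum_eq_single i, hf.diag]
  · intro j _ hj
    rw [hf.off _ _ (fun h => hj (he h)), comp_zero]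
  · simp

theorem IsMonomial.id (M : Mat_ C) : IsMonomial (𝟙 M) (fun i => i) (fun i => 𝟙 (M.X i)) :=
  ⟨fun i => Mat_.id_apply_self M i, fun i j h => Mat_.id_apply_of_ne M i j h⟩

theorem IsMonomial.comp {M N K : Mat_ C} {f : M ⟶ N} {e : M.ι → N.ι}
    {φ : ∀ i, M.X i ⟶ N.X (e i)} (hf : IsMonomial f e φ) {g : N ⟶ K} {e' : N.ι → K.ι}
    {ψ : ∀ i, N.X i ⟶ K.X (e' i)} (hg : IsMonomial g e' ψ) :
    IsMonomial (f ≫ g) (fun i => e' (e i)) (fun i => φ i ≫ ψ (e i)) where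
  diag i := by rw [hf.comp_apply, hg.diag]
  off i k h := by rw [hf.comp_apply, hg.off _ _ h, comp_zero]

theorem IsMonomial.ext {M N : Mat_ C} {f g : M ⟶ N} {e : M.ι → N.ι}
    {φ ψ : ∀ i, M.X i ⟶ N.X (e i)} (hf : IsMonomial f e φ) (hg : IsMonomial g e ψ)
    (h : ∀ i, φ i = ψ i) : f = g := by
  apply Mat_.hom_ext
  intro i j
  by_cases hij : e i = j
  · subst hij; rw [hf.diag, hg.diag, h]
  · rw [hf.off _ _ hij, hg.off _ _ hij]

open scoped Classical in
/-- The matrix with entries `φ i` in the places `(i, e i)` and zeros elsewhere. -/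
def monoHom {M N : Mat_ C} (e : M.ι → N.ι) (φ : ∀ i, M.X i ⟶ N.X (e i)) : M ⟶ N :=
  fun i j => if h : e i = j then φ i ≫ eqToHom (congrArg N.X h) else 0

theorem monoHom_isMonomial {M N : Mat_ C} (e : M.ι → N.ι) (φ : ∀ i, M.X i ⟶ N.X (e i)) :
    IsMonomial (monoHom e φ) e φ :=
  ⟨fun i => by simp [monoHom], fun i j h => dif_neg h⟩

open scoped Classical in
/-- The matrix with entries `φ i` in the places `(e i, i)` and zeros elsewhere. -/
def monoInv {M N : Mat_ C} (e : M.ι → N.ι) (φ : ∀ i, N.X (e i) ⟶ M.X i) : N ⟶ M :=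
  fun j i => if h : j = e i then eqToHom (congrArg N.X h) ≫ φ i else 0

theorem monoInv_self {M N : Mat_ C} (e : M.ι → N.ι) (φ : ∀ i, N.X (e i) ⟶ M.X i) (i : M.ι) :
    monoInv e φ (e i) i = φ i := by
  simp [monoInv]

theorem monoInv_ne {M N : Mat_ C} (e : M.ι → N.ι) (φ : ∀ i, N.X (e i) ⟶ M.X i) {i : M.ι} {j : N.ι}
    (h : j ≠ e i) : monoInv e φ j i = 0 := dif_neg h

/-- The isomorphism given by a bijection of indices and isomorphisms of entries. -/
def monoIso {M N : Mat_ C} (e : M.ι ≃ N.ι) (φ : ∀ i, M.X i ≅ N.X (e i)) : M ≅ N where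
  hom := monoHom e (fun i => (φ i).hom)
  inv := monoInv e (fun i => (φ i).inv)
  hom_inv_id := by
    apply Mat_.hom_ext
    intro i k
    rw [(monoHom_isMonomial _ _).comp_apply]
    by_cases h : i = k
    · subst h; rw [monoInv_self, Iso.hom_inv_id, Mat_.id_apply_self]
    · rw [Mat_.id_apply_of_ne _ _ _ h, monoInv_ne _ _ (fun h' => h (e.injective h')), comp_zero]
  inv_hom_id := by
    apply Mat_.hom_ext
    intro j k
    obtain ⟨i, rfl⟩ := e.surjective k
    rw [(monoHom_isMonomial _ _).apply_comp e.injective]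
    by_cases h : j = e i
    · subst h; rw [monoInv_self, Iso.inv_hom_id, Mat_.id_apply_self]
    · rw [Mat_.id_apply_of_ne _ _ _ h, monoInv_ne _ _ h, zero_comp]

variable [MonoidalCategory C]

/-- The tensor product (Kronecker product) of matrices of morphisms. -/
def tensorMat {M M' N N' : Mat_ C} (f : M ⟶ M') (g : N ⟶ N') :
    (⟨M.ι × N.ι, fun p => M.X p.1 ⊗ N.X p.2⟩ : Mat_ C) ⟶
      ⟨M'.ι × N'.ι, fun p => M'.X p.1 ⊗ N'.X p.2⟩ :=
  fun p p' => f p.1 p'.1 ⊗ₘ g p.2 p'.2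

end MatMonoidal

open MatMonoidal

variable [MonoidalCategory C]

instance : MonoidalCategoryStruct (Mat_ C) where
  tensorObj M N := ⟨M.ι × N.ι, fun p => M.X p.1 ⊗ N.X p.2⟩
  tensorHom := tensorMat
  whiskerLeft M _ _ g := tensorMat (𝟙 M) g
  whiskerRight f N := tensorMat f (𝟙 N)
  tensorUnit := ⟨PUnit, fun _ => 𝟙_ C⟩
  associator M N K := monoIso (Equiv.prodAssoc M.ι N.ι K.ι)
    (fun p => α_ (M.X p.1.1) (N.X p.1.2) (K.X p.2))
  leftUnitor M := monoIso (Equiv.punitProd M.ι) (fun p => λ_ (M.X p.2))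
  rightUnitor M := monoIso (Equiv.prodPUnit M.ι) (fun p => ρ_ (M.X p.1))

namespace MatMonoidal

theorem tensorHom_apply {M M' N N' : Mat_ C} (f : M ⟶ M') (g : N ⟶ N') (i : (M ⊗ N).ι)
    (j : (M' ⊗ N').ι) : (f ⊗ₘ g) i j = f i.1 j.1 ⊗ₘ g i.2 j.2 := rfl

theorem assoc_mono (M N K : Mat_ C) : IsMonomial (α_ M N K).hom (fun p => (p.1.1, (p.1.2, p.2)))
    (fun p => (α_ (M.X p.1.1) (N.X p.1.2) (K.X p.2)).hom) := monoHom_isMonomial _ _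

theorem left_mono (M : Mat_ C) : IsMonomial (λ_ M).hom (fun p : PUnit × M.ι => p.2)
    (fun p : PUnit × M.ι => (λ_ (M.X p.2)).hom) := monoHom_isMonomial _ _

theorem right_mono (M : Mat_ C) : IsMonomial (ρ_ M).hom (fun p : M.ι × PUnit => p.1)
    (fun p : M.ι × PUnit => (ρ_ (M.X p.1)).hom) := monoHom_isMonomial _ _

variable [MonoidalPreadditive C]

theorem IsMonomial.tensor {M M' N N' : Mat_ C} {f : M ⟶ M'} {e : M.ι → M'.ι}
    {φ : ∀ i, M.X i ⟶ M'.X (e i)} (hf : IsMonomial f e φ) {g : N ⟶ N'} {e' : N.ι → N'.ι}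
    {ψ : ∀ i, N.X i ⟶ N'.X (e' i)} (hg : IsMonomial g e' ψ) :
    IsMonomial (f ⊗ₘ g) (fun p => (e p.1, e' p.2)) (fun p => φ p.1 ⊗ₘ ψ p.2) where
  diag p := by rw [tensorHom_apply, hf.diag, hg.diag]
  off p q h := by
    rw [tensorHom_apply]
    by_cases h₁ : e p.1 = q.1
    · rw [hg.off _ _ fun h₂ => h (Prod.ext h₁ h₂)]
      exact MonoidalPreadditive.tensor_zero _
    · rw [hf.off _ _ h₁]
      exact MonoidalPreadditive.zero_tensor _

end MatMonoidal

variable [MonoidalPreadditive C]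

instance : MonoidalCategory (Mat_ C) := MonoidalCategory.ofTensorHom
  (id_tensorHom_id := fun M N =>
    ((IsMonomial.id M).tensor (IsMonomial.id N)).ext (IsMonomial.id (M ⊗ N))
      fun _ => id_tensorHom_id _ _)
  (id_tensorHom := fun _ _ _ _ => rfl)
  (tensorHom_id := fun _ _ => rfl)
  (tensorHom_comp_tensorHom := fun f₁ f₂ g₁ g₂ => by
    apply Mat_.hom_ext
    intro p q
    rw [tensorHom_apply, Mat_.comp_apply, Mat_.comp_apply, Mat_.comp_apply]
    refine Eq.trans ?_ (sum_tensor _ _ _).symm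
    simp only [tensor_sum, ← tensorHom_comp_tensorHom]
    exact Fintype.sum_prod_type _)
  (associator_naturality := fun {X₁ X₂ X₃ Y₁ Y₂ Y₃} f₁ f₂ f₃ => by
    apply Mat_.hom_ext
    rintro p ⟨i', j', k'⟩
    refine ((assoc_mono Y₁ Y₂ Y₃).apply_comp (Equiv.prodAssoc Y₁.ι Y₂.ι Y₃.ι).injective
      ((f₁ ⊗ₘ f₂) ⊗ₘ f₃) p ((i', j'), k')).trans (Eq.trans ?_
        ((assoc_mono X₁ X₂ X₃).comp_apply _ _ _).symm)
    exact associator_naturality _ _ _)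
  (leftUnitor_naturality := fun {X Y} f => by
    apply Mat_.hom_ext
    rintro ⟨i, j⟩ j'
    refine ((left_mono Y).apply_comp (Equiv.punitProd Y.ι).injective (𝟙 (𝟙_ (Mat_ C)) ⊗ₘ f)
      (i, j) (i, j')).trans (Eq.trans ?_ ((left_mono X).comp_apply _ _ _).symm)
    have h := (IsMonomial.id (𝟙_ (Mat_ C))).diag i
    refine (congrArg (· ≫ _) ((congrArg (· ⊗ₘ f j j') h).trans (id_tensorHom _ _))).trans
      (leftUnitor_naturality _))
  (rightUnitor_naturality := fun {X Y} f => by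
    apply Mat_.hom_ext
    rintro ⟨j, i⟩ j'
    refine ((right_mono Y).apply_comp (Equiv.prodPUnit Y.ι).injective (f ⊗ₘ 𝟙 (𝟙_ (Mat_ C)))
      (j, i) (j', i)).trans (Eq.trans ?_ ((right_mono X).comp_apply _ _ _).symm)
    have h := (IsMonomial.id (𝟙_ (Mat_ C))).diag i
    refine (congrArg (· ≫ _) ((congrArg (f j j' ⊗ₘ ·) h).trans (tensorHom_id _ _))).trans
      (rightUnitor_naturality _))
  (pentagon := fun W X Y Z => by
    refine (((assoc_mono W X Y).tensor (.id Z)).comp ((assoc_mono W (X ⊗ Y) Z).comp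
      ((IsMonomial.id W).tensor (assoc_mono X Y Z)))).ext
        ((assoc_mono (W ⊗ X) Y Z).comp (assoc_mono W X (Y ⊗ Z))) fun p => ?_
    have := MonoidalCategory.pentagon (W.X p.1.1.1) (X.X p.1.1.2) (Y.X p.1.2) (Z.X p.2)
    rw [← tensorHom_id, ← id_tensorHom] at this
    exact this)
  (triangle := fun X Y => by
    refine ((assoc_mono X (𝟙_ (Mat_ C)) Y).comp ((IsMonomial.id X).tensor (left_mono Y))).ext
      ((right_mono X).tensor (.id Y)) fun p => ?_
    have := MonoidalCategory.triangle (X.X p.1.1) (Y.X p.2)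
    rw [← tensorHom_id, ← id_tensorHom] at this
    exact this)

instance : MonoidalPreadditive (Mat_ C) where
  whiskerLeft_zero := Mat_.hom_ext _ _ fun _ _ => MonoidalPreadditive.tensor_zero _
  zero_whiskerRight := Mat_.hom_ext _ _ fun _ _ => MonoidalPreadditive.zero_tensor _
  whiskerLeft_add _ _ := Mat_.hom_ext _ _ fun _ _ => MonoidalPreadditive.tensor_add _ _ _
  add_whiskerRight _ _ := Mat_.hom_ext _ _ fun _ _ => MonoidalPreadditive.add_tensor _ _ _

end MatMonoidal

section JonesWenzl

/-- The quantum integer `[n]`. -/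
def qInt (q : ℂ) (n : ℕ) : ℂ := (q ^ n - (q ^ n)⁻¹) / (q - q⁻¹)

variable {C : Type*} [Category C] [MonoidalCategory C]

/-- The tensor power `X ⊗ ⋯ ⊗ X` (`n` factors, bracketed to the left). -/
def tpow (X : C) : ℕ → C
  | 0 => 𝟙_ C
  | n + 1 => tpow X n ⊗ X

/-- The canonical (associativity) isomorphism between tensor powers. -/
def tpowAdd (X : C) (i : ℕ) : ∀ j : ℕ, tpow X i ⊗ tpow X j ≅ tpow X (i + j)
  | 0 => ρ_ (tpow X i)
  | j + 1 => (α_ (tpow X i) (tpow X j) X).symm ≪≫ whiskerRightIso (tpowAdd X i j) X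

/-- The endomorphism `cup ∘ cap` of the last two factors of `T ⊗ X ⊗ X`. -/
def capCup {X : C} (cup : 𝟙_ C ⟶ X ⊗ X) (cap : X ⊗ X ⟶ 𝟙_ C) (T : C) :
    (T ⊗ X) ⊗ X ⟶ (T ⊗ X) ⊗ X :=
  (α_ T X X).hom ≫ T ◁ (cap ≫ cup) ≫ (α_ T X X).inv

section
variable {X : C} (cup : 𝟙_ C ⟶ X ⊗ X) (cap : X ⊗ X ⟶ 𝟙_ C)

theorem capCup_comm (T : C) (f : T ⟶ T) :
    f ▷ X ▷ X ≫ capCup cup cap T = capCup cup cap T ≫ f ▷ X ▷ X := by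
  have h := whisker_exchange f (cap ≫ cup)
  have e : f ▷ X ▷ X = (α_ T X X).hom ≫ f ▷ (X ⊗ X) ≫ (α_ T X X).inv := by simp
  rw [e]
  simp only [capCup, Category.assoc, Iso.inv_hom_id_assoc]
  rw [← reassoc_of% h]

theorem capCup_braid
    (zz₁ : X ◁ cup ≫ (α_ X X X).inv ≫ cap ▷ X = (ρ_ X).hom ≫ (λ_ X).inv)
    (zz₂ : cup ▷ X ≫ (α_ X X X).hom ≫ X ◁ cap = (λ_ X).hom ≫ (ρ_ X).inv) (T : C) :
    capCup cup cap (T ⊗ X) ≫ capCup cup cap T ▷ X ≫ capCup cup cap (T ⊗ X) =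
      capCup cup cap (T ⊗ X) := by
  have h₁ : (T ⊗ X) ◁ cup ≫ (α_ (T ⊗ X) X X).inv ≫ (α_ T X X).hom ▷ X ≫ (T ◁ cap) ▷ X =
      (ρ_ (T ⊗ X)).hom ≫ (ρ_ T).inv ▷ X := by
    calc _ = (α_ T X (𝟙_ C)).hom ≫ T ◁ (X ◁ cup ≫ (α_ X X X).inv ≫ cap ▷ X) ≫
          (α_ T (𝟙_ C) X).inv := by monoidal
      _ = _ := by rw [zz₁]; monoidal
  have h₂ : (T ◁ cup) ▷ X ≫ (α_ T X X).inv ▷ X ≫ (α_ (T ⊗ X) X X).hom ≫ (T ⊗ X) ◁ cap =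
      (ρ_ T).hom ▷ X ≫ (ρ_ (T ⊗ X)).inv := by
    calc _ = (α_ T (𝟙_ C) X).hom ≫ T ◁ (cup ▷ X ≫ (α_ X X X).hom ≫ X ◁ cap) ≫
          (α_ T X (𝟙_ C)).inv := by monoidal
      _ = _ := by rw [zz₂]; monoidal
  simp only [capCup, whiskerLeft_comp, comp_whiskerRight, Category.assoc]
  rw [reassoc_of% h₁, reassoc_of% h₂]
  simp
end

variable [Preadditive C] [Linear ℂ C]

/-- One step `f ↦ f ⊗ 1 + c (f ⊗ 1) U (f ⊗ 1)` of the Jones–Wenzl recursion, where `U` is the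
cap-cup morphism on the last two factors. -/
def jwStep {X : C} (cup : 𝟙_ C ⟶ X ⊗ X) (cap : X ⊗ X ⟶ 𝟙_ C) (T : C) (f : T ⊗ X ⟶ T ⊗ X) (c : ℂ) :
    (T ⊗ X) ⊗ X ⟶ (T ⊗ X) ⊗ X :=
  f ▷ X + c • (f ▷ X ≫ capCup cup cap T ≫ f ▷ X)

/-- The Jones–Wenzl projections. -/
def jw (q : ℂ) {X : C} (cup : 𝟙_ C ⟶ X ⊗ X) (cap : X ⊗ X ⟶ 𝟙_ C) :
    ∀ n : ℕ, tpow X n ⟶ tpow X n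
  | 0 => 𝟙 _
  | 1 => 𝟙 _
  | n + 2 => jwStep cup cap (tpow X n) (jw q cup cap (n + 1)) (qInt q (n + 1) / qInt q (n + 2))

theorem qInt_rec {q : ℂ} (hq : q ≠ 0) (n : ℕ) :
    qInt q 2 * qInt q (n + 1) = qInt q n + qInt q (n + 2) := by
  by_cases h : q - q⁻¹ = 0
  · simp [qInt, h]
  · have h2 : qInt q 2 = q + q⁻¹ := by
      rw [qInt, div_eq_iff h]; field_simp; ring
    rw [h2]
    simp only [qInt]
    rw [← add_div, mul_div_assoc']
    congr 1
    field_simp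
    ring


variable [MonoidalPreadditive C] [MonoidalLinear ℂ C]

theorem capCup_sq {X : C} (cup : 𝟙_ C ⟶ X ⊗ X) (cap : X ⊗ X ⟶ 𝟙_ C) {δ : ℂ}
    (loop : cup ≫ cap = δ • 𝟙 (𝟙_ C)) (T : C) :
    capCup cup cap T ≫ capCup cup cap T = δ • capCup cup cap T := by
  have : (cap ≫ cup) ≫ (cap ≫ cup) = δ • (cap ≫ cup) := by
    rw [Category.assoc, reassoc_of% loop]; simp
  simp only [capCup, Category.assoc, Iso.inv_hom_id_assoc]
  rw [← whiskerLeft_comp_assoc, this, MonoidalLinear.whiskerLeft_smul, Linear.smul_comp,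
    Linear.comp_smul]

/-- The properties carried through the Jones–Wenzl recursion to prove idempotence. -/
structure JWGood {X : C} (cup : 𝟙_ C ⟶ X ⊗ X) (cap : X ⊗ X ⟶ 𝟙_ C) (T : C) (f : T ⟶ T)
    (g : T ⊗ X ⟶ T ⊗ X) (d : ℂ) : Prop where
  idem : g ≫ g = g
  absorb : f ▷ X ≫ g = g
  trace : capCup cup cap T ≫ g ▷ X ≫ capCup cup cap T = d • (capCup cup cap T ≫ f ▷ X ▷ X)

theorem JWGood.step {X : C} {cup : 𝟙_ C ⟶ X ⊗ X} {cap : X ⊗ X ⟶ 𝟙_ C} {δ : ℂ}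
    (zz₁ : X ◁ cup ≫ (α_ X X X).inv ≫ cap ▷ X = (ρ_ X).hom ≫ (λ_ X).inv)
    (zz₂ : cup ▷ X ≫ (α_ X X X).hom ≫ X ◁ cap = (λ_ X).hom ≫ (ρ_ X).inv)
    (loop : cup ≫ cap = δ • 𝟙 (𝟙_ C)) {T : C} {f : T ⟶ T} {g : T ⊗ X ⟶ T ⊗ X} {d : ℂ}
    (h : JWGood cup cap T f g d) {c : ℂ} (hc : c * c * d = -c) :
    JWGood cup cap (T ⊗ X) g (jwStep cup cap T g c) (δ + c) := by
  have hp : g ▷ X ≫ g ▷ X = g ▷ X := by rw [← comp_whiskerRight, h.idem]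
  have hr : f ▷ X ▷ X ≫ g ▷ X = g ▷ X := by rw [← comp_whiskerRight, h.absorb]
  have hpU : (g ▷ X ≫ capCup cup cap T ≫ g ▷ X) ≫ (g ▷ X ≫ capCup cup cap T ≫ g ▷ X) =
      d • (g ▷ X ≫ capCup cup cap T ≫ g ▷ X) := by
    have h1 := h.trace
    simp only [Category.assoc]
    rw [reassoc_of% hp, reassoc_of% h1]
    simp only [Linear.smul_comp, Linear.comp_smul, Category.assoc, hr]
  refine ⟨?_, ?_, ?_⟩
  · have h1 : g ▷ X ≫ g ▷ X ≫ capCup cup cap T ≫ g ▷ X = g ▷ X ≫ capCup cup cap T ≫ g ▷ X := by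
      rw [reassoc_of% hp]
    have h2 : (g ▷ X ≫ capCup cup cap T ≫ g ▷ X) ≫ g ▷ X = g ▷ X ≫ capCup cup cap T ≫ g ▷ X := by
      simp only [Category.assoc, hp]
    rw [jwStep, Preadditive.add_comp, Preadditive.comp_add, Preadditive.comp_add,
      Linear.smul_comp, Linear.comp_smul, Linear.smul_comp, Linear.comp_smul, h1, h2, hp, hpU,
      smul_smul, smul_smul, hc, neg_smul]
    abel
  · rw [jwStep, Preadditive.comp_add, Linear.comp_smul, reassoc_of% hp, hp]
  · have hR : g ▷ X ▷ X ≫ g ▷ X ▷ X = g ▷ X ▷ X := by rw [← comp_whiskerRight, hp]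
    have hRU := capCup_comm cup cap (T ⊗ X) g
    have hUU := capCup_sq cup cap loop (T ⊗ X)
    have hUV := capCup_braid cup cap zz₁ zz₂ T
    rw [jwStep, MonoidalPreadditive.add_whiskerRight, MonoidalLinear.smul_whiskerRight,
      comp_whiskerRight, comp_whiskerRight]
    generalize capCup cup cap (T ⊗ X) = U at *
    generalize g ▷ X ▷ X = R at *
    generalize capCup cup cap T ▷ X = V at *
    have h1 : U ≫ R ≫ U = δ • (U ≫ R) := by
      rw [hRU, reassoc_of% hUU, Linear.smul_comp]
    have h2 : U ≫ R ≫ V ≫ R ≫ U = U ≫ R := by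
      rw [hRU, ← reassoc_of% hRU, reassoc_of% hUV, reassoc_of% hRU, hR]
    simp only [Preadditive.add_comp, Preadditive.comp_add, Linear.smul_comp, Linear.comp_smul,
      Category.assoc, h1, h2, add_smul]

theorem jw_coef {q : ℂ} (hq : q ≠ 0) (n : ℕ) :
    qInt q (n + 1) / qInt q (n + 2) * (qInt q (n + 1) / qInt q (n + 2)) *
      (-qInt q 2 + qInt q n / qInt q (n + 1)) = -(qInt q (n + 1) / qInt q (n + 2)) := by
  have := qInt_rec hq n
  by_cases h1 : qInt q (n + 1) = 0
  · simp [h1]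
  by_cases h2 : qInt q (n + 2) = 0
  · simp [h2]
  have h3 : -qInt q 2 + qInt q n / qInt q (n + 1) = -(qInt q (n + 2) / qInt q (n + 1)) := by
    field_simp
    linear_combination -this
  rw [h3]
  field_simp

theorem jw_idem {q : ℂ} (hq : q ≠ 0) {X : C} (cup : 𝟙_ C ⟶ X ⊗ X) (cap : X ⊗ X ⟶ 𝟙_ C)
    (zz₁ : X ◁ cup ≫ (α_ X X X).inv ≫ cap ▷ X = (ρ_ X).hom ≫ (λ_ X).inv)
    (zz₂ : cup ▷ X ≫ (α_ X X X).hom ≫ X ◁ cap = (λ_ X).hom ≫ (ρ_ X).inv)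
    (loop : cup ≫ cap = (-qInt q 2) • 𝟙 (𝟙_ C)) (n : ℕ) :
    jw q cup cap n ≫ jw q cup cap n = jw q cup cap n := by
  have main : ∀ n, JWGood cup cap (tpow X n) (jw q cup cap n) (jw q cup cap (n + 1))
      (-qInt q 2 + qInt q n / qInt q (n + 1)) := by
    intro n
    induction n with
    | zero =>
      have h0 : qInt q 0 = 0 := by simp [qInt]
      rw [h0, zero_div, add_zero]
      have h : JWGood cup cap (𝟙_ C) (𝟙 _) (𝟙 _) (-qInt q 2) :=
        ⟨by simp, by simp, by simpa using capCup_sq cup cap loop (𝟙_ C)⟩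
      exact h
    | succ n ih => exact ih.step zz₁ zz₂ loop (jw_coef hq n)
  cases n with
  | zero => exact Category.comp_id _
  | succ n => exact (main n).idem

end JonesWenzl

section TemperleyLieb
open CategoryTheory.Idempotents

/-- The root of unity `q = exp (π i / (k + 2))`. -/
def qRoot (k : ℕ) : ℂ := Complex.exp (Real.pi * Complex.I / (k + 2))

/-- The value `δ = -[2]` of a loop. -/
def loopValue (k : ℕ) : ℂ := -qInt (qRoot k) 2

/-- The generating object of the linearized diagram category. -/
def linPt : Free ℂ Diag := (Free.embedding ℂ Diag).obj Diag.pt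

/-- The cup in the linearized diagram category. -/
def linCup : 𝟙_ (Free ℂ Diag) ⟶ linPt ⊗ linPt := (Free.embedding ℂ Diag).map Diag.cup

/-- The cap in the linearized diagram category. -/
def linCap : linPt ⊗ linPt ⟶ 𝟙_ (Free ℂ Diag) := (Free.embedding ℂ Diag).map Diag.cap

/-- The relation that a loop is equal to the scalar `δ`. -/
inductive LoopRel (δ : ℂ) : ∀ ⦃X Y : Free ℂ Diag⦄, (X ⟶ Y) → Prop
  | loop : LoopRel δ (linCup ≫ linCap - δ • 𝟙 (𝟙_ (Free ℂ Diag)))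

/-- The linearized diagram category modulo the relation that every loop is equal to `δ`. -/
abbrev TLPre (k : ℕ) := IdealQuotient (LoopRel (loopValue k))

namespace TLPre
variable (k : ℕ)

/-- The generating object. -/
def pt : TLPre k := (toIdealQuotient _).obj linPt

/-- The cup. -/
def cup : 𝟙_ (TLPre k) ⟶ pt k ⊗ pt k := (toIdealQuotient (LoopRel (loopValue k))).map linCup

/-- The cap. -/
def cap : pt k ⊗ pt k ⟶ 𝟙_ (TLPre k) := (toIdealQuotient (LoopRel (loopValue k))).map linCap

theorem diag_zigzag₁ : Diag.pt ◁ Diag.cup ≫ (α_ Diag.pt Diag.pt Diag.pt).inv ≫ Diag.cap ▷ Diag.pt =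
    (ρ_ Diag.pt).hom ≫ (λ_ Diag.pt).inv :=
  Diag.sound ((Word.Rel.comp_congr (.refl _) (.id_comp _)).trans
    (Word.Rel.zigzag_right.trans (Word.Rel.ident_comp_ident (rfl : 1 = 1) (rfl : 1 = 1)).symm))

theorem diag_zigzag₂ : Diag.cup ▷ Diag.pt ≫ (α_ Diag.pt Diag.pt Diag.pt).hom ≫ Diag.pt ◁ Diag.cap =
    (λ_ Diag.pt).hom ≫ (ρ_ Diag.pt).inv :=
  Diag.sound ((Word.Rel.comp_congr (.refl _) (.id_comp _)).trans
    (Word.Rel.zigzag_left.trans (Word.Rel.ident_comp_ident (rfl : 1 = 1) (rfl : 1 = 1)).symm))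

theorem lin_zigzag₁ : linPt ◁ linCup ≫ (α_ linPt linPt linPt).inv ≫ linCap ▷ linPt =
    (ρ_ linPt).hom ≫ (λ_ linPt).inv := by
  have h1 : linPt ◁ linCup = (Free.embedding ℂ Diag).map (Diag.pt ◁ Diag.cup) :=
    Finsupp.mapDomain_single
  have h2 : linCap ▷ linPt = (Free.embedding ℂ Diag).map (Diag.cap ▷ Diag.pt) :=
    Finsupp.mapDomain_single
  have h := congrArg (Free.embedding ℂ Diag).map diag_zigzag₁
  simp only [Functor.map_comp] at h
  rw [h1, h2]
  exact h

theorem lin_zigzag₂ : linCup ▷ linPt ≫ (α_ linPt linPt linPt).hom ≫ linPt ◁ linCap =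
    (λ_ linPt).hom ≫ (ρ_ linPt).inv := by
  have h1 : linPt ◁ linCap = (Free.embedding ℂ Diag).map (Diag.pt ◁ Diag.cap) :=
    Finsupp.mapDomain_single
  have h2 : linCup ▷ linPt = (Free.embedding ℂ Diag).map (Diag.cup ▷ Diag.pt) :=
    Finsupp.mapDomain_single
  have h := congrArg (Free.embedding ℂ Diag).map diag_zigzag₂
  simp only [Functor.map_comp] at h
  rw [h1, h2]
  exact h

theorem zigzag₁ : pt k ◁ cup k ≫ (α_ (pt k) (pt k) (pt k)).inv ≫ cap k ▷ pt k =
    (ρ_ (pt k)).hom ≫ (λ_ (pt k)).inv :=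
  congrArg (toIdealQuotient (LoopRel (loopValue k))).map lin_zigzag₁

theorem zigzag₂ : cup k ▷ pt k ≫ (α_ (pt k) (pt k) (pt k)).hom ≫ pt k ◁ cap k =
    (λ_ (pt k)).hom ≫ (ρ_ (pt k)).inv :=
  congrArg (toIdealQuotient (LoopRel (loopValue k))).map lin_zigzag₂

theorem loop : cup k ≫ cap k = (-qInt (qRoot k) 2) • 𝟙 (𝟙_ (TLPre k)) :=
  CategoryTheory.Quotient.sound (idealRel (LoopRel (loopValue k)))
    (TensorIdeal.of (S := LoopRel (loopValue k)) _ .loop)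

/-- The Jones–Wenzl projection `f_i`, an endomorphism of `i = 1 ⊗ ⋯ ⊗ 1`. -/
def proj (i : ℕ) : tpow (pt k) i ⟶ tpow (pt k) i := jw (qRoot k) (cup k) (cap k) i

theorem proj_idem (i : ℕ) : proj k i ≫ proj k i = proj k i :=
  jw_idem (Complex.exp_ne_zero _) _ _ (zigzag₁ k) (zigzag₂ k) (loop k) i

end TLPre

/-- The Temperley–Lieb category: the additive and idempotent completion of `TLPre k`. -/
abbrev TL (k : ℕ) := Karoubi (Mat_ (TLPre k))

namespace TL
variable (k : ℕ)

/-- The object `F_i = (i, f_i)`. -/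
def F (i : ℕ) : TL k where
  X := (Mat_.embedding (TLPre k)).obj (tpow (TLPre.pt k) i)
  p := (Mat_.embedding (TLPre k)).map (TLPre.proj k i)
  idem := by rw [← Functor.map_comp, TLPre.proj_idem]

/-- The canonical morphism between the tensor product of two one-by-one matrix objects and the
one-by-one matrix object on the tensor product. -/
def embMul (X Y : TLPre k) : (Mat_.embedding (TLPre k)).obj X ⊗ (Mat_.embedding (TLPre k)).obj Y ⟶
    (Mat_.embedding (TLPre k)).obj (X ⊗ Y) :=
  fun _ _ => 𝟙 (X ⊗ Y)

/-- The morphism `(x, p) ⟶ (y, p')` of the idempotent completion given by `p' ∘ g ∘ p`. -/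
def cut {P Q : TL k} (g : P.X ⟶ Q.X) : P ⟶ Q where
  f := P.p ≫ g ≫ Q.p
  comm := by simp

/-- The morphism `π_{i,j} = f_{i+j} ∘ (f_i ⊗ f_j) : F_i ⊗ F_j ⟶ F_{i+j}`. -/
def mulF (i j : ℕ) : F k i ⊗ F k j ⟶ F k (i + j) :=
  cut k (P := F k i ⊗ F k j) (Q := F k (i + j))
    (embMul k (tpow (TLPre.pt k) i) (tpow (TLPre.pt k) j) ≫
      (Mat_.embedding (TLPre k)).map (tpowAdd (TLPre.pt k) i j).hom)

/-- The identification of the unit object with `F_0`. -/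
def unitF : 𝟙_ (TL k) ⟶ F k 0 :=
  cut k (P := 𝟙_ (TL k)) (Q := F k 0) ((Mat_.embedding (TLPre k)).map (𝟙 (𝟙_ (TLPre k))))

/-- The generator `1_{F_{k+1}}` of the ideal `(F_{k+1})`. -/
inductive KillRel : ∀ ⦃X Y : TL k⦄, (X ⟶ Y) → Prop
  | mk : KillRel (𝟙 (F k (k + 1)))

end TL

/-- The reduced Temperley–Lieb category at level `k`: the quotient of the Temperley–Lieb category
by the tensor ideal generated by `F_{k+1}`. -/
abbrev RedTL (k : ℕ) := IdealQuotient (TL.KillRel k)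

namespace RedTL
variable (k : ℕ)

/-- The object `F_i` of the reduced Temperley–Lieb category. -/
def F (i : ℕ) : RedTL k := (toIdealQuotient (TL.KillRel k)).obj (TL.F k i)

/-- The morphism `π_{i,j} : F_i ⊗ F_j ⟶ F_{i+j}`. -/
def mulF (i j : ℕ) : F k i ⊗ F k j ⟶ F k (i + j) :=
  (toIdealQuotient (TL.KillRel k)).map (TL.mulF k i j)

/-- The identification of the unit object with `F_0`. -/
def unitF : 𝟙_ (RedTL k) ⟶ F k 0 := (toIdealQuotient (TL.KillRel k)).map (TL.unitF k)

/-- The object `Σ = F_0 ⊕ ⋯ ⊕ F_k`. -/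
def Sig : RedTL k := ⨁ fun i : Fin (k + 1) => F k i

/-- The inclusion of the summand `F_i` of `Σ`. -/
def incl (i : ℕ) (h : i < k + 1) : F k i ⟶ Sig k :=
  biproduct.ι (fun i : Fin (k + 1) => F k i) ⟨i, h⟩

/-- The projection of `Σ` to the summand `F_i`. -/
def projF (i : ℕ) (h : i < k + 1) : Sig k ⟶ F k i :=
  biproduct.π (fun i : Fin (k + 1) => F k i) ⟨i, h⟩

/-- The unit `u : 𝟙 = F_0 ⟶ Σ`. -/
def sigUnit : 𝟙_ (RedTL k) ⟶ Sig k := unitF k ≫ incl k 0 (Nat.succ_pos k)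

/-- The multiplication `m : Σ ⊗ Σ ⟶ Σ`, the sum of the morphisms `π_{i,j}` with `i + j ≤ k`. -/
def sigMul : Sig k ⊗ Sig k ⟶ Sig k :=
  ∑ i : Fin (k + 1), ∑ j : Fin (k + 1),
    (projF k i i.isLt ⊗ₘ projF k j j.isLt) ≫
      if h : (i : ℕ) + j < k + 1 then mulF k i j ≫ incl k (i + j) h else 0

/-- The projection `n : Σ ⟶ F_k`. -/
def sigProj : Sig k ⟶ F k k := projF k k (Nat.lt_succ_self k)

end RedTL
end TemperleyLieb

section Frobenius

variable {C : Type*} [Category C] [MonoidalCategory C]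

/-- The morphism `φ : A ⟶ W ⊗ A^∨` attached to a morphism `n : A ⟶ W` from an algebra with a dual
object `A^∨ = Aᘁ`, with coevaluation `𝟙 ⟶ A ⊗ A^∨` and evaluation `A^∨ ⊗ A ⟶ 𝟙`. -/
def frobeniusMap (A : C) [MonObj A] [HasRightDual A] {W : C} (n : A ⟶ W) : A ⟶ W ⊗ Aᘁ :=
  (ρ_ A).inv ≫ A ◁ (η_ A Aᘁ) ≫ (α_ A A Aᘁ).inv ≫ (MonObj.mul (X := A) ≫ n) ▷ Aᘁ

/-- `(W, n)` is a Frobenius structure on the algebra `A`. -/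
def IsFrobeniusStructure (A : C) [MonObj A] [HasRightDual A] (W : C) (n : A ⟶ W) : Prop :=
  IsIso (frobeniusMap A n)

end Frobenius

end

end TLJ

/-! By Yoneda, φ is an isomorphism as soon as composing with it is bijective on Hom(Y, Σ) for every
object Y. Duality identifies Hom(Y, F_k ⊗ Σ^∨) with Hom(Y ⊗ Σ, F_k), whichever dual is chosen, and
turns composition with φ into g ↦ n ∘ m ∘ (g ⊗ 1). On the summand Y ⊗ F_j only the component of g in
F_{k-j} contributes. So the claim reduces to perfectness of the products with i + j = k: the map g ↦
π_{i,j} ∘ (g ⊗ 1) from Hom(Y, F_i) to Hom(Y ⊗ F_j, F_k) is bijective.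

Perfectness is proved by induction on j, moving one strand at a time from the second factor to the
first. Injectivity (`mul_injective`) rests on the partial trace of f_{i+1}, which is -[i+2]/[i+1]
times f_i and hence a nonzero multiple of it for i < k: it recovers g from f_{i+1} ∘ (g ⊗ 1). For
surjectivity (`mul_surjective`), the induction hypothesis writes w as the product with a morphism g
: Y ⊗ X → F_{i+1}. Bend the last leg of g up to get a morphism Y → X^{i+2}. Its composite with
f_{i+2} is zero: if i + 2 ≤ k by injectivity, since w is compatible with f_{j+1}, which kills cups;
if i + 1 = k because f_{k+1} = 0 in the quotient. Expanding f_{i+2} by its recursion then solves for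
g and shows that it is a multiple of f_{i+1} ∘ (v ⊗ 1) for some v : Y → X^i, so the extra strand
splits off.

Apart from the zigzags, the loop value -[2] and q ≠ 0, this uses two facts: [1], …, [k+1] do not
vanish, and f_{k+1} = 0. The algebra axioms follow from absorption: a smaller projection followed by
a larger one is the larger one, on either side (`absorb_right`, `absorb_left`). The dual of Σ is
assembled from the self-duality of the generator by tensor powers, retracts and direct sums.

The calculation is done for an abstract self-dual object (`TLObject`) with images of its projections
(`JWImages`), and is carried to the reduced category along the monoidal functor from diagrams. -/

namespace TLJ

noncomputable section

/-! ### Strand calculus: tensor powers, cups and caps in a monoidal category. -/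

section Strands
variable {C : Type*} [Category C] [MonoidalCategory C]

/-- The cup to the right of an object `T`. -/
def cupAt {X : C} (cup : 𝟙_ C ⟶ X ⊗ X) (T : C) : T ⟶ (T ⊗ X) ⊗ X :=
  (ρ_ T).inv ≫ T ◁ cup ≫ (α_ T X X).inv

/-- The cap to the right of an object `T`. -/
def capAt {X : C} (cap : X ⊗ X ⟶ 𝟙_ C) (T : C) : (T ⊗ X) ⊗ X ⟶ T :=
  (α_ T X X).hom ≫ T ◁ cap ≫ (ρ_ T).hom

/-- A multiplication `A ⊗ B ⟶ N` extended by one strand on the right. -/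
def extendMul (X : C) {A B N : C} (s : A ⊗ B ⟶ N) : A ⊗ (B ⊗ X) ⟶ N ⊗ X :=
  (α_ A B X).inv ≫ s ▷ X

/-- Moving the first factor of `X ⊗ X ⊗ ⋯ ⊗ X` into the tensor power. -/
def tpowCons (X : C) : ∀ j : ℕ, X ⊗ tpow X j ⟶ tpow X (j + 1)
  | 0 => (ρ_ X).hom ≫ (λ_ X).inv
  | j + 1 => extendMul X (tpowCons X j)

/-- The inverse of `tpowCons`. -/
def tpowUncons (X : C) : ∀ j : ℕ, tpow X (j + 1) ⟶ X ⊗ tpow X j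
  | 0 => (λ_ X).hom ≫ (ρ_ X).inv
  | j + 1 => tpowUncons X j ▷ X ≫ (α_ X (tpow X j) X).hom

/-- The canonical morphism `X^i ⊗ X^j ⟶ X^n` for `i + j = n`. -/
def tpowMul (X : C) (i j : ℕ) {n : ℕ} (h : i + j = n) : tpow X i ⊗ tpow X j ⟶ tpow X n :=
  (tpowAdd X i j).hom ≫ eqToHom (congrArg (tpow X) h)

section
variable {X : C}

theorem extendMul_cons {A B B' N : C} (s : X ⊗ B ⟶ B') (m : A ⊗ B' ⟶ N) :
    extendMul X ((α_ A X B).hom ≫ A ◁ s ≫ m) =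
      (α_ A X (B ⊗ X)).hom ≫ A ◁ extendMul X s ≫ extendMul X m := by
  simp only [extendMul]
  monoidal

theorem extendMul_assoc {A B L M P N : C} (ab : A ⊗ B ⟶ M) (ml : M ⊗ L ⟶ N) (bl : B ⊗ L ⟶ P)
    (ap : A ⊗ P ⟶ N) (h : ab ▷ L ≫ ml = (α_ A B L).hom ≫ A ◁ bl ≫ ap) :
    ab ▷ (L ⊗ X) ≫ extendMul X ml =
      (α_ A B (L ⊗ X)).hom ≫ A ◁ extendMul X bl ≫ extendMul X ap := by
  have h' := congrArg (· ▷ X) h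
  simp only [comp_whiskerRight] at h'
  simp only [extendMul]
  calc _ = (α_ (A ⊗ B) L X).inv ≫ ab ▷ L ▷ X ≫ ml ▷ X := by monoidal
    _ = _ := by rw [h']; monoidal

theorem extendMul_natural {A A' B N : C} (f : A ⟶ A') (m : A' ⊗ B ⟶ N) :
    f ▷ (B ⊗ X) ≫ extendMul X m = extendMul X (f ▷ B ≫ m) := by
  simp [extendMul]

theorem extendMul_natural_assoc {A A' B N W : C} (f : A ⟶ A') (m : A' ⊗ B ⟶ N) (h : N ⊗ X ⟶ W) :
    f ▷ (B ⊗ X) ≫ extendMul X m ≫ h = extendMul X (f ▷ B ≫ m) ≫ h := by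
  rw [← extendMul_natural, Category.assoc]

theorem extendMul_natural_right {A B B' N : C} (f : B ⟶ B') (m : A ⊗ B' ⟶ N) :
    A ◁ (f ▷ X) ≫ extendMul X m = extendMul X (A ◁ f ≫ m) := by
  simp [extendMul]

theorem extendMul_natural_right_assoc {A B B' N W : C} (f : B ⟶ B') (m : A ⊗ B' ⟶ N)
    (h : N ⊗ X ⟶ W) :
    A ◁ (f ▷ X) ≫ extendMul X m ≫ h = extendMul X (A ◁ f ≫ m) ≫ h := by
  rw [← extendMul_natural_right, Category.assoc]

theorem extendMul_comp {A B N N' : C} (m : A ⊗ B ⟶ N) (g : N ⟶ N') :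
    extendMul X m ≫ g ▷ X = extendMul X (m ≫ g) := by
  simp [extendMul]

theorem extendMul_comp_assoc {A B N N' W : C} (m : A ⊗ B ⟶ N) (g : N ⟶ N') (h : N' ⊗ X ⟶ W) :
    extendMul X m ≫ g ▷ X ≫ h = extendMul X (m ≫ g) ≫ h := by
  rw [← extendMul_comp, Category.assoc]

theorem whiskerRight_comp_absorb {Y T B M : C} (g : Y ⟶ T) (f : T ⟶ T) (m : T ⊗ B ⟶ M)
    (h : f ▷ B ≫ m = m) : (g ≫ f) ▷ B ≫ m = g ▷ B ≫ m := by
  rw [comp_whiskerRight_assoc, h]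

theorem whiskerRight_cons {Y A B B' N : C} (g : Y ⟶ A) (s : X ⊗ B ⟶ B') (m : A ⊗ B' ⟶ N) :
    g ▷ X ▷ B ≫ (α_ A X B).hom ≫ A ◁ s ≫ m = (α_ Y X B).hom ≫ Y ◁ s ≫ g ▷ B' ≫ m := by
  rw [whisker_exchange_assoc]
  simp

end

section
variable (X : C)

theorem tpowMul_zero_right (i : ℕ) : tpowMul X i 0 (n := i) rfl = (ρ_ (tpow X i)).hom :=
  Category.comp_id _

theorem tpowMul_succ_right (i j : ℕ) {n : ℕ} (h : i + j = n) :
    tpowMul X i (j + 1) (n := n + 1) (congrArg (· + 1) h) = extendMul X (tpowMul X i j h) := by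
  subst h
  have : tpowMul X i j rfl = (tpowAdd X i j).hom := Category.comp_id _
  rw [this]
  exact Category.comp_id _

theorem tpowMul_zero_left (j : ℕ) : tpowMul X 0 j (zero_add j) = (λ_ (tpow X j)).hom := by
  induction j with
  | zero => exact (tpowMul_zero_right X 0).trans (unitors_equal (C := C)).symm
  | succ j ih =>
    refine (tpowMul_succ_right X 0 j (zero_add j)).trans ?_
    have e : extendMul X (λ_ (tpow X j)).hom = (λ_ (tpow X j ⊗ X)).hom := by simp [extendMul]
    rw [ih]
    exact e

/-- The canonical map is defined by recursion on the last strand of the second factor, whereas the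
perfectness argument transfers the first strand of the second factor to the first one. This is the
coherence statement that reconciles the two. -/
theorem tpowMul_succ_left (i j : ℕ) {n : ℕ} (h : i + 1 + j = n) (h' : i + (j + 1) = n) :
    tpowMul X (i + 1) j h = (α_ (tpow X i) X (tpow X j)).hom ≫ tpow X i ◁ tpowCons X j ≫
      tpowMul X i (j + 1) h' := by
  induction j generalizing n with
  | zero =>
    subst h
    rw [tpowMul_zero_right, tpowMul_succ_right X i 0 rfl, tpowMul_zero_right]
    -- Stated for an arbitrary object, so that the coherence tactics see a visible tensor product.
    -- The identification of `tpow X (i + 1)` with `tpow X i ⊗ X` is left to definitional unfolding;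
    -- the same device recurs below.
    have e : ∀ A : C, (ρ_ (A ⊗ X)).hom = (α_ A X (𝟙_ C)).hom ≫ A ◁ ((ρ_ X).hom ≫ (λ_ X).inv) ≫
      extendMul X (ρ_ A).hom := fun A => by simp only [extendMul]; monoidal
    exact e _
  | succ j ih =>
    obtain _ | n := n
    · omega
    refine (tpowMul_succ_right X (i + 1) j (n := n) (by omega)).trans ?_
    rw [ih (by omega) (by omega), tpowMul_succ_right X i (j + 1) (n := n) (by omega)]
    exact extendMul_cons _ _

theorem whiskerRight_tpowMul_succ_left {i j n : ℕ} (h : i + 1 + j = n) (h' : i + (j + 1) = n)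
    {Z W : C} (v : Z ⟶ tpow X i) (f : tpow X n ⟶ W) :
    v ▷ X ▷ tpow X j ≫ (tpowMul X (i + 1) j h : (tpow X i ⊗ X) ⊗ tpow X j ⟶ _) ≫ f =
      (α_ Z X (tpow X j)).hom ≫ Z ◁ tpowCons X j ≫ v ▷ tpow X (j + 1) ≫
        tpowMul X i (j + 1) h' ≫ f := by
  rw [tpowMul_succ_left X i j h h']
  simp only [Category.assoc]
  rw [whiskerRight_cons]

theorem tpowMul_assoc (i j l : ℕ) {m p n : ℕ} (hm : i + j = m) (hp : j + l = p) (h : m + l = n)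
    (h' : i + p = n) :
    tpowMul X i j hm ▷ tpow X l ≫ tpowMul X m l h =
      (α_ _ _ _).hom ≫ tpow X i ◁ tpowMul X j l hp ≫ tpowMul X i p h' := by
  induction l generalizing p n with
  | zero =>
    obtain rfl : j = p := hp
    obtain rfl : m = n := h
    rw [tpowMul_zero_right, tpowMul_zero_right]
    have e : ∀ {A B M : C} (f : A ⊗ B ⟶ M), f ▷ 𝟙_ C ≫ (ρ_ M).hom =
      (α_ A B (𝟙_ C)).hom ≫ A ◁ (ρ_ B).hom ≫ f := fun f => by simp
    exact e _
  | succ l ih =>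
    obtain _ | n := n
    · omega
    obtain _ | p := p
    · omega
    rw [tpowMul_succ_right X m l (n := n) (by omega), tpowMul_succ_right X j l (n := p) (by omega),
      tpowMul_succ_right X i p (n := n) (by omega)]
    exact extendMul_assoc _ _ _ _ (ih _ _ _)

/-- Makes `tpowCons` a split epimorphism, which is what is needed to cancel it at the end of
`mul_surjective`. -/
theorem tpowUncons_tpowCons (j : ℕ) : tpowUncons X j ≫ tpowCons X j = 𝟙 _ := by
  induction j with
  | zero =>
    have e : ((λ_ X).hom ≫ (ρ_ X).inv) ≫ (ρ_ X).hom ≫ (λ_ X).inv = 𝟙 (𝟙_ C ⊗ X) := by simp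
    exact e
  | succ j ih =>
    have e : ∀ {B N : C} (u : N ⟶ X ⊗ B) (s : X ⊗ B ⟶ N), u ≫ s = 𝟙 _ →
      (u ▷ X ≫ (α_ X B X).hom) ≫ extendMul X s = 𝟙 _ := fun u s h => by
        simp [extendMul, ← comp_whiskerRight, h]
    exact e _ _ ih

end

section
variable {X : C} (cup : 𝟙_ C ⟶ X ⊗ X) (cap : X ⊗ X ⟶ 𝟙_ C)

theorem cupAt_natural {S T : C} (g : S ⟶ T) :
    g ≫ cupAt cup T = cupAt cup S ≫ g ▷ X ▷ X := by
  have h := whisker_exchange g cup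
  simp only [cupAt, Category.assoc]
  have e : g ≫ (ρ_ T).inv = (ρ_ S).inv ≫ g ▷ 𝟙_ C := by simp
  rw [reassoc_of% e, ← reassoc_of% h]
  simp

theorem cupAt_natural_assoc {S T W : C} (g : S ⟶ T) (h : (T ⊗ X) ⊗ X ⟶ W) :
    g ≫ cupAt cup T ≫ h = cupAt cup S ≫ g ▷ X ▷ X ≫ h := by
  rw [← Category.assoc, cupAt_natural, Category.assoc]

theorem capAt_natural {S T : C} (g : S ⟶ T) :
    g ▷ X ▷ X ≫ capAt cap T = capAt cap S ≫ g := by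
  have h := whisker_exchange g cap
  simp only [capAt, Category.assoc]
  rw [← rightUnitor_naturality, reassoc_of% h]
  simp

theorem capCup_eq (T : C) : capCup cup cap T = capAt cap T ≫ cupAt cup T := by
  simp [capCup, capAt, cupAt]

theorem whiskerLeft_cupAt {A B N : C} (m : A ⊗ B ⟶ N) :
    A ◁ cupAt cup B ≫ extendMul X (extendMul X m) = m ≫ cupAt cup N := by
  rw [cupAt_natural]
  simp only [cupAt, extendMul]
  monoidal

theorem whiskerLeft_capAt {A B N : C} (m : A ⊗ B ⟶ N) :
    extendMul X (extendMul X m) ≫ capAt cap N = A ◁ capAt cap B ≫ m := by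
  have h := capAt_natural cap m
  simp only [extendMul, comp_whiskerRight, Category.assoc]
  rw [h]
  simp only [capAt]
  monoidal

theorem whiskerLeft_capAt_assoc {A B N W : C} (m : A ⊗ B ⟶ N) (h : N ⟶ W) :
    extendMul X (extendMul X m) ≫ capAt cap N ≫ h = A ◁ capAt cap B ≫ m ≫ h := by
  rw [← Category.assoc, whiskerLeft_capAt, Category.assoc]

/-- The multiplication extended by two strands does not touch these strands, so a cap-cup on them
slides through. -/
theorem whiskerLeft_capCup {A B N : C} (m : A ⊗ B ⟶ N) :
    A ◁ capCup cup cap B ≫ extendMul X (extendMul X m) =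
      extendMul X (extendMul X m) ≫ capCup cup cap N := by
  rw [capCup_eq, capCup_eq, whiskerLeft_capAt_assoc, MonoidalCategory.whiskerLeft_comp,
    Category.assoc, whiskerLeft_cupAt]

theorem whiskerLeft_capCup_assoc {A B N W : C} (m : A ⊗ B ⟶ N) (h : (N ⊗ X) ⊗ X ⟶ W) :
    A ◁ capCup cup cap B ≫ extendMul X (extendMul X m) ≫ h =
      extendMul X (extendMul X m) ≫ capCup cup cap N ≫ h := by
  rw [← Category.assoc, whiskerLeft_capCup, Category.assoc]

variable {cup cap}

theorem cupAt_capAt_right (zz₂ : cup ▷ X ≫ (α_ X X X).hom ≫ X ◁ cap = (λ_ X).hom ≫ (ρ_ X).inv)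
    (T : C) : cupAt cup T ▷ X ≫ capAt cap (T ⊗ X) = 𝟙 _ := by
  calc _ = (ρ_ T).inv ▷ X ≫ (α_ T (𝟙_ C) X).hom ≫ T ◁ (cup ▷ X ≫ (α_ X X X).hom ≫ X ◁ cap) ≫
          (α_ T X (𝟙_ C)).inv ≫ (ρ_ (T ⊗ X)).hom := by simp only [cupAt, capAt]; monoidal
      _ = _ := by rw [zz₂]; monoidal

theorem cupAt_capAt_left (zz₁ : X ◁ cup ≫ (α_ X X X).inv ≫ cap ▷ X = (ρ_ X).hom ≫ (λ_ X).inv)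
    (T : C) : cupAt cup (T ⊗ X) ≫ capAt cap T ▷ X = 𝟙 _ := by
  calc _ = (ρ_ (T ⊗ X)).inv ≫ (α_ T X (𝟙_ C)).hom ≫ T ◁ (X ◁ cup ≫ (α_ X X X).inv ≫ cap ▷ X) ≫
          (α_ T (𝟙_ C) X).inv ≫ (ρ_ T).hom ▷ X := by simp only [cupAt, capAt]; monoidal
      _ = _ := by rw [zz₁]; monoidal

theorem cup_cons_cons {B B' B'' : C} (s : X ⊗ B ⟶ B') (s' : X ⊗ B' ⟶ B'') :
    cup ▷ (B ⊗ X) ≫ (α_ X X (B ⊗ X)).hom ≫ X ◁ extendMul X s ≫ extendMul X s' =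
      (α_ (𝟙_ C) B X).inv ≫ (cup ▷ B ≫ (α_ X X B).hom ≫ X ◁ s ≫ s') ▷ X := by
  simp only [extendMul]
  monoidal

variable [Preadditive C] [Linear ℂ C]

theorem whiskerRight_jwStep_absorb {T : C} {f : T ⊗ X ⟶ T ⊗ X} (hf : f ≫ f = f) (c : ℂ) :
    f ▷ X ≫ jwStep cup cap T f c = jwStep cup cap T f c := by
  have hp : f ▷ X ≫ f ▷ X = f ▷ X := by rw [← comp_whiskerRight, hf]
  rw [jwStep, Preadditive.comp_add, Linear.comp_smul, reassoc_of% hp, hp]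

/-- After the cup, the second term of the recursion contains the partial trace of f, which is d
times e. Since e is absorbed by f, this term is c d = -1 times the first one, and the two cancel. -/
theorem cupAt_jwStep {T : C} {e : T ⟶ T} {f : T ⊗ X ⟶ T ⊗ X} {c d : ℂ}
    (he : e ▷ X ≫ f = f) (hd : cupAt cup T ≫ f ▷ X ≫ capAt cap T = d • e) (hcd : c * d = -1) :
    cupAt cup T ≫ jwStep cup cap T f c = 0 := by
  have h : e ≫ cupAt cup T ≫ f ▷ X = cupAt cup T ≫ f ▷ X := by
    rw [cupAt_natural_assoc, ← comp_whiskerRight, he]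
  simp only [jwStep, capCup_eq, Preadditive.comp_add, Linear.comp_smul, Category.assoc]
  rw [reassoc_of% hd]
  simp only [Linear.smul_comp, h, smul_smul, hcd]
  simp

variable [MonoidalPreadditive C]

/-- Closing the extra strand of f ∘ (g ⊗ 1) gives d times e ∘ g, that is d times g. -/
theorem eq_zero_of_whiskerRight_comp {Y T : C} {e : T ⟶ T} {f : T ⊗ X ⟶ T ⊗ X} {d : ℂ}
    (hd : cupAt cup T ≫ f ▷ X ≫ capAt cap T = d • e) (hd0 : d ≠ 0) {g : Y ⟶ T} (hg : g ≫ e = g)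
    (h : g ▷ X ≫ f = 0) : g = 0 := by
  have h1 : d • g = 0 := by
    rw [← hg, ← Linear.comp_smul, ← hd, cupAt_natural_assoc, ← comp_whiskerRight_assoc, h]
    simp
  exact (smul_eq_zero.mp h1).resolve_left hd0

variable [MonoidalLinear ℂ C]

theorem cupAt_capAt {δ : ℂ} (loop : cup ≫ cap = δ • 𝟙 (𝟙_ C)) (T : C) :
    cupAt cup T ≫ capAt cap T = δ • 𝟙 T := by
  simp only [cupAt, capAt, Category.assoc, Iso.inv_hom_id_assoc]
  rw [← MonoidalCategory.whiskerLeft_comp_assoc, loop]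
  simp [MonoidalLinear.whiskerLeft_smul]

/-- Closing the last strand turns f ⊗ 1 into a loop next to f. In the second term the closed strand
straightens by the two zigzags, which leaves f ∘ f = f. -/
theorem ptr_jwStep {δ : ℂ} (zz₁ : X ◁ cup ≫ (α_ X X X).inv ≫ cap ▷ X = (ρ_ X).hom ≫ (λ_ X).inv)
    (zz₂ : cup ▷ X ≫ (α_ X X X).hom ≫ X ◁ cap = (λ_ X).hom ≫ (ρ_ X).inv)
    (loop : cup ≫ cap = δ • 𝟙 (𝟙_ C)) {T : C} {f : T ⊗ X ⟶ T ⊗ X} (hf : f ≫ f = f) (c : ℂ) :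
    cupAt cup (T ⊗ X) ≫ jwStep cup cap T f c ▷ X ≫ capAt cap (T ⊗ X) = (δ + c) • f := by
  have h1 : cupAt cup (T ⊗ X) ≫ f ▷ X ▷ X ≫ capAt cap (T ⊗ X) = δ • f := by
    rw [capAt_natural, reassoc_of% (cupAt_capAt loop (T ⊗ X))]
    simp
  have h2 : cupAt cup (T ⊗ X) ≫ f ▷ X ▷ X ≫ capAt cap T ▷ X ≫ cupAt cup T ▷ X ≫ f ▷ X ▷ X ≫
      capAt cap (T ⊗ X) = f := by
    rw [capAt_natural, reassoc_of% (cupAt_capAt_right zz₂ T), ← cupAt_natural_assoc,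
      reassoc_of% (cupAt_capAt_left zz₁ T), hf]
  simp only [jwStep, capCup_eq, MonoidalPreadditive.add_whiskerRight,
    MonoidalLinear.smul_whiskerRight, comp_whiskerRight, Preadditive.add_comp,
    Preadditive.comp_add, Linear.smul_comp, Linear.comp_smul, Category.assoc, h1, h2, add_smul]

/-- Only f ⊗ 1 survives in the recursion: the cap-cup of the other term slides through the
multiplication, and its cup is killed by g'. The surviving f is absorbed by hypothesis, because g'
absorbs g. -/
theorem absorb_left_step {A B N : C} {m : A ⊗ B ⟶ N} {f : B ⊗ X ⟶ B ⊗ X} {g : N ⊗ X ⟶ N ⊗ X}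
    {g' : (N ⊗ X) ⊗ X ⟶ (N ⊗ X) ⊗ X} {c : ℂ}
    (h : A ◁ f ≫ extendMul X m ≫ g = extendMul X m ≫ g) (hg : g ▷ X ≫ g' = g')
    (hk : cupAt cup N ≫ g' = 0) :
    A ◁ jwStep cup cap B f c ≫ extendMul X (extendMul X m) ≫ g' =
      extendMul X (extendMul X m) ≫ g' := by
  have h1 : A ◁ (f ▷ X) ≫ extendMul X (extendMul X m) ≫ g' = extendMul X (extendMul X m) ≫ g' := by
    rw [← hg, extendMul_natural_right_assoc, extendMul_comp_assoc, extendMul_comp_assoc,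
      Category.assoc, h]
  simp only [jwStep, MonoidalPreadditive.whiskerLeft_add, MonoidalLinear.whiskerLeft_smul,
    MonoidalCategory.whiskerLeft_comp, Preadditive.add_comp, Linear.smul_comp, Category.assoc, h1,
    whiskerLeft_capCup_assoc]
  rw [capCup_eq, Category.assoc, hk]
  simp

/-- The recursion, applied to the mate of g, expresses this mate as -c times a cup added to v and
followed by f ⊗ 1, where v is the mate with its last two strands capped. Bending the last strand
back down yields g itself. -/
theorem eq_smul_of_mate_comp_jwStep
    (zz₂ : cup ▷ X ≫ (α_ X X X).hom ≫ X ◁ cap = (λ_ X).hom ≫ (ρ_ X).inv)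
    {Y T : C} {f : T ⊗ X ⟶ T ⊗ X} {c : ℂ} {g : Y ⊗ X ⟶ T ⊗ X} (hg : g ≫ f = g)
    (h : cupAt cup Y ≫ g ▷ X ≫ jwStep cup cap T f c = 0) :
    g = (-c) • ((cupAt cup Y ≫ g ▷ X ≫ capAt cap T) ▷ X ≫ f) := by
  have hgf : g ▷ X ≫ f ▷ X = g ▷ X := by rw [← comp_whiskerRight, hg]
  simp only [jwStep, capCup_eq, Preadditive.comp_add, Linear.comp_smul, Category.assoc] at h
  rw [reassoc_of% hgf, hgf] at h
  have h1 := eq_neg_of_add_eq_zero_left h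
  have h2 : (cupAt cup Y ≫ g ▷ X) ▷ X ≫ capAt cap (T ⊗ X) = g := by
    rw [comp_whiskerRight_assoc, capAt_natural, reassoc_of% (cupAt_capAt_right zz₂ Y)]
  rw [h1, ← neg_smul, MonoidalLinear.smul_whiskerRight, Linear.smul_comp] at h2
  refine h2.symm.trans ?_
  congr 1
  simp only [comp_whiskerRight, Category.assoc]
  rw [capAt_natural, reassoc_of% (cupAt_capAt_right zz₂ T)]
end
end Strands

/-! ### Jones–Wenzl projections: partial traces, absorption and perfect products. -/

section JonesWenzlCalculus
variable {C : Type*} [Category C] [MonoidalCategory C] [Preadditive C] [Linear ℂ C]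
  [MonoidalPreadditive C] [MonoidalLinear ℂ C]

/-- A self-dual object `X` whose loop has the value `-[2]`, at a parameter `q` for which the quantum
integers `[1], …, [N + 1]` do not vanish. -/
structure TLObject (q : ℂ) (N : ℕ) {X : C} (cup : 𝟙_ C ⟶ X ⊗ X) (cap : X ⊗ X ⟶ 𝟙_ C) : Prop where
  q_ne_zero : q ≠ 0
  zz₁ : X ◁ cup ≫ (α_ X X X).inv ≫ cap ▷ X = (ρ_ X).hom ≫ (λ_ X).inv
  zz₂ : cup ▷ X ≫ (α_ X X X).hom ≫ X ◁ cap = (λ_ X).hom ≫ (ρ_ X).inv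
  loop : cup ≫ cap = (-qInt q 2) • 𝟙 (𝟙_ C)
  qInt_ne_zero : ∀ n, n ≤ N → qInt q (n + 1) ≠ 0

namespace TLObject
variable {q : ℂ} {N : ℕ} {X : C} {cup : 𝟙_ C ⟶ X ⊗ X} {cap : X ⊗ X ⟶ 𝟙_ C}

theorem idem (H : TLObject q N cup cap) (n : ℕ) : jw q cup cap n ≫ jw q cup cap n = jw q cup cap n :=
  jw_idem H.q_ne_zero cup cap H.zz₁ H.zz₂ H.loop n

theorem absorb_succ (H : TLObject q N cup cap) (n : ℕ) :
    jw q cup cap n ▷ X ≫ (jw q cup cap (n + 1) : tpow X n ⊗ X ⟶ tpow X n ⊗ X) =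
      jw q cup cap (n + 1) := by
  cases n with
  | zero =>
    have e : 𝟙 (𝟙_ C) ▷ X ≫ 𝟙 (𝟙_ C ⊗ X) = 𝟙 _ := by simp
    exact e
  | succ n => exact whiskerRight_jwStep_absorb (H.idem (n + 1)) _

/-- One step of the recursion adds the loop value to its coefficient, and -[2] + [n+1]/[n+2] =
-[n+3]/[n+2] by the recurrence of the quantum integers. -/
theorem ptr (H : TLObject q N cup cap) (n : ℕ) (hn : n ≤ N) :
    cupAt cup (tpow X n) ≫ (jw q cup cap (n + 1) : tpow X n ⊗ X ⟶ tpow X n ⊗ X) ▷ X ≫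
      capAt cap (tpow X n) = (-(qInt q (n + 2) / qInt q (n + 1))) • jw q cup cap n := by
  have hq := H.qInt_ne_zero n hn
  cases n with
  | zero =>
    have h1 : qInt q 1 ≠ 0 := hq
    -- If q were equal to its inverse, all quantum integers would be 0 by the convention for
    -- division by zero; [1] ≠ 0 excludes this.
    have h1' : qInt q 1 = 1 := by
      have h : q - q⁻¹ ≠ 0 := fun h => h1 (by simp [qInt, h])
      simp [qInt, h]
    have e : cupAt cup (𝟙_ C) ≫ 𝟙 (𝟙_ C ⊗ X) ▷ X ≫ capAt cap (𝟙_ C) =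
        (-(qInt q 2 / qInt q 1)) • 𝟙 (𝟙_ C) := by
      rw [h1', div_one, id_whiskerRight, Category.id_comp, cupAt_capAt H.loop]
    exact e
  | succ n =>
    have := ptr_jwStep H.zz₁ H.zz₂ H.loop (H.idem (n + 1)) (qInt q (n + 1) / qInt q (n + 2))
    refine Eq.trans this ?_
    congr 1
    have := qInt_rec H.q_ne_zero (n + 1)
    have hq' : qInt q (n + 2) ≠ 0 := hq
    simp only [add_assoc, Nat.reduceAdd] at this ⊢
    field_simp
    linear_combination -this

/-- The coefficient [n+1]/[n+2] of the recursion is minus the inverse of the partial trace factor of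
the preceding projection, so the two terms cancel on a cup. -/
theorem cup_jw (H : TLObject q N cup cap) (n : ℕ) (hn : n + 1 ≤ N) :
    cupAt cup (tpow X n) ≫ (jw q cup cap (n + 2) : (tpow X n ⊗ X) ⊗ X ⟶ (tpow X n ⊗ X) ⊗ X) = 0 := by
  have h1 := H.qInt_ne_zero n (by omega)
  have h2 := H.qInt_ne_zero (n + 1) hn
  refine cupAt_jwStep (H.absorb_succ n) (H.ptr n (by omega)) ?_
  rw [add_assoc] at h2
  norm_num at h2
  field_simp

/-- The recursion starts and ends with the previous projection on the left strands, so idempotence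
suffices. No quantum integer has to be nonzero, hence no bound on n. -/
theorem absorb_right (H : TLObject q N cup cap) (i j : ℕ) {n : ℕ} (h : i + j = n) :
    jw q cup cap i ▷ tpow X j ≫ tpowMul X i j h ≫ jw q cup cap n =
      tpowMul X i j h ≫ jw q cup cap n := by
  induction j generalizing n with
  | zero =>
    obtain rfl : i = n := h
    rw [tpowMul_zero_right]
    have e : ∀ {A : C} (f : A ⟶ A), f ≫ f = f → f ▷ (𝟙_ C) ≫ (ρ_ A).hom ≫ f = (ρ_ A).hom ≫ f :=
      fun f hf => by simp [hf]
    exact e _ (H.idem i)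
  | succ j ih =>
    obtain _ | n := n
    · omega
    have hn : i + j = n := by omega
    rw [tpowMul_succ_right X i j hn]
    have e : ∀ {A B M : C} (f : A ⟶ A) (m : A ⊗ B ⟶ M) (g : M ⟶ M) (g' : M ⊗ X ⟶ M ⊗ X),
        f ▷ B ≫ m ≫ g = m ≫ g → g ▷ X ≫ g' = g' →
        f ▷ (B ⊗ X) ≫ extendMul X m ≫ g' = extendMul X m ≫ g' := by
      intro A B M f m g g' h1 h2
      rw [← h2, extendMul_natural_assoc, extendMul_comp_assoc, extendMul_comp_assoc, Category.assoc,
        h1]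
    exact e _ _ _ _ (ih hn) (H.absorb_succ n)

/-- The recursion is not symmetric: absorbing a projection placed on the right strands requires that
the large projection kill cups, whence the bound on n. -/
theorem absorb_left (H : TLObject q N cup cap) (i j : ℕ) {n : ℕ} (h : i + j = n) (hn : n ≤ N + 1) :
    tpow X i ◁ jw q cup cap j ≫ tpowMul X i j h ≫ jw q cup cap n =
      tpowMul X i j h ≫ jw q cup cap n := by
  have e : ∀ {A B M : C} (m : A ⊗ B ⟶ M), A ◁ 𝟙 B ≫ m = m := fun m => by simp
  induction j using Nat.twoStepInduction generalizing n with
  | zero => exact e _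
  | one => exact e _
  | more j _ ih =>
    obtain _ | _ | n := n
    · omega
    · omega
    have hn' : i + j = n := by omega
    have ih := ih (n := n + 1) (by omega) (by omega)
    rw [tpowMul_succ_right X i j hn'] at ih
    rw [tpowMul_succ_right X i (j + 1) (n := n + 1) (by omega), tpowMul_succ_right X i j hn']
    exact absorb_left_step ih (H.absorb_succ (n + 1)) (H.cup_jw n (by omega))

theorem absorb_cons (H : TLObject q N cup cap) (j : ℕ) (hj : j ≤ N) :
    X ◁ jw q cup cap j ≫ tpowCons X j ≫ jw q cup cap (j + 1) =
      tpowCons X j ≫ jw q cup cap (j + 1) := by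
  have e : ∀ {A B M : C} (m : A ⊗ B ⟶ M), A ◁ 𝟙 B ≫ m = m := fun m => by simp
  induction j using Nat.twoStepInduction with
  | zero => exact e _
  | one => exact e _
  | more j _ ih =>
    exact absorb_left_step (ih (by omega)) (H.absorb_succ (j + 2)) (H.cup_jw (j + 1) (by omega))

/-- A cup on the first two strands is already killed by f_2, and every larger projection absorbs f_2
on its first two strands. The induction adds one strand on the right at a time. -/
theorem cup_cons_jw (H : TLObject q N cup cap) (j : ℕ) (hj : j + 1 ≤ N) :
    cup ▷ tpow X j ≫ (α_ X X (tpow X j)).hom ≫ X ◁ tpowCons X j ≫ tpowCons X (j + 1) ≫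
      jw q cup cap (j + 2) = 0 := by
  induction j with
  | zero =>
    have h := H.cup_jw 0 hj
    have e : ∀ g : (𝟙_ C ⊗ X) ⊗ X ⟶ (𝟙_ C ⊗ X) ⊗ X, cupAt cup (𝟙_ C) ≫ g = 0 →
        cup ▷ 𝟙_ C ≫ (α_ X X (𝟙_ C)).hom ≫ X ◁ ((ρ_ X).hom ≫ (λ_ X).inv) ≫
          extendMul X ((ρ_ X).hom ≫ (λ_ X).inv) ≫ g = 0 := by
      intro g hg
      have : cup ▷ 𝟙_ C ≫ (α_ X X (𝟙_ C)).hom ≫ X ◁ ((ρ_ X).hom ≫ (λ_ X).inv) ≫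
          extendMul X ((ρ_ X).hom ≫ (λ_ X).inv) = (λ_ (𝟙_ C)).hom ≫ cupAt cup (𝟙_ C) := by
        simp only [extendMul, cupAt]
        monoidal
      rw [reassoc_of% this, hg, comp_zero]
    exact e _ h
  | succ j ih =>
    have e : ∀ {B B' B'' : C} (s : X ⊗ B ⟶ B') (s' : X ⊗ B' ⟶ B'') (g : B'' ⟶ B'')
        (g' : B'' ⊗ X ⟶ B'' ⊗ X), cup ▷ B ≫ (α_ X X B).hom ≫ X ◁ s ≫ s' ≫ g = 0 → g ▷ X ≫ g' = g' →
        cup ▷ (B ⊗ X) ≫ (α_ X X (B ⊗ X)).hom ≫ X ◁ extendMul X s ≫ extendMul X s' ≫ g' = 0 := by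
      intro B B' B'' s s' g g' h1 h2
      have h3 := congrArg (· ▷ X) h1
      simp only [comp_whiskerRight, MonoidalPreadditive.zero_whiskerRight] at h3
      have h4 := cup_cons_cons (cup := cup) s s'
      rw [← h2, reassoc_of% h4]
      simp only [comp_whiskerRight, Category.assoc]
      rw [reassoc_of% h3]
      simp
    exact e _ _ _ _ (ih (by omega)) (H.absorb_succ (j + 2))

/-- A morphism into the image of `f_i` is determined by its product with the identity of
`X^(N - i)`. -/
theorem mul_injective (H : TLObject q N cup cap) (j : ℕ) : ∀ (i : ℕ) (h : i + j = N) {Y : C} (g : Y ⟶ tpow X i),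
    g ≫ jw q cup cap i = g → g ▷ tpow X j ≫ tpowMul X i j h ≫ jw q cup cap N = 0 → g = 0 := by
  induction j with
  | zero =>
    intro i h Y g hg h0
    obtain rfl : i = N := h
    rw [tpowMul_zero_right] at h0
    have e : ∀ {A : C} (g : Y ⟶ A) (f : A ⟶ A), g ≫ f = g → g ▷ 𝟙_ C ≫ (ρ_ A).hom ≫ f = 0 → g = 0 :=
      fun g f h1 h2 => by
        rw [rightUnitor_naturality_assoc, h1] at h2
        simpa using h2
    exact e _ _ hg h0
  | succ j ih =>
    intro i h Y g hg h0
    have hi : i + 1 + j = N := by omega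
    -- The partial trace factor of f_{i+1}. It is nonzero because i + 1 ≤ N.
    have hd : -(qInt q (i + 2) / qInt q (i + 1)) ≠ 0 :=
      neg_ne_zero.mpr (div_ne_zero (H.qInt_ne_zero (i + 1) (by omega))
        (H.qInt_ne_zero i (by omega)))
    refine eq_zero_of_whiskerRight_comp (H.ptr i (by omega)) hd hg ?_
    -- The induction hypothesis is applied to f_{i+1} ∘ (g ⊗ 1). Its product with X^j is that of g
    -- with X^{j+1}, since f_N absorbs f_{i+1}.
    refine ih (i + 1) hi _ ?_ ?_
    · exact (Category.assoc _ _ _).trans (congrArg (g ▷ X ≫ ·) (H.idem (i + 1)))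
    · refine (whiskerRight_comp_absorb (T := tpow X (i + 1)) _ _ _
        (H.absorb_right (i + 1) j hi)).trans
          ((whiskerRight_tpowMul_succ_left X hi h g _).trans ?_)
      rw [h0]
      simp

/-- In the presence of `f_(N+1) = 0`, every morphism from `Y ⊗ X^j` to the image of `f_N` that is
compatible with `f_j` is the product of a morphism into the image of `f_i` and the identity. -/
theorem mul_surjective (H : TLObject q N cup cap) (H0 : jw q cup cap (N + 1) = 0) (j : ℕ) :
    ∀ (i : ℕ) (h : i + j = N) {Y : C} (w : Y ⊗ tpow X j ⟶ tpow X N),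
    Y ◁ jw q cup cap j ≫ w = w → w ≫ jw q cup cap N = w →
    ∃ g : Y ⟶ tpow X i, g ≫ jw q cup cap i = g ∧
      g ▷ tpow X j ≫ tpowMul X i j h ≫ jw q cup cap N = w := by
  induction j with
  | zero =>
    intro i h Y w _ hw
    obtain rfl : i = N := h
    rw [tpowMul_zero_right]
    have e : ∀ {A : C} (w : Y ⊗ 𝟙_ C ⟶ A) (f : A ⟶ A), w ≫ f = w →
        ∃ g : Y ⟶ A, g ≫ f = g ∧ g ▷ 𝟙_ C ≫ (ρ_ A).hom ≫ f = w :=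
      fun w f h1 => ⟨(ρ_ Y).inv ≫ w, by simp [h1], by simp [h1]⟩
    exact e _ _ hw
  | succ j ih =>
    intro i h Y w hw hwN
    have hi : i + 1 + j = N := by omega
    -- With the first strand moved to Y, w is still compatible with f_j: it contains f_{j+1}, which
    -- absorbs f_j on its last strands.
    have hw' : (Y ⊗ X) ◁ jw q cup cap j ≫ (α_ Y X (tpow X j)).hom ≫ Y ◁ tpowCons X j ≫ w =
        (α_ Y X (tpow X j)).hom ≫ Y ◁ tpowCons X j ≫ w := by
      have := congrArg (Y ◁ ·) (H.absorb_cons j (by omega))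
      simp only [MonoidalCategory.whiskerLeft_comp] at this
      rw [← hw, associator_naturality_right_assoc, reassoc_of% this]
    obtain ⟨g, hg, hgw⟩ := ih (i + 1) hi _ hw' (by simp only [Category.assoc, hwN])
    let gT : Y ⊗ X ⟶ tpow X i ⊗ X := g
    -- The mate of g is killed by f_{i+2}. At the top, i + 2 = N + 1 and the projection itself is
    -- zero. Below the top, injectivity reduces the claim to the product with the remaining strands,
    -- which is w with a cup plugged into the first two strands of the projection it contains.
    have hk : cupAt cup Y ≫ gT ▷ X ≫
        (jw q cup cap (i + 2) : (tpow X i ⊗ X) ⊗ X ⟶ (tpow X i ⊗ X) ⊗ X) = 0 := by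
      obtain _ | j := j
      · obtain rfl : i + 1 = N := hi
        rw [H0]
        exact (congrArg (cupAt cup Y ≫ ·) comp_zero).trans comp_zero
      · have hi' : i + 2 + j = N := by omega
        refine (Category.assoc _ _ _).symm.trans
          (H.mul_injective j (i + 2) hi' ((cupAt cup Y ≫ g ▷ X) ≫ jw q cup cap (i + 2)) ?_ ?_)
        · exact (Category.assoc _ _ _).trans (congrArg (_ ≫ ·) (H.idem (i + 2)))
        · refine (whiskerRight_comp_absorb (T := tpow X (i + 2)) _ _ _
            (H.absorb_right (i + 2) j hi')).trans ?_
          refine (congrArg (· ≫ _) (comp_whiskerRight _ _ _)).trans ((Category.assoc _ _ _).trans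
            ((congrArg (_ ≫ ·) (whiskerRight_tpowMul_succ_left X hi' hi g _)).trans ?_))
          rw [hgw, ← hw]
          have e2 : ∀ {B B' B'' M : C} (s : X ⊗ B ⟶ B') (s' : X ⊗ B' ⟶ B'') (f : B'' ⟶ B'')
              (w : Y ⊗ B'' ⟶ M), cup ▷ B ≫ (α_ X X B).hom ≫ X ◁ s ≫ s' ≫ f = 0 →
              cupAt cup Y ▷ B ≫ (α_ (Y ⊗ X) X B).hom ≫ (Y ⊗ X) ◁ s ≫
                (α_ Y X B').hom ≫ Y ◁ s' ≫ Y ◁ f ≫ w = 0 := by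
            intro B B' B'' M s s' f w h0
            calc _ = (ρ_ Y).inv ▷ B ≫ (α_ Y (𝟙_ C) B).hom ≫
                  Y ◁ (cup ▷ B ≫ (α_ X X B).hom ≫ X ◁ s ≫ s' ≫ f) ≫ w := by
                    simp only [cupAt]; monoidal
              _ = 0 := by rw [h0]; simp
          exact e2 _ _ _ _ (H.cup_cons_jw j (by omega))
    have hgT := eq_smul_of_mate_comp_jwStep H.zz₂ (T := tpow X i) (g := gT) hg hk
    generalize cupAt cup Y ≫ gT ▷ X ≫ capAt cap (tpow X i) = v at hgT
    have habs := H.absorb_right i (j + 1) h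
    -- The scalar is minus the recursion coefficient of f_{i+2}. Composing v with f_i puts the
    -- witness in the image of f_i and does not change its product, as f_N absorbs f_i.
    refine ⟨(-(qInt q (i + 1) / qInt q (i + 2))) • (v ≫ jw q cup cap i), ?_, ?_⟩
    · rw [Linear.smul_comp, Category.assoc, H.idem]
    · have hinv : tpowUncons X j ≫ tpowCons X j = 𝟙 _ := tpowUncons_tpowCons X j
      have hepi : Y ◁ tpowUncons X j ≫ (α_ Y X (tpow X j)).inv ≫ (α_ Y X (tpow X j)).hom ≫
          Y ◁ tpowCons X j = 𝟙 _ := by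
        rw [Iso.inv_hom_id_assoc, ← MonoidalCategory.whiskerLeft_comp, hinv,
          MonoidalCategory.whiskerLeft_id]
      -- The required equality with the first strand of X^{j+1} moved next to Y; the right inverse
      -- above then cancels this rearrangement.
      have key : (α_ Y X (tpow X j)).hom ≫ Y ◁ tpowCons X j ≫
          ((-(qInt q (i + 1) / qInt q (i + 2))) • (v ≫ jw q cup cap i)) ▷ tpow X (j + 1) ≫
            tpowMul X i (j + 1) h ≫ jw q cup cap N =
          (α_ Y X (tpow X j)).hom ≫ Y ◁ tpowCons X j ≫ w := by
        rw [← hgw, MonoidalLinear.smul_whiskerRight, comp_whiskerRight]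
        simp only [Linear.smul_comp, Linear.comp_smul, Category.assoc]
        rw [habs]
        have e3 : gT ▷ tpow X j ≫ (tpowMul X (i + 1) j hi : (tpow X i ⊗ X) ⊗ tpow X j ⟶ _) ≫
            jw q cup cap N = (-(qInt q (i + 1) / qInt q (i + 2))) • (v ▷ X ▷ tpow X j ≫
              (tpowMul X (i + 1) j hi : (tpow X i ⊗ X) ⊗ tpow X j ⟶ _) ≫ jw q cup cap N) := by
          rw [hgT, MonoidalLinear.smul_whiskerRight, Linear.smul_comp]
          congr 1
          exact whiskerRight_comp_absorb (T := tpow X (i + 1)) _ _ _ (H.absorb_right (i + 1) j hi)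
        refine Eq.trans ?_ e3.symm
        rw [whiskerRight_tpowMul_succ_left X hi h]
      have := congrArg (fun t => Y ◁ tpowUncons X j ≫ (α_ Y X (tpow X j)).inv ≫ t) key
      simp only [reassoc_of% hepi] at this
      exact this

end TLObject
end JonesWenzlCalculus

/-! ### Finite direct sums of a sequence of objects. -/

section TruncatedSum
variable {C : Type*} [Category C] [Preadditive C] [HasFiniteBiproducts C]

/-- The direct sum `F 0 ⊕ ⋯ ⊕ F N`. -/
def truncSum (F : ℕ → C) (N : ℕ) : C := ⨁ fun i : Fin (N + 1) => F i

/-- The inclusion of a summand. -/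
def truncIncl (F : ℕ → C) {N i : ℕ} (h : i < N + 1) : F i ⟶ truncSum F N :=
  biproduct.ι (fun i : Fin (N + 1) => F i) ⟨i, h⟩

/-- The projection to a summand. -/
def truncProj (F : ℕ → C) {N i : ℕ} (h : i < N + 1) : truncSum F N ⟶ F i :=
  biproduct.π (fun i : Fin (N + 1) => F i) ⟨i, h⟩

variable {F : ℕ → C} {N : ℕ}

theorem truncIncl_truncProj {i : ℕ} (h : i < N + 1) : truncIncl F h ≫ truncProj F h = 𝟙 (F i) :=
  biproduct.ι_π_self _ _

theorem truncIncl_truncProj_ne {i j : ℕ} (hi : i < N + 1) (hj : j < N + 1) (h : i ≠ j) :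
    truncIncl F hi ≫ truncProj F hj = 0 :=
  biproduct.ι_π_ne _ fun e => h (congrArg Fin.val e)

theorem truncSum_hom_ext {Y : C} {f g : Y ⟶ truncSum F N}
    (h : ∀ (i : ℕ) (hi : i < N + 1), f ≫ truncProj F hi = g ≫ truncProj F hi) : f = g :=
  biproduct.hom_ext _ _ fun i => h i i.isLt

theorem exists_truncSum_lift {Y : C} (g : ∀ i, i < N + 1 → (Y ⟶ F i)) :
    ∃ f : Y ⟶ truncSum F N, ∀ (i : ℕ) (hi : i < N + 1), f ≫ truncProj F hi = g i hi :=
  ⟨biproduct.lift fun i : Fin (N + 1) => g i i.isLt, fun _ _ => biproduct.lift_π _ _⟩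

end TruncatedSum

/-! ### Truncated graded algebras and the Frobenius property. -/

section TruncatedAlgebra
variable {C : Type*} [Category C] [MonoidalCategory C] [Preadditive C]

/-- A graded multiplication `F i ⊗ F j ⟶ F (i + j)`, with values in `F n` for `n = i + j`. -/
def gradedMul {F : ℕ → C} (m : ∀ i j, F i ⊗ F j ⟶ F (i + j)) (i j : ℕ) {n : ℕ} (h : i + j = n) :
    F i ⊗ F j ⟶ F n :=
  m i j ≫ eqToHom (congrArg F h)

/-- A graded multiplication on `F 0, …, F N` that is associative and unital, and for which the
products `F i ⊗ F (N - i) ⟶ F N` are perfect on the left. -/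
structure IsFrobeniusGraded {F : ℕ → C} (N : ℕ) (u : 𝟙_ C ⟶ F 0)
    (m : ∀ i j, F i ⊗ F j ⟶ F (i + j)) : Prop where
  one_mul : ∀ j, u ▷ F j ≫ gradedMul m 0 j (zero_add j) = (λ_ (F j)).hom
  mul_one : ∀ i, F i ◁ u ≫ gradedMul m i 0 (add_zero i) = (ρ_ (F i)).hom
  mul_assoc : ∀ (i j l : ℕ) {a b n : ℕ} (ha : i + j = a) (hb : j + l = b) (h : a + l = n)
    (h' : i + b = n), n ≤ N → gradedMul m i j ha ▷ F l ≫ gradedMul m a l h =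
      (α_ _ _ _).hom ≫ F i ◁ gradedMul m j l hb ≫ gradedMul m i b h'
  injective : ∀ (i j : ℕ) (h : i + j = N) {Y : C} (g : Y ⟶ F i),
    g ▷ F j ≫ gradedMul m i j h = 0 → g = 0
  surjective : ∀ (i j : ℕ) (h : i + j = N) {Y : C} (w : Y ⊗ F j ⟶ F N),
    ∃ g : Y ⟶ F i, g ▷ F j ≫ gradedMul m i j h = w

variable [HasFiniteBiproducts C]

/-- The multiplication on `F 0 ⊕ ⋯ ⊕ F N` obtained by truncating a graded multiplication. -/
def truncMul {F : ℕ → C} (N : ℕ) (m : ∀ i j, F i ⊗ F j ⟶ F (i + j)) :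
    truncSum F N ⊗ truncSum F N ⟶ truncSum F N :=
  ∑ i : Fin (N + 1), ∑ j : Fin (N + 1), (truncProj F i.isLt ⊗ₘ truncProj F j.isLt) ≫
    if h : (i : ℕ) + j < N + 1 then m i j ≫ truncIncl F h else 0

section
variable {F : ℕ → C} {N : ℕ}

variable [MonoidalPreadditive C]

theorem truncSum_tensor_ext {Y Z : C} {f g : truncSum F N ⊗ Y ⟶ Z}
    (h : ∀ (i : ℕ) (hi : i < N + 1), truncIncl F hi ▷ Y ≫ f = truncIncl F hi ▷ Y ≫ g) : f = g :=
  rightDistributor_ext_left fun i => h i i.isLt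

theorem tensor_truncSum_ext {Y Z : C} {f g : Y ⊗ truncSum F N ⟶ Z}
    (h : ∀ (i : ℕ) (hi : i < N + 1), Y ◁ truncIncl F hi ≫ f = Y ◁ truncIncl F hi ≫ g) : f = g :=
  leftDistributor_ext_left fun i => h i i.isLt

/-- The outer factors are split by the distributors, after reassociation; the middle one is split by
whiskering the decomposition of the identity of the sum on both sides. -/
theorem truncSum_tensor_ext₃ {Z : C} {f g : (truncSum F N ⊗ truncSum F N) ⊗ truncSum F N ⟶ Z}
    (h : ∀ (i j l : ℕ) (hi : i < N + 1) (hj : j < N + 1) (hl : l < N + 1),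
      ((truncIncl F hi ⊗ₘ truncIncl F hj) ⊗ₘ truncIncl F hl) ≫ f =
        ((truncIncl F hi ⊗ₘ truncIncl F hj) ⊗ₘ truncIncl F hl) ≫ g) : f = g := by
  refine tensor_truncSum_ext fun l hl => ?_
  rw [← cancel_epi (α_ _ _ _).inv]
  refine truncSum_tensor_ext fun i hi => ?_
  have e : ∀ {f' g' : (F i ⊗ truncSum F N) ⊗ F l ⟶ Z}, (∀ (j : ℕ) (hj : j < N + 1),
      (F i ◁ truncIncl F hj) ▷ F l ≫ f' = (F i ◁ truncIncl F hj) ▷ F l ≫ g') → f' = g' := by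
    intro f' g' h'
    have h1 : ∑ j : Fin (N + 1), truncProj F j.isLt ≫ truncIncl F j.isLt = 𝟙 (truncSum F N) :=
      biproduct.total
    have h2 : ∑ j : Fin (N + 1), (F i ◁ truncProj F j.isLt) ▷ F l ≫
        (F i ◁ truncIncl F j.isLt) ▷ F l = 𝟙 ((F i ⊗ truncSum F N) ⊗ F l) := by
      simp only [← comp_whiskerRight, ← MonoidalCategory.whiskerLeft_comp, ← sum_whiskerRight,
        ← whiskerLeft_sum, h1, MonoidalCategory.whiskerLeft_id, id_whiskerRight]
    rw [← Category.id_comp f', ← Category.id_comp g', ← h2]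
    simp only [Preadditive.sum_comp, Category.assoc, h' _ (Fin.isLt _)]
  rw [← cancel_epi (α_ _ _ _).hom]
  refine e fun j hj => ?_
  have e' : ∀ w : (truncSum F N ⊗ truncSum F N) ⊗ truncSum F N ⟶ Z,
      (F i ◁ truncIncl F hj) ▷ F l ≫ (α_ _ _ _).hom ≫ truncIncl F hi ▷ (truncSum F N ⊗ F l) ≫
        (α_ _ _ _).inv ≫ (truncSum F N ⊗ truncSum F N) ◁ truncIncl F hl ≫ w =
      ((truncIncl F hi ⊗ₘ truncIncl F hj) ⊗ₘ truncIncl F hl) ≫ w := by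
    intro w
    rw [MonoidalCategory.tensorHom_def (truncIncl F hi ⊗ₘ truncIncl F hj),
      MonoidalCategory.tensorHom_def' (truncIncl F hi)]
    monoidal
  rw [e', e', h i j l hi hj hl]
end

section
variable [MonoidalPreadditive C] {F : ℕ → C} {N : ℕ} (m : ∀ i j, F i ⊗ F j ⟶ F (i + j))

theorem truncIncl_truncMul {i j : ℕ} (hi : i < N + 1) (hj : j < N + 1) :
    (truncIncl F hi ⊗ₘ truncIncl F hj) ≫ truncMul N m =
      if h : i + j < N + 1 then m i j ≫ truncIncl F h else 0 := by
  simp only [truncMul, Preadditive.comp_sum, tensorHom_comp_tensorHom_assoc]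
  rw [Finset.sum_eq_single ⟨i, hi⟩, Finset.sum_eq_single ⟨j, hj⟩]
  · simp [truncIncl_truncProj]
  · intro b _ hb
    rw [truncIncl_truncProj_ne hj _ fun e => hb (Fin.ext e.symm), MonoidalPreadditive.tensor_zero,
      zero_comp]
  · simp
  · intro b _ hb
    simp [truncIncl_truncProj_ne hi _ fun e => hb (Fin.ext e.symm), MonoidalPreadditive.zero_tensor]
  · simp

theorem truncIncl_truncMul_of_eq {i j n : ℕ} (hi : i < N + 1) (hj : j < N + 1) (hn : n < N + 1)
    (h : i + j = n) : (truncIncl F hi ⊗ₘ truncIncl F hj) ≫ truncMul N m =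
      gradedMul m i j h ≫ truncIncl F hn := by
  subst h
  rw [truncIncl_truncMul, dif_pos hn]
  simp [gradedMul]

theorem truncIncl_truncMul_of_lt {i j : ℕ} (hi : i < N + 1) (hj : j < N + 1) (h : N < i + j) :
    (truncIncl F hi ⊗ₘ truncIncl F hj) ≫ truncMul N m = 0 := by
  rw [truncIncl_truncMul, dif_neg (by omega)]

/-- Against the summand of degree j, the form n ∘ m sees only degree N - j: every other product
lands in a degree other than N or is truncated to zero. -/
theorem truncIncl_truncMul_truncProj (i j : ℕ) (hi : i < N + 1) (hj : j < N + 1) (h : i + j = N) :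
    truncSum F N ◁ truncIncl F hj ≫ truncMul N m ≫ truncProj F (Nat.lt_succ_self N) =
      truncProj F hi ▷ F j ≫ gradedMul m i j h := by
  refine truncSum_tensor_ext fun a ha => ?_
  have e : truncIncl F ha ▷ F j ≫ truncSum F N ◁ truncIncl F hj =
      truncIncl F ha ⊗ₘ truncIncl F hj := (MonoidalCategory.tensorHom_def _ _).symm
  rw [reassoc_of% e, ← Category.assoc, ← comp_whiskerRight_assoc]
  by_cases hai : a = i
  · subst hai
    rw [truncIncl_truncProj, truncIncl_truncMul_of_eq m ha hj (Nat.lt_succ_self N) h,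
      Category.assoc, truncIncl_truncProj]
    simp
  · rw [truncIncl_truncProj_ne ha hi hai, MonoidalPreadditive.zero_whiskerRight, zero_comp]
    by_cases h1 : N < a + j
    · rw [truncIncl_truncMul_of_lt m ha hj h1, zero_comp]
    · rw [truncIncl_truncMul_of_eq m ha hj (n := a + j) (by omega) rfl, Category.assoc,
        truncIncl_truncProj_ne _ _ (by omega), comp_zero]

variable {m} {u : 𝟙_ C ⟶ F 0}

namespace IsFrobeniusGraded

theorem trunc_one_mul (H : IsFrobeniusGraded N u m) :
    (u ≫ truncIncl F (Nat.succ_pos N)) ▷ truncSum F N ≫ truncMul N m = (λ_ _).hom := by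
  refine tensor_truncSum_ext fun j hj => ?_
  rw [whisker_exchange_assoc, comp_whiskerRight_assoc, leftUnitor_naturality,
    ← H.one_mul j, Category.assoc,
    ← truncIncl_truncMul_of_eq m (Nat.succ_pos N) hj hj (zero_add _),
    MonoidalCategory.tensorHom_def, Category.assoc]

theorem trunc_mul_one (H : IsFrobeniusGraded N u m) :
    truncSum F N ◁ (u ≫ truncIncl F (Nat.succ_pos N)) ≫ truncMul N m = (ρ_ _).hom := by
  refine truncSum_tensor_ext fun i hi => ?_
  rw [← whisker_exchange_assoc, MonoidalCategory.whiskerLeft_comp_assoc, rightUnitor_naturality,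
    ← H.mul_one i, Category.assoc,
    ← truncIncl_truncMul_of_eq m hi (Nat.succ_pos N) hi (add_zero _),
    MonoidalCategory.tensorHom_def', Category.assoc]

theorem trunc_mul_assoc (H : IsFrobeniusGraded N u m) :
    truncMul N m ▷ _ ≫ truncMul N m = (α_ _ _ _).hom ≫ _ ◁ truncMul N m ≫ truncMul N m := by
  refine truncSum_tensor_ext₃ fun i j l hi hj hl => ?_
  rw [associator_naturality_assoc, ← MonoidalCategory.tensorHom_id, ← MonoidalCategory.id_tensorHom,
    tensorHom_comp_tensorHom_assoc, tensorHom_comp_tensorHom_assoc, Category.comp_id,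
    Category.comp_id]
  -- In total degree at most N this is graded associativity. Beyond N both bracketings vanish,
  -- through truncation of either the inner or the outer product.
  by_cases h : i + j + l < N + 1
  · rw [truncIncl_truncMul_of_eq m hi hj (n := i + j) (by omega) rfl,
      truncIncl_truncMul_of_eq m hj hl (n := j + l) (by omega) rfl]
    have e1 : (gradedMul m i j rfl ≫ truncIncl F (N := N) (i := i + j) (by omega)) ⊗ₘ truncIncl F hl =
        gradedMul m i j rfl ▷ F l ≫ (truncIncl F (by omega) ⊗ₘ truncIncl F hl) := by
      rw [← MonoidalCategory.tensorHom_id, tensorHom_comp_tensorHom, Category.id_comp]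
    have e2 : truncIncl F hi ⊗ₘ (gradedMul m j l rfl ≫ truncIncl F (N := N) (i := j + l) (by omega)) =
        F i ◁ gradedMul m j l rfl ≫ (truncIncl F hi ⊗ₘ truncIncl F (by omega)) := by
      rw [← MonoidalCategory.id_tensorHom, tensorHom_comp_tensorHom, Category.id_comp]
    rw [e1, e2, Category.assoc, Category.assoc,
      truncIncl_truncMul_of_eq m _ hl h rfl,
      truncIncl_truncMul_of_eq m hi _ h (by omega),
      reassoc_of% (H.mul_assoc i j l rfl rfl rfl (by omega) (by omega))]
  · have e1 : ((truncIncl F hi ⊗ₘ truncIncl F hj) ≫ truncMul N m ⊗ₘ truncIncl F hl) ≫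
        truncMul N m = 0 := by
      by_cases h1 : i + j < N + 1
      · rw [truncIncl_truncMul_of_eq m hi hj h1 rfl]
        have e1 : (gradedMul m i j rfl ≫ truncIncl F h1) ⊗ₘ truncIncl F hl =
          gradedMul m i j rfl ▷ F l ≫ (truncIncl F h1 ⊗ₘ truncIncl F hl) := by
          rw [← MonoidalCategory.tensorHom_id, tensorHom_comp_tensorHom, Category.id_comp]
        rw [e1, Category.assoc, truncIncl_truncMul_of_lt m _ _ (by omega), comp_zero]
      · rw [truncIncl_truncMul_of_lt m _ _ (by omega), MonoidalPreadditive.zero_tensor, zero_comp]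
    have e2 : (truncIncl F hi ⊗ₘ (truncIncl F hj ⊗ₘ truncIncl F hl) ≫ truncMul N m) ≫
        truncMul N m = 0 := by
      by_cases h1 : j + l < N + 1
      · rw [truncIncl_truncMul_of_eq m hj hl h1 rfl]
        have e1 : truncIncl F hi ⊗ₘ (gradedMul m j l rfl ≫ truncIncl F h1) =
          F i ◁ gradedMul m j l rfl ≫ (truncIncl F hi ⊗ₘ truncIncl F h1) := by
          rw [← MonoidalCategory.id_tensorHom, tensorHom_comp_tensorHom, Category.id_comp]
        rw [e1, Category.assoc, truncIncl_truncMul_of_lt m _ _ (by omega), comp_zero]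
      · rw [truncIncl_truncMul_of_lt m _ _ (by omega), MonoidalPreadditive.tensor_zero, zero_comp]
    rw [e1, e2, comp_zero]

/-- The map is block antidiagonal: its restriction to Y ⊗ F j depends only on the component of g in
degree N - j, through the perfect product of complementary degrees. Bijectivity can therefore be
checked one degree at a time. -/
theorem trunc_bijective (H : IsFrobeniusGraded N u m) (Y : C) :
    Function.Bijective fun g : Y ⟶ truncSum F N =>
      g ▷ truncSum F N ≫ truncMul N m ≫ truncProj F (Nat.lt_succ_self N) := by
  have key : ∀ (g : Y ⟶ truncSum F N) (i j : ℕ) (hi : i < N + 1) (hj : j < N + 1) (h : i + j = N),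
      Y ◁ truncIncl F hj ≫ g ▷ truncSum F N ≫ truncMul N m ≫ truncProj F (Nat.lt_succ_self N) =
        (g ≫ truncProj F hi) ▷ F j ≫ gradedMul m i j h := by
    intro g i j hi hj h
    rw [whisker_exchange_assoc, truncIncl_truncMul_truncProj m i j hi hj h,
      comp_whiskerRight_assoc]
  constructor
  · intro g g' hgg
    rw [← sub_eq_zero]
    refine truncSum_hom_ext fun i hi => ?_
    rw [zero_comp]
    refine H.injective i (N - i) (by omega) _ ?_
    rw [← key (g - g') i (N - i) hi (by omega) (by omega)]
    have : (g - g') ▷ truncSum F N = g ▷ truncSum F N - g' ▷ truncSum F N :=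
      (tensorRight (truncSum F N)).map_sub
    rw [this, Preadditive.sub_comp, sub_eq_zero.mpr hgg, comp_zero]
  · intro w
    have hex : ∀ (i : ℕ) (hi : i < N + 1), ∃ g : Y ⟶ F i, ∀ (j : ℕ) (hj : j < N + 1)
        (h : i + j = N), g ▷ F j ≫ gradedMul m i j h = Y ◁ truncIncl F hj ≫ w := by
      intro i hi
      obtain ⟨g, hg⟩ := H.surjective i (N - i) (by omega)
        (Y ◁ truncIncl F (N := N) (i := N - i) (by omega) ≫ w)
      refine ⟨g, fun j hj h => ?_⟩
      obtain rfl : j = N - i := by omega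
      exact hg
    choose g hg using hex
    obtain ⟨f, hf⟩ := exists_truncSum_lift g
    refine ⟨f, tensor_truncSum_ext fun j hj => ?_⟩
    rw [key f (N - j) j (by omega) hj (by omega), hf]
    exact hg _ _ _ _ _

/-- The truncated algebra of a Frobenius graded multiplication. -/
abbrev monObj (H : IsFrobeniusGraded N u m) : MonObj (truncSum F N) where
  one := u ≫ truncIncl F (Nat.succ_pos N)
  mul := truncMul N m
  one_mul := H.trunc_one_mul
  mul_one := H.trunc_mul_one
  mul_assoc := H.trunc_mul_assoc

/-- By Yoneda: under the adjunction Hom(Y ⊗ A, W) ≅ Hom(Y, W ⊗ A^∨), composition with the Frobenius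
map is the bijection of `trunc_bijective`. -/
theorem isFrobeniusStructure (H : IsFrobeniusGraded N u m) [HasRightDual (truncSum F N)] :
    letI := H.monObj
    IsFrobeniusStructure (truncSum F N) (F N) (truncProj F (Nat.lt_succ_self N)) := by
  let := H.monObj
  refine isIso_of_yoneda_map_bijective _ fun Y => ?_
  have e : (fun g : Y ⟶ truncSum F N => g ≫ frobeniusMap (truncSum F N)
      (truncProj F (Nat.lt_succ_self N))) =
      tensorRightHomEquiv Y (truncSum F N) (truncSum F N)ᘁ (F N) ∘
        fun g => g ▷ truncSum F N ≫ truncMul N m ≫ truncProj F (Nat.lt_succ_self N) := by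
    funext g
    change g ≫ (ρ_ _).inv ≫ _ ◁ _ ≫ (α_ _ _ _).inv ≫ (truncMul N m ≫ _) ▷ _ =
      (ρ_ _).inv ≫ _ ◁ _ ≫ (α_ _ _ _).inv ≫ (g ▷ _ ≫ _) ▷ _
    -- Here g is moved past the coevaluation, so that it enters the multiplication directly.
    have h1 : g ≫ (ρ_ _).inv = (ρ_ _).inv ≫ g ▷ 𝟙_ C := by simp
    rw [reassoc_of% h1, ← whisker_exchange_assoc]
    simp
  rw [e]
  exact (Equiv.bijective _).comp (H.trunc_bijective Y)

end IsFrobeniusGraded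
end
end TruncatedAlgebra

/-! ### From tensor powers to the images of the projections. -/

section Retracts
variable {C : Type*} [Category C] [MonoidalCategory C] [Preadditive C] [Linear ℂ C]

/-- Images `F i` of the Jones–Wenzl projections, and their multiplication. -/
structure JWImages (q : ℂ) {X : C} (cup : 𝟙_ C ⟶ X ⊗ X) (cap : X ⊗ X ⟶ 𝟙_ C) (F : ℕ → C)
    (u : 𝟙_ C ⟶ F 0) (m : ∀ i j, F i ⊗ F j ⟶ F (i + j)) where
  ι : ∀ i, F i ⟶ tpow X i
  p : ∀ i, tpow X i ⟶ F i
  ι_p : ∀ i, ι i ≫ p i = 𝟙 _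
  p_ι : ∀ i, p i ≫ ι i = jw q cup cap i
  unit : u ≫ ι 0 = 𝟙 (𝟙_ C)
  mul : ∀ i j, m i j = (ι i ⊗ₘ ι j) ≫ (tpowAdd X i j).hom ≫ p (i + j)

namespace JWImages
variable {q : ℂ} {X : C} {cup : 𝟙_ C ⟶ X ⊗ X} {cap : X ⊗ X ⟶ 𝟙_ C} {F : ℕ → C}
  {u : 𝟙_ C ⟶ F 0} {m : ∀ i j, F i ⊗ F j ⟶ F (i + j)}

theorem gradedMul_eq (R : JWImages q cup cap F u m) (i j : ℕ) {n : ℕ} (h : i + j = n) :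
    gradedMul m i j h = (R.ι i ⊗ₘ R.ι j) ≫ tpowMul X i j h ≫ R.p n := by
  subst h
  simp [gradedMul, tpowMul, R.mul]

theorem ι_jw (R : JWImages q cup cap F u m) (i : ℕ) : R.ι i ≫ jw q cup cap i = R.ι i := by
  rw [← R.p_ι, ← Category.assoc, R.ι_p, Category.id_comp]

theorem jw_p (R : JWImages q cup cap F u m) (i : ℕ) : jw q cup cap i ≫ R.p i = R.p i := by
  rw [← R.p_ι, Category.assoc, R.ι_p, Category.comp_id]

variable [MonoidalPreadditive C] [MonoidalLinear ℂ C] {N : ℕ}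

/-- Every identity is conjugated by the splittings into one between tensor powers. The inner
projections thus created are absorbed by the outer one; this gives associativity, and it lets
`mul_injective` and `mul_surjective` speak about F j in place of X^j. -/
theorem isFrobeniusGraded (R : JWImages q cup cap F u m) (H : TLObject q N cup cap)
    (H0 : jw q cup cap (N + 1) = 0) : IsFrobeniusGraded N u m where
  one_mul j := by
    rw [R.gradedMul_eq, tpowMul_zero_left]
    have e : ∀ (z : F 0 ⟶ 𝟙_ C), u ≫ z = 𝟙 _ →
        u ▷ F j ≫ (z ⊗ₘ R.ι j) ≫ (λ_ (tpow X j)).hom ≫ R.p j = (λ_ (F j)).hom := by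
      intro z hz
      rw [MonoidalCategory.tensorHom_def, Category.assoc, ← comp_whiskerRight_assoc, hz]
      simp [R.ι_p]
    exact e _ R.unit
  mul_one i := by
    rw [R.gradedMul_eq, tpowMul_zero_right]
    have e : ∀ (z : F 0 ⟶ 𝟙_ C), u ≫ z = 𝟙 _ →
        F i ◁ u ≫ (R.ι i ⊗ₘ z) ≫ (ρ_ (tpow X i)).hom ≫ R.p i = (ρ_ (F i)).hom := by
      intro z hz
      rw [MonoidalCategory.tensorHom_def', Category.assoc,
        ← MonoidalCategory.whiskerLeft_comp_assoc, hz]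
      simp [R.ι_p]
    exact e _ R.unit
  mul_assoc i j l a b n ha hb h h' hn := by
    have e1 : gradedMul m i j ha ▷ F l ≫ gradedMul m a l h =
        ((R.ι i ⊗ₘ R.ι j) ⊗ₘ R.ι l) ≫ tpowMul X i j ha ▷ tpow X l ≫
          jw q cup cap a ▷ tpow X l ≫ tpowMul X a l h ≫ jw q cup cap n ≫ R.p n := by
      simp only [R.gradedMul_eq, ← MonoidalCategory.tensorHom_id, tensorHom_comp_tensorHom_assoc,
        Category.id_comp, Category.comp_id, Category.assoc, R.p_ι, R.jw_p]
    have e2 : F i ◁ gradedMul m j l hb ≫ gradedMul m i b h' =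
        (R.ι i ⊗ₘ (R.ι j ⊗ₘ R.ι l)) ≫ tpow X i ◁ tpowMul X j l hb ≫
          tpow X i ◁ jw q cup cap b ≫ tpowMul X i b h' ≫ jw q cup cap n ≫ R.p n := by
      simp only [R.gradedMul_eq, ← MonoidalCategory.id_tensorHom, tensorHom_comp_tensorHom_assoc,
        Category.id_comp, Category.comp_id, Category.assoc, R.p_ι, R.jw_p]
    rw [e1, e2, reassoc_of% (H.absorb_right a l h), reassoc_of% (H.absorb_left i b h' (by omega)),
      reassoc_of% (tpowMul_assoc X i j l ha hb h h'), associator_naturality_assoc]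
  injective i j h Y g hg := by
    rw [R.gradedMul_eq] at hg
    have h1 : (g ≫ R.ι i) ▷ tpow X j ≫ tpowMul X i j h ≫ jw q cup cap N = 0 := by
      have h2 := congrArg (fun t => Y ◁ R.p j ≫ t ≫ R.ι N) hg
      simp only [zero_comp, comp_zero, Category.assoc, R.p_ι] at h2
      rw [← h2, ← H.absorb_left i j h (by omega)]
      simp only [← MonoidalCategory.tensorHom_id, ← MonoidalCategory.id_tensorHom,
        tensorHom_comp_tensorHom_assoc, Category.id_comp, Category.comp_id, R.ι_jw, R.p_ι]
    have h3 := H.mul_injective j i h (g ≫ R.ι i) (by rw [Category.assoc, R.ι_jw]) h1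
    rw [← Category.comp_id g, ← R.ι_p, ← Category.assoc, h3, zero_comp]
  surjective i j h Y w := by
    obtain ⟨g, hg, hw⟩ := H.mul_surjective H0 j i h (Y ◁ R.p j ≫ w ≫ R.ι N)
      (by rw [← MonoidalCategory.whiskerLeft_comp_assoc, R.jw_p])
      (by simp only [Category.assoc, R.ι_jw])
    refine ⟨g ≫ R.p i, ?_⟩
    have h1 := congrArg (fun t => Y ◁ R.ι j ≫ t ≫ R.p N) hw
    simp only [Category.assoc, R.ι_p, R.jw_p, Category.comp_id] at h1
    rw [← MonoidalCategory.whiskerLeft_comp_assoc, R.ι_p, MonoidalCategory.whiskerLeft_id,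
      Category.id_comp] at h1
    rw [← h1, R.gradedMul_eq]
    simp only [← MonoidalCategory.tensorHom_id, ← MonoidalCategory.id_tensorHom,
      tensorHom_comp_tensorHom_assoc, Category.id_comp, Category.comp_id, Category.assoc, R.p_ι, hg]

end JWImages
end Retracts

/-! ### Duals of images under monoidal functors, of retracts and of direct sums. -/

section Duals
open Functor.LaxMonoidal Functor.OplaxMonoidal

/-- The functor is applied to the triangle identity, and the result is conjugated by the structure
isomorphisms, which then cancel in pairs. This serves both for exact pairings and for transporting
the zigzags of a cup and a cap. -/
theorem map_coevaluation_evaluation {C D : Type*} [Category C] [MonoidalCategory C] [Category D]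
    [MonoidalCategory D] (G : C ⥤ D) [G.Monoidal] {A B : C} {c : 𝟙_ C ⟶ A ⊗ B} {e : B ⊗ A ⟶ 𝟙_ C}
    (h : B ◁ c ≫ (α_ B A B).inv ≫ e ▷ B = (ρ_ B).hom ≫ (λ_ B).inv) :
    G.obj B ◁ (ε G ≫ G.map c ≫ δ G A B) ≫ (α_ _ _ _).inv ≫ (μ G B A ≫ G.map e ≫ η G) ▷ G.obj B =
      (ρ_ _).hom ≫ (λ_ _).inv := by
  have h' := congrArg G.map h
  simp only [Functor.map_comp, Functor.Monoidal.map_whiskerLeft, Functor.Monoidal.map_whiskerRight,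
    Functor.Monoidal.map_associator_inv, Functor.Monoidal.map_rightUnitor,
    Functor.Monoidal.map_leftUnitor_inv, Category.assoc] at h'
  have h2 := congrArg (fun t => G.obj B ◁ ε G ≫ μ G B (𝟙_ C) ≫ t ≫ δ G (𝟙_ C) B ≫ η G ▷ G.obj B) h'
  simp only [Category.assoc, Functor.Monoidal.μ_δ_assoc, Functor.Monoidal.whiskerRight_ε_η,
    Functor.Monoidal.whiskerLeft_ε_η, Functor.Monoidal.whiskerRight_ε_η_assoc,
    Functor.Monoidal.whiskerLeft_ε_η_assoc, Category.comp_id] at h2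
  simpa only [MonoidalCategory.whiskerLeft_comp, comp_whiskerRight, Category.assoc] using h2

theorem map_evaluation_coevaluation {C D : Type*} [Category C] [MonoidalCategory C] [Category D]
    [MonoidalCategory D] (G : C ⥤ D) [G.Monoidal] {A B : C} {c : 𝟙_ C ⟶ A ⊗ B} {e : B ⊗ A ⟶ 𝟙_ C}
    (h : c ▷ A ≫ (α_ A B A).hom ≫ A ◁ e = (λ_ A).hom ≫ (ρ_ A).inv) :
    (ε G ≫ G.map c ≫ δ G A B) ▷ G.obj A ≫ (α_ _ _ _).hom ≫ G.obj A ◁ (μ G B A ≫ G.map e ≫ η G) =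
      (λ_ _).hom ≫ (ρ_ _).inv := by
  have h' := congrArg G.map h
  simp only [Functor.map_comp, Functor.Monoidal.map_whiskerLeft, Functor.Monoidal.map_whiskerRight,
    Functor.Monoidal.map_associator, Functor.Monoidal.map_leftUnitor,
    Functor.Monoidal.map_rightUnitor_inv, Category.assoc] at h'
  have h2 := congrArg (fun t => ε G ▷ G.obj A ≫ μ G (𝟙_ C) A ≫ t ≫ δ G A (𝟙_ C) ≫ G.obj A ◁ η G) h'
  simp only [Category.assoc, Functor.Monoidal.μ_δ_assoc, Functor.Monoidal.whiskerRight_ε_η,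
    Functor.Monoidal.whiskerLeft_ε_η, Functor.Monoidal.whiskerRight_ε_η_assoc,
    Functor.Monoidal.whiskerLeft_ε_η_assoc, Category.comp_id] at h2
  simpa only [MonoidalCategory.whiskerLeft_comp, comp_whiskerRight, Category.assoc] using h2

/-- Monoidal functors preserve exact pairings. -/
abbrev mapExactPairing {C D : Type*} [Category C] [MonoidalCategory C] [Category D]
    [MonoidalCategory D] (G : C ⥤ D) [G.Monoidal] (A B : C) [ExactPairing A B] :
    ExactPairing (G.obj A) (G.obj B) where
  coevaluation' := ε G ≫ G.map (η_ A B) ≫ δ G A B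
  evaluation' := μ G B A ≫ G.map (ε_ A B) ≫ η G
  coevaluation_evaluation' := map_coevaluation_evaluation G (ExactPairing.coevaluation_evaluation A B)
  evaluation_coevaluation' := map_evaluation_coevaluation G (ExactPairing.evaluation_coevaluation A B)

variable {C : Type*} [Category C] [MonoidalCategory C]

/-- In a triangle whose coevaluation and evaluation are modified by morphisms on their legs, x and y
meet on the bent strand while s and t sit at its free ends. For a retract x ≫ y is the idempotent;
for a direct sum it is an identity or zero. -/
theorem whiskerLeft_coev_comp {A A' B D P E E' : C} (c : 𝟙_ C ⟶ A ⊗ B) (x : A ⟶ P) (t : B ⟶ E')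
    (s : E ⟶ D) (y : P ⟶ A') (e : D ⊗ A' ⟶ 𝟙_ C) :
    E ◁ (c ≫ (x ⊗ₘ t)) ≫ (α_ _ _ _).inv ≫ ((s ⊗ₘ y) ≫ e) ▷ E' =
      s ▷ 𝟙_ C ≫ (D ◁ (c ≫ (x ≫ y) ▷ B) ≫ (α_ _ _ _).inv ≫ e ▷ B) ≫ 𝟙_ C ◁ t := by
  have h := associator_inv_naturality s y (𝟙 E')
  have h' := associator_inv_naturality (𝟙 D) (𝟙 A') t
  have h'' : e ▷ B ≫ 𝟙_ C ◁ t = (D ⊗ A') ◁ t ≫ e ▷ E' := (whisker_exchange _ _).symm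
  simp only [Category.assoc]
  rw [h'']
  simp only [← MonoidalCategory.tensorHom_id, ← MonoidalCategory.id_tensorHom] at h h' ⊢
  have k : ((s ⊗ₘ y) ≫ e) ⊗ₘ 𝟙 E' = ((s ⊗ₘ y) ⊗ₘ 𝟙 E') ≫ (e ⊗ₘ 𝟙 E') := by
    rw [tensorHom_comp_tensorHom, Category.comp_id]
  rw [k, ← reassoc_of% h, ← id_tensorHom_id, ← reassoc_of% h']
  simp only [tensorHom_comp_tensorHom_assoc, tensorHom_comp_tensorHom, Category.comp_id,
    Category.id_comp, Category.assoc]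

theorem coev_whiskerRight_comp {A A' B D P E Q : C} (c : 𝟙_ C ⟶ A ⊗ B) (x : A ⟶ P) (t : B ⟶ E)
    (s : E ⟶ D) (y : Q ⟶ A') (e : D ⊗ A' ⟶ 𝟙_ C) :
    (c ≫ (x ⊗ₘ t)) ▷ Q ≫ (α_ _ _ _).hom ≫ P ◁ ((s ⊗ₘ y) ≫ e) =
      𝟙_ C ◁ y ≫ (c ▷ A' ≫ (α_ _ _ _).hom ≫ A ◁ ((t ≫ s) ▷ A' ≫ e)) ≫ x ▷ 𝟙_ C := by
  have h := associator_naturality x t (𝟙 Q)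
  have h' := associator_naturality (𝟙 A) (𝟙 B) y
  have h'' : 𝟙_ C ◁ y ≫ c ▷ A' = c ▷ Q ≫ (A ⊗ B) ◁ y := whisker_exchange _ _
  simp only [Category.assoc]
  rw [reassoc_of% h'']
  simp only [← MonoidalCategory.tensorHom_id, ← MonoidalCategory.id_tensorHom] at h h' ⊢
  rw [← Category.comp_id (𝟙 Q), ← tensorHom_comp_tensorHom, Category.assoc,
    Category.comp_id, reassoc_of% h, ← id_tensorHom_id A B, reassoc_of% h']
  simp only [tensorHom_comp_tensorHom_assoc, tensorHom_comp_tensorHom, Category.comp_id,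
    Category.id_comp, Category.assoc]

/-- A retract of an object with a right dual has a right dual, if idempotents split. -/
theorem nonempty_hasRightDual_of_retract [IsIdempotentComplete C] {A P : C} [HasRightDual A]
    (i : P ⟶ A) (r : A ⟶ P) (hir : i ≫ r = 𝟙 P) : Nonempty (HasRightDual P) := by
  -- The mate of the idempotent that cuts out P is an idempotent on the dual of A; its image E is
  -- the dual of P.
  have hid : (r ≫ i)ᘁ ≫ (r ≫ i)ᘁ = (r ≫ i)ᘁ := by
    rw [← comp_rightAdjointMate, Category.assoc, reassoc_of% hir]
  obtain ⟨E, s, t, hst, hts⟩ := IsIdempotentComplete.idempotents_split _ _ hid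
  have h1 := coevaluation_comp_rightAdjointMate (r ≫ i)
  have h2 := rightAdjointMate_comp_evaluation (r ≫ i)
  rw [← hts] at h1 h2
  refine ⟨@HasRightDual.mk _ _ _ P E
    { coevaluation' := η_ A Aᘁ ≫ (r ⊗ₘ t), evaluation' := (s ⊗ₘ i) ≫ ε_ A Aᘁ,
      coevaluation_evaluation' := ?_, evaluation_coevaluation' := ?_ }⟩
  · rw [whiskerLeft_coev_comp, ← h1]
    have e : Aᘁ ◁ (η_ A Aᘁ ≫ A ◁ (t ≫ s)) ≫ (α_ Aᘁ A Aᘁ).inv ≫ ε_ A Aᘁ ▷ Aᘁ =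
        (Aᘁ ◁ η_ A Aᘁ ≫ (α_ _ _ _).inv ≫ ε_ A Aᘁ ▷ Aᘁ) ≫ 𝟙_ C ◁ (t ≫ s) := by
      simp only [Category.assoc]
      rw [← whisker_exchange]
      simp
    rw [e, ExactPairing.coevaluation_evaluation]
    simp [reassoc_of% hst, hst]
  · rw [coev_whiskerRight_comp, h2]
    have e : η_ A Aᘁ ▷ A ≫ (α_ A Aᘁ A).hom ≫ A ◁ (Aᘁ ◁ (r ≫ i) ≫ ε_ A Aᘁ) =
        𝟙_ C ◁ (r ≫ i) ≫ η_ A Aᘁ ▷ A ≫ (α_ _ _ _).hom ≫ A ◁ ε_ A Aᘁ := by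
      rw [whisker_exchange_assoc]
      simp
    rw [e, ExactPairing.evaluation_coevaluation]
    simp [reassoc_of% hir, hir]

/-- A finite direct sum of objects with right duals has a right dual. -/
theorem nonempty_hasRightDual_biproduct [Preadditive C] [MonoidalPreadditive C]
    [HasFiniteBiproducts C] {J : Type} [Fintype J] (F : J → C) [∀ j, HasRightDual (F j)] :
    Nonempty (HasRightDual (⨁ F)) := by
  classical
  let G : J → C := fun j => (F j)ᘁ
  refine ⟨@HasRightDual.mk _ _ _ (⨁ F) (⨁ G)
    { coevaluation' := ∑ j, η_ (F j) (F j)ᘁ ≫ (biproduct.ι F j ⊗ₘ biproduct.ι G j),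
      evaluation' := ∑ j, (biproduct.π G j ⊗ₘ biproduct.π F j) ≫ ε_ (F j) (F j)ᘁ,
      coevaluation_evaluation' := ?_, evaluation_coevaluation' := ?_ }⟩
  · simp only [whiskerLeft_sum, sum_whiskerRight, Preadditive.sum_comp, Preadditive.comp_sum,
      whiskerLeft_coev_comp]
    -- Orthogonality of the summands leaves only j = l, where the triangle identity of F l applies.
    -- Summing over l then gives the identity of the direct sum.
    have e : ∀ l, ∑ j, biproduct.π G l ▷ 𝟙_ C ≫
        (HasRightDual.rightDual (F l) ◁ (η_ (F j) (F j)ᘁ ≫ (biproduct.ι F j ≫ biproduct.π F l) ▷ (F j)ᘁ) ≫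
          (α_ (F l)ᘁ (F l) (F j)ᘁ).inv ≫ ε_ (F l) (F l)ᘁ ▷ (F j)ᘁ) ≫ 𝟙_ C ◁ biproduct.ι G j =
        (ρ_ _).hom ≫ (biproduct.π G l ≫ biproduct.ι G l) ≫ (λ_ _).inv := by
      intro l
      rw [Finset.sum_eq_single l]
      · rw [biproduct.ι_π_self, id_whiskerRight, Category.comp_id,
          ExactPairing.coevaluation_evaluation]
        simp [G]
      · intro j _ hj
        rw [biproduct.ι_π_ne _ hj]
        simp
      · simp
    refine (Finset.sum_congr rfl fun l _ => e l).trans ?_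
    rw [← Preadditive.comp_sum, ← Preadditive.sum_comp, biproduct.total, Category.id_comp]
  · simp only [whiskerLeft_sum, sum_whiskerRight, Preadditive.sum_comp, Preadditive.comp_sum,
      coev_whiskerRight_comp]
    have e : ∀ l, ∑ j, 𝟙_ C ◁ biproduct.π F l ≫
        (η_ (F j) (F j)ᘁ ▷ F l ≫ (α_ (F j) (F j)ᘁ (F l)).hom ≫
          F j ◁ ((biproduct.ι G j ≫ biproduct.π G l) ▷ F l ≫ ε_ (F l) (F l)ᘁ)) ≫
            biproduct.ι F j ▷ 𝟙_ C =
        (λ_ _).hom ≫ (biproduct.π F l ≫ biproduct.ι F l) ≫ (ρ_ _).inv := by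
      intro l
      rw [Finset.sum_eq_single l]
      · rw [biproduct.ι_π_self, id_whiskerRight, Category.id_comp,
          ExactPairing.evaluation_coevaluation]
        simp
      · intro j _ hj
        rw [biproduct.ι_π_ne _ hj]
        simp
      · simp
    refine (Finset.sum_congr rfl fun l _ => e l).trans ?_
    rw [← Preadditive.comp_sum, ← Preadditive.sum_comp, biproduct.total, Category.id_comp]

end Duals

/-! ### Linear structures on additive and idempotent completions and on quotients. -/

section LinearCompletions
open CategoryTheory.Idempotents

variable {R : Type*} [CommRing R] {C : Type*} [Category C] [Preadditive C] [Linear R C]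

instance matLinear : Linear R (Mat_ C) where
  homModule M N :=
    { smul := fun r f i j => r • f i j
      one_smul := fun f => Mat_.hom_ext _ _ fun i j => one_smul R (f i j)
      mul_smul := fun r s f => Mat_.hom_ext _ _ fun i j => mul_smul r s (f i j)
      smul_zero := fun r => Mat_.hom_ext _ _ fun i j => smul_zero r
      smul_add := fun r f g => Mat_.hom_ext _ _ fun i j => smul_add r (f i j) (g i j)
      add_smul := fun r s f => Mat_.hom_ext _ _ fun i j => add_smul r s (f i j)
      zero_smul := fun f => Mat_.hom_ext _ _ fun i j => zero_smul R (f i j) }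
  smul_comp M N K r f g := Mat_.hom_ext _ _ fun i j => by
    rw [Mat_.comp_apply]
    change ∑ l, (r • f i l) ≫ g l j = r • (f ≫ g) i j
    simp only [Mat_.comp_apply, Finset.smul_sum, Linear.smul_comp]
  comp_smul M N K f r g := Mat_.hom_ext _ _ fun i j => by
    rw [Mat_.comp_apply]
    change ∑ l, f i l ≫ (r • g l j) = r • (f ≫ g) i j
    simp only [Mat_.comp_apply, Finset.smul_sum, Linear.comp_smul]

instance matEmbedding_linear : (Mat_.embedding C).Linear R where
  map_smul _ _ := rfl

instance karoubiLinear : Linear R (Karoubi C) where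
  homModule P Q :=
    { smul := fun r f => ⟨r • f.f, by
        rw [Linear.smul_comp, Linear.comp_smul]; exact congrArg (r • ·) f.comm⟩
      one_smul := fun f => Karoubi.hom_ext _ _ (one_smul R f.f)
      mul_smul := fun r s f => Karoubi.hom_ext _ _ (mul_smul r s f.f)
      smul_zero := fun r => Karoubi.hom_ext _ _ (smul_zero r)
      smul_add := fun r f g => Karoubi.hom_ext _ _ (smul_add r f.f g.f)
      add_smul := fun r s f => Karoubi.hom_ext _ _ (add_smul r s f.f)
      zero_smul := fun f => Karoubi.hom_ext _ _ (zero_smul R f.f) }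
  smul_comp P Q T r f g := Karoubi.hom_ext _ _ (Linear.smul_comp _ _ _ r f.f g.f)
  comp_smul P Q T f r g := Karoubi.hom_ext _ _ (Linear.comp_smul _ _ _ f.f r g.f)

instance toKaroubi_linear : (toKaroubi C).Linear R where
  map_smul _ _ := rfl

instance toIdealQuotient_linear [MonoidalCategory C] (S : ∀ ⦃X Y : C⦄, (X ⟶ Y) → Prop) :
    (toIdealQuotient S).Linear R where
  map_smul _ _ := rfl

variable [MonoidalCategory C] [MonoidalPreadditive C] [MonoidalLinear R C]

theorem smul_tensorHom {A B A' B' : C} (r : R) (f : A ⟶ B) (g : A' ⟶ B') :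
    (r • f) ⊗ₘ g = r • (f ⊗ₘ g) := by
  rw [MonoidalCategory.tensorHom_def, MonoidalCategory.tensorHom_def,
    MonoidalLinear.smul_whiskerRight, Linear.smul_comp]

theorem tensorHom_smul {A B A' B' : C} (r : R) (f : A ⟶ B) (g : A' ⟶ B') :
    f ⊗ₘ (r • g) = r • (f ⊗ₘ g) := by
  rw [MonoidalCategory.tensorHom_def, MonoidalCategory.tensorHom_def,
    MonoidalLinear.whiskerLeft_smul, Linear.comp_smul]

instance mat_monoidalLinear : MonoidalLinear R (Mat_ C) where
  whiskerLeft_smul _ _ _ r f := Mat_.hom_ext _ _ fun _ _ => tensorHom_smul r _ _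
  smul_whiskerRight r _ _ f _ := Mat_.hom_ext _ _ fun _ _ => smul_tensorHom r _ _

instance karoubi_monoidalLinear : MonoidalLinear R (Karoubi C) where
  whiskerLeft_smul _ _ _ r f := Karoubi.hom_ext _ _ (tensorHom_smul r _ f.f)
  smul_whiskerRight r _ _ f _ := Karoubi.hom_ext _ _ (smul_tensorHom r f.f _)

end LinearCompletions

/-! ### Monoidality of the embeddings into the completions and of the quotient functors. -/

section MonoidalFunctors
open CategoryTheory.Idempotents MatMonoidal

variable {C : Type*} [Category C] [MonoidalCategory C]

instance toKaroubi_monoidal : (toKaroubi C).Monoidal :=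
  Functor.CoreMonoidal.toMonoidal
    { εIso := Iso.refl _
      μIso := fun X Y => karoubiIso (P := (toKaroubi C).obj X ⊗ (toKaroubi C).obj Y)
        (Q := (toKaroubi C).obj (X ⊗ Y)) (Iso.refl (X ⊗ Y))
        ((Category.comp_id _).trans ((id_tensorHom_id X Y).trans (Category.comp_id _).symm))
      μIso_hom_natural_left := fun f X' => Karoubi.hom_ext _ _ (by
        change (f ⊗ₘ 𝟙 X') ≫ (𝟙 _ ⊗ₘ 𝟙 _) ≫ 𝟙 _ = ((𝟙 _ ⊗ₘ 𝟙 _) ≫ 𝟙 _) ≫ f ▷ X'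
        simp)
      μIso_hom_natural_right := fun X' f => Karoubi.hom_ext _ _ (by
        change (𝟙 X' ⊗ₘ f) ≫ (𝟙 _ ⊗ₘ 𝟙 _) ≫ 𝟙 _ = ((𝟙 _ ⊗ₘ 𝟙 _) ≫ 𝟙 _) ≫ X' ◁ f
        simp)
      associativity := fun X Y Z => Karoubi.hom_ext _ _ (by
        change (((𝟙 X ⊗ₘ 𝟙 Y) ≫ 𝟙 _) ⊗ₘ 𝟙 Z) ≫ ((𝟙 _ ⊗ₘ 𝟙 _) ≫ 𝟙 _) ≫ (α_ X Y Z).hom =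
          (((𝟙 _ ⊗ₘ 𝟙 _) ⊗ₘ 𝟙 _) ≫ (α_ X Y Z).hom) ≫ (𝟙 _ ⊗ₘ ((𝟙 _ ⊗ₘ 𝟙 _) ≫ 𝟙 _)) ≫
            (𝟙 _ ⊗ₘ 𝟙 _) ≫ 𝟙 _
        simp)
      left_unitality := fun X => Karoubi.hom_ext _ _ (by
        change (𝟙 _ ⊗ₘ 𝟙 _) ≫ (λ_ X).hom = (𝟙 _ ⊗ₘ 𝟙 _) ≫ ((𝟙 _ ⊗ₘ 𝟙 _) ≫ 𝟙 _) ≫ (λ_ X).hom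
        simp)
      right_unitality := fun X => Karoubi.hom_ext _ _ (by
        change (𝟙 _ ⊗ₘ 𝟙 _) ≫ (ρ_ X).hom = (𝟙 _ ⊗ₘ 𝟙 _) ≫ ((𝟙 _ ⊗ₘ 𝟙 _) ≫ 𝟙 _) ≫ (ρ_ X).hom
        simp) }

theorem id_whiskerRight_comp_associator (X Y Z : C) :
    𝟙 (X ⊗ Y) ▷ Z ≫ 𝟙 _ ≫ (α_ X Y Z).hom = (α_ X Y Z).hom ≫ X ◁ 𝟙 (Y ⊗ Z) ≫ 𝟙 _ := by
  simp

theorem leftUnitor_eq_id_whiskerRight_comp (X : C) :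
    (λ_ X).hom = 𝟙 (𝟙_ C) ▷ X ≫ 𝟙 _ ≫ (λ_ X).hom := by
  simp

theorem rightUnitor_eq_whiskerLeft_id_comp (X : C) :
    (ρ_ X).hom = X ◁ 𝟙 (𝟙_ C) ≫ 𝟙 _ ≫ (ρ_ X).hom := by
  simp

variable [Preadditive C]

theorem matEmbedding_isMonomial {C : Type*} [Category C] [Preadditive C] {X Y : C} (f : X ⟶ Y) :
    IsMonomial ((Mat_.embedding C).map f) (fun _ => PUnit.unit) (fun _ => f) :=
  ⟨fun _ => rfl, fun _ _ h => (h rfl).elim⟩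

/-- The canonical isomorphism between the tensor product of two one-by-one matrix objects and the
one-by-one matrix object on the tensor product. -/
def matEmbeddingMul (X Y : C) : (Mat_.embedding C).obj X ⊗ (Mat_.embedding C).obj Y ≅
    (Mat_.embedding C).obj (X ⊗ Y) where
  hom := fun _ _ => 𝟙 (X ⊗ Y)
  inv := fun _ _ => 𝟙 (X ⊗ Y)
  hom_inv_id :=
    (IsMonomial.comp (e := fun _ => PUnit.unit) (φ := fun _ => 𝟙 (X ⊗ Y))
      (e' := fun _ => (PUnit.unit, PUnit.unit)) (ψ := fun _ => 𝟙 (X ⊗ Y))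
      ⟨fun _ => rfl, fun _ _ h => (h rfl).elim⟩ ⟨fun _ => rfl, fun _ _ h => (h rfl).elim⟩).ext
      (IsMonomial.id _) fun _ => Category.comp_id _
  inv_hom_id :=
    (IsMonomial.comp (e := fun _ => (PUnit.unit, PUnit.unit)) (φ := fun _ => 𝟙 (X ⊗ Y))
      (e' := fun _ => PUnit.unit) (ψ := fun _ => 𝟙 (X ⊗ Y))
      ⟨fun _ => rfl, fun _ _ h => (h rfl).elim⟩ ⟨fun _ => rfl, fun _ _ h => (h rfl).elim⟩).ext
      (IsMonomial.id _) fun _ => Category.comp_id _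

theorem matEmbeddingMul_isMonomial (X Y : C) :
    IsMonomial (matEmbeddingMul X Y).hom (fun _ => PUnit.unit) (fun _ => 𝟙 (X ⊗ Y)) :=
  ⟨fun _ => rfl, fun _ _ h => (h rfl).elim⟩

variable [MonoidalPreadditive C]

instance toIdealQuotient_monoidal (S : ∀ ⦃X Y : C⦄, (X ⟶ Y) → Prop) :
    (toIdealQuotient S).Monoidal :=
  Functor.CoreMonoidal.toMonoidal
    { εIso := Iso.refl _
      μIso := fun X Y => Iso.refl _
      μIso_hom_natural_left := fun f X' => (Category.comp_id _).trans (Category.id_comp _).symm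
      μIso_hom_natural_right := fun X' f => (Category.comp_id _).trans (Category.id_comp _).symm
      associativity := fun X Y Z => id_whiskerRight_comp_associator
        ((toIdealQuotient S).obj X) ((toIdealQuotient S).obj Y) ((toIdealQuotient S).obj Z)
      left_unitality := fun X => leftUnitor_eq_id_whiskerRight_comp ((toIdealQuotient S).obj X)
      right_unitality := fun X => rightUnitor_eq_whiskerLeft_id_comp ((toIdealQuotient S).obj X) }

/-- The index set of a product of one-by-one matrix objects is PUnit × PUnit, so the tensorator is a
reindexing rather than an identity. All composites are monomial matrices, and each axiom reduces to
one between entries. -/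
instance matEmbedding_monoidal : (Mat_.embedding C).Monoidal :=
  Functor.CoreMonoidal.toMonoidal
    { εIso := Iso.refl _
      μIso := matEmbeddingMul
      μIso_hom_natural_left := fun {X Y} f X' =>
        (((matEmbedding_isMonomial f).tensor (.id ((Mat_.embedding C).obj X'))).comp
          (matEmbeddingMul_isMonomial Y X')).ext
          ((matEmbeddingMul_isMonomial X X').comp (matEmbedding_isMonomial (f ▷ X')))
          fun _ => (by simp : (f ⊗ₘ 𝟙 X') ≫ 𝟙 _ = 𝟙 _ ≫ f ▷ X')
      μIso_hom_natural_right := fun {X Y} X' f =>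
        (((IsMonomial.id ((Mat_.embedding C).obj X')).tensor (matEmbedding_isMonomial f)).comp
          (matEmbeddingMul_isMonomial X' Y)).ext
          ((matEmbeddingMul_isMonomial X' X).comp (matEmbedding_isMonomial (X' ◁ f)))
          fun _ => (by simp : (𝟙 X' ⊗ₘ f) ≫ 𝟙 _ = 𝟙 _ ≫ X' ◁ f)
      associativity := fun X Y Z =>
        (((matEmbeddingMul_isMonomial X Y).tensor (.id ((Mat_.embedding C).obj Z))).comp
          ((matEmbeddingMul_isMonomial (X ⊗ Y) Z).comp
            (matEmbedding_isMonomial (α_ X Y Z).hom))).ext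
          ((assoc_mono ((Mat_.embedding C).obj X) ((Mat_.embedding C).obj Y)
            ((Mat_.embedding C).obj Z)).comp
            (((IsMonomial.id ((Mat_.embedding C).obj X)).tensor
              (matEmbeddingMul_isMonomial Y Z)).comp (matEmbeddingMul_isMonomial X (Y ⊗ Z))))
          fun _ => (by simp : (𝟙 (X ⊗ Y) ⊗ₘ 𝟙 Z) ≫ 𝟙 _ ≫ (α_ X Y Z).hom =
            (α_ X Y Z).hom ≫ (𝟙 X ⊗ₘ 𝟙 (Y ⊗ Z)) ≫ 𝟙 _)
      left_unitality := fun X =>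
        (left_mono ((Mat_.embedding C).obj X)).ext
          (((IsMonomial.id (𝟙_ (Mat_ C))).tensor (.id ((Mat_.embedding C).obj X))).comp
            ((matEmbeddingMul_isMonomial (𝟙_ C) X).comp (matEmbedding_isMonomial (λ_ X).hom)))
          fun _ => (by simp : (λ_ X).hom = (𝟙 (𝟙_ C) ⊗ₘ 𝟙 X) ≫ 𝟙 _ ≫ (λ_ X).hom)
      right_unitality := fun X =>
        (right_mono ((Mat_.embedding C).obj X)).ext
          (((IsMonomial.id ((Mat_.embedding C).obj X)).tensor (.id (𝟙_ (Mat_ C)))).comp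
            ((matEmbeddingMul_isMonomial X (𝟙_ C)).comp (matEmbedding_isMonomial (ρ_ X).hom)))
          fun _ => (by simp : (ρ_ X).hom = (𝟙 X ⊗ₘ 𝟙 (𝟙_ C)) ≫ 𝟙 _ ≫ (ρ_ X).hom) }

end MonoidalFunctors

/-! ### Transport of the Jones–Wenzl calculus along a monoidal functor. -/

section Transfer
open Functor.LaxMonoidal Functor.OplaxMonoidal Functor.Monoidal

variable {C D : Type*} [Category C] [MonoidalCategory C] [Category D] [MonoidalCategory D]
  (G : C ⥤ D) [G.Monoidal]

/-- The image of a cup under a monoidal functor. -/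
def mapCup {X : C} (cup : 𝟙_ C ⟶ X ⊗ X) : 𝟙_ D ⟶ G.obj X ⊗ G.obj X :=
  ε G ≫ G.map cup ≫ δ G X X

/-- The image of a cap under a monoidal functor. -/
def mapCap {X : C} (cap : X ⊗ X ⟶ 𝟙_ C) : G.obj X ⊗ G.obj X ⟶ 𝟙_ D :=
  μ G X X ≫ G.map cap ≫ η G

/-- Monoidal functors commute with tensor powers. -/
def tpowMapIso (X : C) : ∀ n : ℕ, tpow (G.obj X) n ≅ G.obj (tpow X n)
  | 0 => εIso G
  | n + 1 => whiskerRightIso (tpowMapIso X n) (G.obj X) ≪≫ μIso G (tpow X n) X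

/-- A morphism to `G.obj T`, extended by one strand. -/
def extendMap {T' : D} {T : C} (t : T' ⟶ G.obj T) (X : C) : T' ⊗ G.obj X ⟶ G.obj (T ⊗ X) :=
  t ▷ G.obj X ≫ μ G T X

theorem whiskerRight_extendMap {T' S' : D} {T S : C} {t : T' ⟶ G.obj T} {s : S' ⟶ G.obj S}
    {f' : T' ⟶ S'} {f : T ⟶ S} (h : f' ≫ s = t ≫ G.map f) (X : C) :
    f' ▷ G.obj X ≫ extendMap G s X = extendMap G t X ≫ G.map (f ▷ X) := by
  rw [extendMap, ← comp_whiskerRight_assoc, h]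
  simp [extendMap]

/-- Associativity of the tensorator, in the form needed for inductions that add one strand on the
right. -/
theorem tensorHom_μ_associator_inv {A' B' : D} {A B : C} (a : A' ⟶ G.obj A) (b : B' ⟶ G.obj B)
    (X : C) :
    (α_ A' B' (G.obj X)).inv ≫ extendMap G ((a ⊗ₘ b) ≫ μ G A B) X =
      (a ⊗ₘ extendMap G b X) ≫ μ G A (B ⊗ X) ≫ G.map (α_ A B X).inv := by
  have h := associator_inv_naturality a b (𝟙 (G.obj X))
  simp only [extendMap, comp_whiskerRight, Category.assoc]
  rw [← MonoidalCategory.tensorHom_id (a ⊗ₘ b), ← reassoc_of% h]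
  simp only [Functor.LaxMonoidal.associativity_inv, MonoidalCategory.tensorHom_id]
  rw [MonoidalCategory.tensorHom_def a, MonoidalCategory.tensorHom_def a]
  simp

theorem capCup_map {X : C} (cup : 𝟙_ C ⟶ X ⊗ X) (cap : X ⊗ X ⟶ 𝟙_ C) {T' : D} {T : C}
    (t : T' ⟶ G.obj T) :
    capCup (mapCup G cup) (mapCap G cap) T' ≫ extendMap G (extendMap G t X) X =
      extendMap G (extendMap G t X) X ≫ G.map (capCup cup cap T) := by
  have e : extendMap G (extendMap G t X) X =
      (α_ T' (G.obj X) (G.obj X)).hom ≫ (t ⊗ₘ μ G X X) ≫ μ G T (X ⊗ X) ≫ G.map (α_ T X X).inv := by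
    have h := tensorHom_μ_associator_inv G t (𝟙 (G.obj X)) X
    simp only [MonoidalCategory.tensorHom_id] at h
    have h' : extendMap G (𝟙 (G.obj X)) X = μ G X X := by simp [extendMap]
    rw [h'] at h
    rw [← h, Iso.hom_inv_id_assoc]
    rfl
  have hm : (mapCap G cap ≫ mapCup G cup) ≫ μ G X X = μ G X X ≫ G.map (cap ≫ cup) := by
    simp [mapCap, mapCup]
  rw [e]
  simp only [capCup, Category.assoc, Iso.inv_hom_id_assoc, Functor.map_comp]
  congr 1
  have h1 : T' ◁ (mapCap G cap ≫ mapCup G cup) ≫ (t ⊗ₘ μ G X X) =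
      (t ⊗ₘ μ G X X) ≫ G.obj T ◁ G.map (cap ≫ cup) := by
    rw [← MonoidalCategory.id_tensorHom, ← MonoidalCategory.id_tensorHom,
      tensorHom_comp_tensorHom, tensorHom_comp_tensorHom, hm]
    simp
  rw [reassoc_of% h1, ← Functor.map_comp_assoc G (α_ T X X).inv, Iso.inv_hom_id]
  simp

theorem tpowAdd_map (X : C) (i : ℕ) : ∀ j : ℕ,
    ((tpowMapIso G X i).hom ⊗ₘ (tpowMapIso G X j).hom) ≫ μ G _ _ ≫ G.map (tpowAdd X i j).hom =
      (tpowAdd (G.obj X) i j).hom ≫ (tpowMapIso G X (i + j)).hom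
  | 0 => by
    have e : ∀ (A' : D) (A : C) (a : A' ⟶ G.obj A),
        (a ⊗ₘ ε G) ≫ μ G _ _ ≫ G.map (ρ_ A).hom = (ρ_ A').hom ≫ a := by
      intro A' A a
      rw [MonoidalCategory.tensorHom_def]
      simp
    exact e _ _ _
  | j + 1 => by
    have ih := tpowAdd_map X i j
    have e : ∀ (A' B' E' : D) (A B E : C) (a : A' ⟶ G.obj A) (b : B' ⟶ G.obj B) (c : E' ⟶ G.obj E)
        (r' : A' ⊗ B' ⟶ E') (r : A ⊗ B ⟶ E), (a ⊗ₘ b) ≫ μ G _ _ ≫ G.map r = r' ≫ c →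
        (a ⊗ₘ extendMap G b X) ≫ μ G _ _ ≫ G.map ((α_ A B X).inv ≫ r ▷ X) =
          ((α_ A' B' (G.obj X)).inv ≫ r' ▷ G.obj X) ≫ extendMap G c X := by
      intro A' B' E' A B E a b c r' r h
      have h' := whiskerRight_extendMap G (t := (a ⊗ₘ b) ≫ μ G A B) (s := c)
        (h.symm.trans (Category.assoc _ _ _).symm) X
      rw [Category.assoc, h', Functor.map_comp, ← reassoc_of% tensorHom_μ_associator_inv G a b X]
    exact e _ _ _ _ _ _ _ _ _ _ _ ih

variable [Preadditive C] [Linear ℂ C] [Preadditive D] [Linear ℂ D]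
  [G.Linear ℂ]

theorem TLObject.map [MonoidalPreadditive C] [MonoidalLinear ℂ C]
    [MonoidalPreadditive D] [MonoidalLinear ℂ D]
    {q : ℂ} {N : ℕ} {X : C} {cup : 𝟙_ C ⟶ X ⊗ X} {cap : X ⊗ X ⟶ 𝟙_ C}
    (H : TLObject q N cup cap) : TLObject q N (mapCup G cup) (mapCap G cap) where
  q_ne_zero := H.q_ne_zero
  zz₁ := map_coevaluation_evaluation G H.zz₁
  zz₂ := map_evaluation_coevaluation G H.zz₂
  loop := by
    simp only [mapCup, mapCap, Category.assoc, δ_μ_assoc]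
    rw [← Functor.map_comp_assoc, H.loop, Functor.map_smul, CategoryTheory.Functor.map_id, Linear.smul_comp,
      Category.id_comp, Linear.comp_smul, ε_η]
  qInt_ne_zero := H.qInt_ne_zero

variable [G.Additive]

theorem jwStep_map {X : C} (cup : 𝟙_ C ⟶ X ⊗ X) (cap : X ⊗ X ⟶ 𝟙_ C) {T' : D} {T : C}
    (t : T' ⟶ G.obj T) {f' : T' ⊗ G.obj X ⟶ T' ⊗ G.obj X} {f : T ⊗ X ⟶ T ⊗ X}
    (h : f' ≫ extendMap G t X = extendMap G t X ≫ G.map f) (c : ℂ) :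
    jwStep (mapCup G cup) (mapCap G cap) T' f' c ≫ extendMap G (extendMap G t X) X =
      extendMap G (extendMap G t X) X ≫ G.map (jwStep cup cap T f c) := by
  have h1 := whiskerRight_extendMap G h X
  have h2 := capCup_map G cup cap t
  simp only [jwStep, Functor.map_add, Functor.map_smul, Functor.map_comp, Preadditive.add_comp,
    Preadditive.comp_add, Linear.smul_comp, Linear.comp_smul, Category.assoc]
  rw [h1, reassoc_of% h2, reassoc_of% h1]

/-- The recursion involves only whiskering, cap-cups and linear combinations, each of which is
compatible with a linear monoidal functor. -/
theorem jw_map (q : ℂ) {X : C} (cup : 𝟙_ C ⟶ X ⊗ X) (cap : X ⊗ X ⟶ 𝟙_ C) : ∀ n : ℕ,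
    jw q (mapCup G cup) (mapCap G cap) n ≫ (tpowMapIso G X n).hom =
      (tpowMapIso G X n).hom ≫ G.map (jw q cup cap n)
  | 0 => by simp [jw]
  | 1 => by simp [jw]
  | n + 2 => jwStep_map G cup cap (tpowMapIso G X n).hom (jw_map q cup cap (n + 1)) _

/-- Images of the Jones–Wenzl projections of `X`, in the target of a monoidal functor. -/
def JWImages.ofMap (q : ℂ) {X : C} (cup : 𝟙_ C ⟶ X ⊗ X) (cap : X ⊗ X ⟶ 𝟙_ C) {F : ℕ → D}
    {u : 𝟙_ D ⟶ F 0} {m : ∀ i j, F i ⊗ F j ⟶ F (i + j)}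
    (ι : ∀ i, F i ⟶ G.obj (tpow X i)) (p : ∀ i, G.obj (tpow X i) ⟶ F i)
    (ι_p : ∀ i, ι i ≫ p i = 𝟙 _) (p_ι : ∀ i, p i ≫ ι i = G.map (jw q cup cap i))
    (unit : u ≫ ι 0 = ε G)
    (mul : ∀ i j, m i j = (ι i ⊗ₘ ι j) ≫ μ G _ _ ≫ G.map (tpowAdd X i j).hom ≫ p (i + j)) :
    JWImages q (mapCup G cup) (mapCap G cap) F u m where
  ι i := ι i ≫ (tpowMapIso G X i).inv
  p i := (tpowMapIso G X i).hom ≫ p i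
  ι_p i := by simp [ι_p]
  p_ι i := by
    rw [Category.assoc, reassoc_of% p_ι i, ← reassoc_of% jw_map G q cup cap i, Iso.hom_inv_id,
      Category.comp_id]
  unit := by
    have e : ∀ (z : F 0 ⟶ G.obj (𝟙_ C)), u ≫ z = ε G → u ≫ z ≫ η G = 𝟙 _ := by
      intro z hz
      rw [reassoc_of% hz, ε_η]
    exact e _ unit
  mul i j := by
    rw [← reassoc_of% tpowAdd_map G X i j, ← tensorHom_comp_tensorHom_assoc,
      tensorHom_comp_tensorHom_assoc, tensorHom_comp_tensorHom_assoc]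
    simp [mul]

end Transfer

/-! ### Nonvanishing of quantum integers at the root of unity. -/

section QuantumIntegers

/-- Otherwise q^{2n} = exp(2πi n/(k+2)) = 1, which would make n a multiple of k + 2. -/
theorem qRoot_pow_ne_inv (k n : ℕ) (hn : 0 < n) (hnk : n < k + 2) :
    qRoot k ^ n - (qRoot k ^ n)⁻¹ ≠ 0 := by
  intro h
  have hk : ((k : ℂ) + 2) ≠ 0 := by exact_mod_cast (Nat.succ_ne_zero (k + 1))
  have h0 : qRoot k ^ n ≠ 0 := pow_ne_zero _ (Complex.exp_ne_zero _)
  have h1 : qRoot k ^ n * qRoot k ^ n = 1 := by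
    rw [sub_eq_zero] at h
    nth_rewrite 2 [h]
    exact mul_inv_cancel₀ h0
  rw [qRoot, ← Complex.exp_nat_mul, ← Complex.exp_add, Complex.exp_eq_one_iff] at h1
  obtain ⟨z, hz⟩ := h1
  have hz' : (n : ℂ) = z * (k + 2) := by
    field_simp at hz
    have h2 : (2 * (Real.pi : ℂ) * Complex.I) ≠ 0 := Complex.two_pi_I_ne_zero
    apply mul_left_cancel₀ h2
    linear_combination (Real.pi : ℂ) * Complex.I * hz
  have hz'' : (n : ℤ) = z * (k + 2) := by exact_mod_cast hz'
  have hpos : 0 < z := by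
    by_contra hneg
    have : z * ((k : ℤ) + 2) ≤ 0 := mul_nonpos_of_nonpos_of_nonneg (not_lt.mp hneg) (by positivity)
    omega
  have : (k : ℤ) + 2 ≤ z * (k + 2) := le_mul_of_one_le_left (by positivity) hpos
  omega

theorem qInt_qRoot_ne_zero (k n : ℕ) (hn : n ≤ k) : qInt (qRoot k) (n + 1) ≠ 0 := by
  have h := qRoot_pow_ne_inv k 1 one_pos (by omega)
  rw [pow_one] at h
  exact div_ne_zero (qRoot_pow_ne_inv k (n + 1) n.succ_pos (by omega)) h

end QuantumIntegers

/-! ### The reduced Temperley–Lieb category at level k. -/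

section Level
open CategoryTheory.Idempotents Functor.LaxMonoidal Functor.OplaxMonoidal Functor.Monoidal

variable (k : ℕ)

theorem TLPre.tlObject : TLObject (qRoot k) k (TLPre.cup k) (TLPre.cap k) where
  q_ne_zero := Complex.exp_ne_zero _
  zz₁ := TLPre.zigzag₁ k
  zz₂ := TLPre.zigzag₂ k
  loop := TLPre.loop k
  qInt_ne_zero n hn := qInt_qRoot_ne_zero k n hn

/-- The embedding of the category of diagrams in its additive and idempotent completion. -/
abbrev TL.ofPre : TLPre k ⥤ TL k := Mat_.embedding (TLPre k) ⋙ toKaroubi (Mat_ (TLPre k))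

/-- The canonical inclusion and projection of an object of the idempotent completion both have the
idempotent as underlying morphism, so the formula matches the definition by `cut` up to identities
in the tensorator. -/
theorem TL.mulF_eq (i j : ℕ) : TL.mulF k i j =
    ((F k i).decompId_i ⊗ₘ (F k j).decompId_i) ≫ μ (TL.ofPre k) _ _ ≫
      (TL.ofPre k).map (tpowAdd (TLPre.pt k) i j).hom ≫ (F k (i + j)).decompId_p := by
  refine Karoubi.hom_ext _ _ ?_
  have e : ∀ {A B P S : Mat_ (TLPre k)} (a : A ⟶ A) (b : B ⟶ B)
      (r : A ⊗ B ⟶ P) (s : P ⟶ S) (t : S ⟶ S),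
      (a ⊗ₘ b) ≫ (r ≫ s) ≫ t = (a ⊗ₘ b) ≫ (((𝟙 A ⊗ₘ 𝟙 B) ≫ 𝟙 (A ⊗ B)) ≫ r) ≫ s ≫ t := by
    intros; simp
  exact e _ _ _ _ _

theorem TL.unitF_decompId_i : TL.unitF k ≫ (F k 0).decompId_i = ε (TL.ofPre k) := by
  refine Karoubi.hom_ext _ _ ?_
  have h : ∀ {A : Mat_ (TLPre k)} (a b c d : A ⟶ A), a = 𝟙 A → b = 𝟙 A → c = 𝟙 A → d = 𝟙 A →
      (a ≫ b ≫ c) ≫ c = 𝟙 A ≫ d := by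
    intro A a b c d h1 h2 h3 h4; simp [h1, h2, h3, h4]
  have hid := (Mat_.embedding (TLPre k)).map_id (𝟙_ (TLPre k))
  exact h _ _ _ _ rfl hid hid rfl

/-- The functor from the category of diagrams to the reduced Temperley–Lieb category. -/
abbrev RedTL.ofPre : TLPre k ⥤ RedTL k := TL.ofPre k ⋙ toIdealQuotient (TL.KillRel k)

theorem tensorHom_μ_comp {C D E : Type*} [Category C] [MonoidalCategory C] [Category D]
    [MonoidalCategory D] [Category E] [MonoidalCategory E] (K : C ⥤ D) (Q : D ⥤ E) [K.Monoidal]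
    [Q.Monoidal] {A B P : C} {A' B' P' : D} (a : A' ⟶ K.obj A) (b : B' ⟶ K.obj B) (r : A ⊗ B ⟶ P)
    (p : K.obj P ⟶ P') :
    (Q.map a ⊗ₘ Q.map b) ≫ μ (K ⋙ Q) A B ≫ (K ⋙ Q).map r ≫ Q.map p =
      μ Q A' B' ≫ Q.map ((a ⊗ₘ b) ≫ μ K A B ≫ K.map r ≫ p) := by
  simp

/-- The objects `F_i` of the reduced Temperley–Lieb category as images of the Jones–Wenzl
projections. -/
def RedTL.jwImages : JWImages (qRoot k) (mapCup (RedTL.ofPre k) (TLPre.cup k))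
    (mapCap (RedTL.ofPre k) (TLPre.cap k)) (RedTL.F k) (RedTL.unitF k) (RedTL.mulF k) :=
  JWImages.ofMap (RedTL.ofPre k) (qRoot k) (TLPre.cup k) (TLPre.cap k)
    (fun i => (toIdealQuotient (TL.KillRel k)).map (TL.F k i).decompId_i)
    (fun i => (toIdealQuotient (TL.KillRel k)).map (TL.F k i).decompId_p)
    (fun i => ((toIdealQuotient (TL.KillRel k)).map_comp _ _).symm.trans
      (congrArg (toIdealQuotient (TL.KillRel k)).map (TL.F k i).decompId.symm))
    (fun i => ((toIdealQuotient (TL.KillRel k)).map_comp _ _).symm.trans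
      (congrArg (toIdealQuotient (TL.KillRel k)).map
        (Karoubi.hom_ext _ _ (TL.F k i).idem)))
    (((toIdealQuotient (TL.KillRel k)).map_comp _ _).symm.trans
      ((congrArg (toIdealQuotient (TL.KillRel k)).map (TL.unitF_decompId_i k)).trans
        (Category.id_comp _).symm))
    (fun i j => by
      refine (congrArg (toIdealQuotient (TL.KillRel k)).map (TL.mulF_eq k i j)).trans ?_
      refine Eq.trans ?_ (tensorHom_μ_comp (TL.ofPre k) (toIdealQuotient (TL.KillRel k)) _ _ _ _).symm
      -- The tensorator of the quotient functor is the identity.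
      exact (Category.id_comp _).symm)

/-- The projection factors through F_{k+1}, whose identity is zero in the quotient. -/
theorem RedTL.jw_eq_zero : jw (qRoot k) (mapCup (RedTL.ofPre k) (TLPre.cup k))
    (mapCap (RedTL.ofPre k) (TLPre.cap k)) (k + 1) = 0 := by
  have h : 𝟙 (RedTL.F k (k + 1)) = 0 :=
    CategoryTheory.Quotient.sound (idealRel (TL.KillRel k)) (by
      have h : TensorIdeal (TL.KillRel k) (𝟙 (TL.F k (k + 1)) - 0) := by
        rw [sub_zero]
        exact .of _ .mk
      exact h)
  have R := RedTL.jwImages k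
  rw [← R.p_ι, ← Category.comp_id (R.p (k + 1)), h, comp_zero, zero_comp]

theorem RedTL.isFrobeniusGraded : IsFrobeniusGraded k (RedTL.unitF k) (RedTL.mulF k) :=
  (RedTL.jwImages k).isFrobeniusGraded ((TLPre.tlObject k).map (RedTL.ofPre k)) (RedTL.jw_eq_zero k)

/-- The generating object is its own dual. -/
instance TLPre.ptExactPairing : ExactPairing (TLPre.pt k) (TLPre.pt k) where
  coevaluation' := TLPre.cup k
  evaluation' := TLPre.cap k
  coevaluation_evaluation' := TLPre.zigzag₁ k
  evaluation_coevaluation' := TLPre.zigzag₂ k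

theorem nonempty_hasRightDual_tpow {C : Type*} [Category C] [MonoidalCategory C] (X : C)
    [HasRightDual X] : ∀ n, Nonempty (HasRightDual (tpow X n))
  | 0 => ⟨(inferInstance : HasRightDual (𝟙_ C))⟩
  | n + 1 => by
    obtain ⟨_⟩ := nonempty_hasRightDual_tpow X n
    exact ⟨hasRightDualTensor (X := tpow X n) (Y := X)⟩

theorem nonempty_hasRightDual_map {C D : Type*} [Category C] [MonoidalCategory C] [Category D]
    [MonoidalCategory D] (G : C ⥤ D) [G.Monoidal] (A : C) [HasRightDual A] :
    Nonempty (HasRightDual (G.obj A)) :=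
  ⟨@HasRightDual.mk _ _ _ (G.obj A) (G.obj Aᘁ) (mapExactPairing G A Aᘁ)⟩

/-- F_i is a retract of the i-th power of the self-dual generator. The argument takes place before
passing to the quotient, in a category whose idempotents split by construction; the quotient functor
then carries the dual along. -/
theorem TL.nonempty_hasRightDual_F (i : ℕ) : Nonempty (HasRightDual (TL.F k i)) := by
  have : HasRightDual (TLPre.pt k) := ⟨TLPre.pt k⟩
  obtain ⟨_⟩ := nonempty_hasRightDual_tpow (TLPre.pt k) i
  obtain ⟨_⟩ := nonempty_hasRightDual_map (TL.ofPre k) (tpow (TLPre.pt k) i)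
  exact nonempty_hasRightDual_of_retract (A := (TL.ofPre k).obj (tpow (TLPre.pt k) i))
    (TL.F k i).decompId_i (TL.F k i).decompId_p (TL.F k i).decompId.symm

theorem RedTL.nonempty_hasRightDual_F (i : ℕ) : Nonempty (HasRightDual (RedTL.F k i)) := by
  obtain ⟨_⟩ := TL.nonempty_hasRightDual_F k i
  exact nonempty_hasRightDual_map (toIdealQuotient (TL.KillRel k)) (TL.F k i)

theorem RedTL.nonempty_hasRightDual_Sig : Nonempty (HasRightDual (RedTL.Sig k)) := by
  have : ∀ i : Fin (k + 1), HasRightDual (RedTL.F k i) := fun i =>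
    (RedTL.nonempty_hasRightDual_F k i).some
  exact nonempty_hasRightDual_biproduct fun i : Fin (k + 1) => RedTL.F k i

end Level

end

end TLJ

theorem lemma3p21 (k : ℕ) (hk : 1 ≤ k) :
    ∃ _ : MonObj (TLJ.RedTL.Sig k),
      MonObj.one (X := TLJ.RedTL.Sig k) = TLJ.RedTL.sigUnit k ∧
      MonObj.mul (X := TLJ.RedTL.Sig k) = TLJ.RedTL.sigMul k ∧
      Nonempty (HasRightDual (TLJ.RedTL.Sig k)) ∧
      ∀ _ : HasRightDual (TLJ.RedTL.Sig k),
        TLJ.IsFrobeniusStructure (TLJ.RedTL.Sig k) (TLJ.RedTL.F k k) (TLJ.RedTL.sigProj k) :=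
  -- The truncated sum, its unit, multiplication and projection are written so as to unfold to Σ, u,
  -- m and n, hence the agreement by definition.
  ⟨(TLJ.RedTL.isFrobeniusGraded k).monObj, rfl, rfl, TLJ.RedTL.nonempty_hasRightDual_Sig k,
    fun d => letI : HasRightDual (TLJ.truncSum (TLJ.RedTL.F k) k) := d
      (TLJ.RedTL.isFrobeniusGraded k).isFrobeniusStructure⟩
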